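/- Throughout, $G=(V,E)$ is a finite connected graph on $n=|V|\ge 1$ vertices. Given a set $S\subseteq V$ of initially colored vertices, first color every neighbor of a vertex of $S$; then, as long as possible, whenever a colored vertex has exactly one uncolored neighbor, color that neighbor. $S$ is a connected power dominating set if all vertices become colored and $G[S]$ is connected; $\gamma_{P,c}(G)$ is the minimum size of such a set. $G$ is a cactus if any two different cycles of $G$ have at most one common vertex. A pendant path attached to a vertex $v$ of degree at least $3$ is (the vertex set $P$ of) a connected component of $G-v$ which induces a path in $G$ and contains exactly one neighbor of $v$, that neighbor being an end of the path. Let $p(v)=1$ if $v$ is a cut vertex which belongs to a pendant path, and otherwise let $p(v)$ be the number of pendant paths attached to $v$. Let $R_1(G)$ be the set of the vertices $v$ such that $G-v$ has exactly two components and $p(v)=1$. A segment of a cycle $C$ is the set of vertices strictly between $u$ and $v$ on the way around $C$ (in a fixed direction) from $u$ to $v$, where $u,v\in C$ and $u=v$ is allowed (giving $C\setminus\{u\}$). A segment is feasible if it is disjoint from some connected power dominating set of $G$; $s(C)$ is the maximum size of a feasible segment of $C$. Theorem. (1) Let $G$ be a connected cactus graph, $C_1,\dots,C_k$ the vertex sets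 of the cycles of $G$, and $P_1,\dots,P_\ell$ the vertex sets of the pendant paths of $G$. Then $$\gamma_{P,c}(G)=\begin{cases}1 & \text{if } G \text{ is a cycle or a path},\\ n-\sum_{i=1}^{\ell}|P_i|-\sum_{i=1}^{k}s(C_i) & \text{otherwise.}\end{cases}$$ Moreover, a segment of a cycle $C_i$ is feasible if and only if it contains no cut vertex of $G$, or exactly one cut vertex, which is in $R_1(G)$, or exactly two cut vertices, which are adjacent and both in $R_1(G)$. (2) $\gamma_{P,c}(G)$ can be computed in $O(n)$ time for connected cactus graphs: there are a program for a random access machine (registers and random access arrays of natural numbers, initially zero outside the input; operations: constants, copying, indirect reading and writing, increment, truncated decrement, comparison, conditionals and while loops, all at unit cost) and a constant $c$ such that, for every connected cactus graph $G$ with vertex set $\{0,\dots,n-1\}$, given by its order and its adjacency lists (stored consecutively in an array, each list in arbitrary order, with the array of their starting positions), the program halts after at most $cn$ steps with $\gamma_{P,c}(G)$ as its output. -/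

import Mathlib

universe u

namespace CactusPD

section Graphs

variable {V : Type u}

/-! ### Connected power domination -/

/-- The vertices that become coloured when `S` is coloured initially: first every vertex of the
closed neighbourhood of `S` is coloured (rule 1, applied once); then, repeatedly, whenever a
coloured vertex has exactly one uncoloured neighbour, that neighbour becomes coloured (rule 2). -/
inductive Observed (G : SimpleGraph V) (S : Set V) : V → Prop
  | self {v : V} : v ∈ S → Observed G S v
  | dominate {v w : V} : v ∈ S → G.Adj v w → Observed G S w
  | force {v w : V} : Observed G S v → G.Adj v w →
      (∀ x, G.Adj v x → x ≠ w → Observed G S x) → Observed G S w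

def IsPowerDominating (G : SimpleGraph V) (S : Set V) : Prop :=
  ∀ v, Observed G S v

def IsConnPowerDominating (G : SimpleGraph V) (S : Set V) : Prop :=
  IsPowerDominating G S ∧ (G.induce S).Connected

/-- The minimum size of a connected power dominating set (of a finite connected graph; such a
set exists by `exists_isConnPowerDominating`). -/
noncomputable def connPowerDomNumber (G : SimpleGraph V) : ℕ :=
  sInf {k | ∃ S : Finset V, IsConnPowerDominating G (S : Set V) ∧ S.card = k}

theorem exists_isConnPowerDominating [Fintype V] {G : SimpleGraph V} (hG : G.Connected) :
    ∃ S : Finset V, IsConnPowerDominating G (S : Set V) ∧ S.card = connPowerDomNumber G := by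
  have h : {k | ∃ S : Finset V, IsConnPowerDominating G (S : Set V) ∧ S.card = k}.Nonempty := by
    refine ⟨_, Finset.univ, ⟨fun v => .self (by simp), ?_⟩, rfl⟩
    rw [Finset.coe_univ]
    exact (SimpleGraph.induceUnivIso G).connected_iff.mpr hG
  exact Nat.sInf_mem h

/-! ### Paths, cycles, cactus graphs -/

/-- `G ≃ P_n` for some `n`. -/
def IsPathGraph (G : SimpleGraph V) : Prop :=
  ∃ n : ℕ, Nonempty (G ≃g SimpleGraph.pathGraph n)

/-- `G ≃ C_n` for some `n ≥ 3`. -/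
def IsCycleGraph (G : SimpleGraph V) : Prop :=
  ∃ n : ℕ, 3 ≤ n ∧ Nonempty (G ≃g SimpleGraph.cycleGraph n)

/-- Any two different cycles (as subgraphs) have at most one common vertex. -/
def IsCactus (G : SimpleGraph V) : Prop :=
  ∀ (a b : V) (p : G.Walk a a) (q : G.Walk b b), p.IsCycle → q.IsCycle →
    p.toSubgraph ≠ q.toSubgraph → (p.toSubgraph.verts ∩ q.toSubgraph.verts).Subsingleton

/-- `C` is the vertex set of a cycle of `G`. -/
def IsCycleSet (G : SimpleGraph V) (C : Finset V) : Prop :=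
  ∃ (a : V) (p : G.Walk a a), p.IsCycle ∧ ∀ w, w ∈ C ↔ w ∈ p.support

open Classical in
/-- The vertex sets `C₁, …, C_k` of the cycles of `G`. -/
noncomputable def cycleSets [Fintype V] (G : SimpleGraph V) : Finset (Finset V) :=
  Finset.univ.filter fun C => IsCycleSet G C

/-! ### Cut vertices and pendant paths -/

/-- The number `c(G)` of connected components. -/
noncomputable def numComponents {W : Type u} (G : SimpleGraph W) : ℕ :=
  Nat.card G.ConnectedComponent

/-- `G - v`. -/
abbrev deleteVertex (G : SimpleGraph V) (v : V) : SimpleGraph ({v}ᶜ : Set V) :=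
  G.induce ({v}ᶜ : Set V)

def IsCutVertex (G : SimpleGraph V) (v : V) : Prop :=
  numComponents G < numComponents (deleteVertex G v)

/-- `P` is (the vertex set of) a pendant path attached to `v`: `v` has degree at least `3`, `P` is
a connected component of `G - v`, `G[P]` is a path, and exactly one vertex of `P` is adjacent to
`v`, namely an end of that path (the vertex number `0`). -/
def IsPendantPathAt (G : SimpleGraph V) (v : V) (P : Finset V) : Prop :=
  3 ≤ (G.neighborSet v).ncard ∧
  (∃ K : (deleteVertex G v).ConnectedComponent, (P : Set V) = Subtype.val '' K.supp) ∧
  ∃ (m : ℕ) (φ : G.induce (P : Set V) ≃g SimpleGraph.pathGraph (m + 1)),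
    ∀ x : (P : Set V), G.Adj v x ↔ φ x = 0

def IsPendantPath (G : SimpleGraph V) (P : Finset V) : Prop :=
  ∃ v, IsPendantPathAt G v P

open Classical in
/-- The vertex sets `P₁, …, P_ℓ` of the pendant paths of `G`. -/
noncomputable def pendantPaths [Fintype V] (G : SimpleGraph V) : Finset (Finset V) :=
  Finset.univ.filter fun P => IsPendantPath G P

open Classical in
/-- `p(v)`: the number of pendant paths attached to `v`, except that `p(v) = 1` if `v` is a cut
vertex which belongs to a pendant path. -/
noncomputable def numPendant (G : SimpleGraph V) (v : V) : ℕ :=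
  if IsCutVertex G v ∧ ∃ P, IsPendantPath G P ∧ v ∈ P then 1
  else {P : Finset V | IsPendantPathAt G v P}.ncard

/-- The set `R₁(G)` of the vertices `v` with `c(G - v) = 2` and `p(v) = 1`. -/
def R1 (G : SimpleGraph V) : Set V :=
  {v | numComponents (deleteVertex G v) = 2 ∧ numPendant G v = 1}

/-! ### Segments of a cycle -/

/-- `S` is a segment `(a ↪ b)` of the cycle with vertex set `C`: for a closed walk `p` around the
cycle that starts in `a` and has `b` at position `k`, `S` consists of the vertices strictly
between `a` and `b`. For `k = 1` this is the empty segment, for `k = p.length` it is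
`(a ↪ a) = C \ {a}`. Walks in both directions are allowed; as `(a ↪ b)` in one direction
is `(b ↪ a)` in the other one, this does not change the family of all segments. -/
def IsSegment (G : SimpleGraph V) (C S : Finset V) : Prop :=
  ∃ (a : V) (p : G.Walk a a) (k : ℕ), p.IsCycle ∧ (∀ w, w ∈ C ↔ w ∈ p.support) ∧
    1 ≤ k ∧ k ≤ p.length ∧ ∀ w, w ∈ S ↔ ∃ i, 0 < i ∧ i < k ∧ p.getVert i = w

/-- `S` can be excluded from a connected power dominating set of `G`. -/
def IsFeasible (G : SimpleGraph V) (S : Finset V) : Prop :=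
  ∃ R : Set V, IsConnPowerDominating G R ∧ Disjoint R (S : Set V)

open Classical in
/-- `s(C)`: the maximum size of a feasible segment of `C`. -/
noncomputable def maxFeasible [Fintype V] (G : SimpleGraph V) (C : Finset V) : ℕ :=
  (Finset.univ.filter fun S : Finset V => IsSegment G C S ∧ IsFeasible G S).sup Finset.card

/-- `S` contains no cut vertex, or exactly one cut vertex, which is in `R₁(G)`, or exactly two cut
vertices, which are adjacent and both in `R₁(G)`. -/
def CutVertexCondition (G : SimpleGraph V) (S : Finset V) : Prop :=
  {w | w ∈ S ∧ IsCutVertex G w} = ∅ ∨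
  (∃ x ∈ R1 G, {w | w ∈ S ∧ IsCutVertex G w} = {x}) ∨
  ∃ x ∈ R1 G, ∃ y ∈ R1 G, G.Adj x y ∧ {w | w ∈ S ∧ IsCutVertex G w} = {x, y}

end Graphs

/-! ### A random access machine

Programs act on registers and on random access arrays that hold natural numbers; a program
mentions only finitely many of them. The only arithmetical operations are `x + 1` and
`x - 1`, so within `t` steps all numbers and addresses stay below `t` plus the
largest number in the input or the program, and unit cost per elementary operation is realistic. -/

structure Store where
  reg : ℕ → ℕ
  arr : ℕ → ℕ → ℕ

inductive Expr
  | const (k : ℕ)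
  | reg (i : ℕ)
  | read (a : ℕ) (e : Expr)
  | succ (e : Expr)
  | pred (e : Expr)

def Expr.eval (σ : Store) : Expr → ℕ
  | .const k => k
  | .reg i => σ.reg i
  | .read a e => σ.arr a (e.eval σ)
  | .succ e => e.eval σ + 1
  | .pred e => e.eval σ - 1

/-- The number of elementary operations in the evaluation of an expression. -/
def Expr.cost : Expr → ℕ
  | .const _ => 1
  | .reg _ => 1
  | .read _ e => e.cost + 1
  | .succ e => e.cost + 1
  | .pred e => e.cost + 1

inductive Test
  | eq (e f : Expr)
  | lt (e f : Expr)

def Test.holds (σ : Store) : Test → Prop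
  | .eq e f => e.eval σ = f.eval σ
  | .lt e f => e.eval σ < f.eval σ

def Test.cost : Test → ℕ
  | .eq e f => e.cost + f.cost + 1
  | .lt e f => e.cost + f.cost + 1

inductive Prog
  | skip
  | assign (i : ℕ) (e : Expr)
  | write (a : ℕ) (e f : Expr)
  | seq (P Q : Prog)
  | ite (b : Test) (P Q : Prog)
  | while (b : Test) (P : Prog)

def Store.setReg (σ : Store) (i x : ℕ) : Store :=
  { σ with reg := Function.update σ.reg i x }

def Store.setArr (σ : Store) (a j x : ℕ) : Store :=
  { σ with arr := Function.update σ.arr a (Function.update (σ.arr a) j x) }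

/-- `Exec P σ τ t`: started in the store `σ`, the program `P` halts in the store `τ` after
exactly `t` steps. -/
inductive Exec : Prog → Store → Store → ℕ → Prop
  | skip (σ : Store) : Exec .skip σ σ 1
  | assign (σ : Store) (i : ℕ) (e : Expr) :
      Exec (.assign i e) σ (σ.setReg i (e.eval σ)) (e.cost + 1)
  | write (σ : Store) (a : ℕ) (e f : Expr) :
      Exec (.write a e f) σ (σ.setArr a (e.eval σ) (f.eval σ)) (e.cost + f.cost + 1)
  | seq {P Q : Prog} {σ τ ρ : Store} {s t : ℕ} :
      Exec P σ τ s → Exec Q τ ρ t → Exec (.seq P Q) σ ρ (s + t)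
  | ite_true {b : Test} {P Q : Prog} {σ τ : Store} {t : ℕ} :
      b.holds σ → Exec P σ τ t → Exec (.ite b P Q) σ τ (b.cost + t)
  | ite_false {b : Test} {P Q : Prog} {σ τ : Store} {t : ℕ} :
      ¬ b.holds σ → Exec Q σ τ t → Exec (.ite b P Q) σ τ (b.cost + t)
  | while_true {b : Test} {P : Prog} {σ τ ρ : Store} {s t : ℕ} :
      b.holds σ → Exec P σ τ s → Exec (.while b P) τ ρ t →
      Exec (.while b P) σ ρ (b.cost + s + t)
  | while_false {b : Test} {P : Prog} {σ : Store} :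
      ¬ b.holds σ → Exec (.while b P) σ σ b.cost

/-- `adj` lists, for each vertex `v`, the neighbours of `v` once each, in some order. -/
def IsAdjacencyList {n : ℕ} (G : SimpleGraph (Fin n)) (adj : Fin n → List (Fin n)) : Prop :=
  ∀ v, (adj v).Nodup ∧ ∀ w, w ∈ adj v ↔ G.Adj v w

/-- The store that holds a graph with vertex set `{0, …, n - 1}` as adjacency lists: register `0`
holds `n`, array `1` holds the concatenation of the lists of the vertices `0, 1, …, n - 1`,
and array `0` holds at `v ≤ n` the position in array `1` where the list of `v` starts (for
`v = n`: the total length). All other words are `0`. -/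
def inputStore {n : ℕ} (adj : Fin n → List (Fin n)) : Store where
  reg i := if i = 0 then n else 0
  arr a j :=
    if a = 0 then
      if j ≤ n then ∑ v : Fin n, if v.val < j then (adj v).length else 0 else 0
    else if a = 1 then ((List.ofFn adj).flatten.map Fin.val).getD j 0
    else 0

end CactusPD

open CactusPD

/-! A cycle of a cactus has no ears: once its edges are deleted, its vertices lie in different
components. Hence every vertex of `G` has a unique attachment point on each cycle, and `G` looks
like a ring of branches (`IsRing`, `IsCactus.exists_isRing`).

Lower bound. A fort is a set such that no vertex outside has exactly one neighbour in it; rule 2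
never enters a fort (`IsPowerDominating.notMem_of_fort`). Let `R` be a connected power dominating
set. Forts show that `R` meets every cycle, that a missed cut vertex on a cycle carries just one
pendant path (`IsRing.mem_R1_of_notMem`), that two missed cut vertices in a missed arc are
consecutive (`IsRing.arcCondition_of_disjoint`), and that a missed vertex on no cycle belongs to a
pendant path (`mem_pendantPath_of_notMem`). Connectivity shows that the missed part of a cycle is
one segment (`IsRing.exists_arc`). So `R`, the pendant paths and one feasible segment for each cycle
cover all vertices.

Upper bound. All pendant paths are removed, and from each cycle a segment that satisfies the
condition on cut vertices. These sets are disjoint, the rest is connected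
(`remaining_preconnected`), and it colours everything (`remaining_isPowerDominating`): colour runs
into each segment from both ends, the two waves meet at the at most two cut vertices, and then the
pendant paths are coloured. The same construction shows that the condition suffices for feasibility
(`isFeasible_iff`).

Algorithm. Without a vertex of degree at least 3 the graph is a path or a cycle. Otherwise such a
vertex is the root of a breadth first search tree. The non-tree edges correspond to the cycles, and
a tree edge lies on at most one cycle, so the cycle lengths and the degrees have linear sums
(`sum_card_fundCycles_le`, `sum_degree_le`). Pendant vertices are recognised locally in reverse
search order, and this also classifies the vertices of each cycle. A longest admissible segment is
found by a scan that goes twice around the cycle (`IsRing.best_run_eq`). Programs are treated by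
rules for `Halts` that track the final store and the time. -/

namespace CactusPD
open SimpleGraph

/-! ### Cycles of a cactus and the branches at them -/

section Cycles

variable {V : Type u} {G : SimpleGraph V}

/-- `c` runs once around a cycle of `G`. -/
structure IsCyclic (G : SimpleGraph V) {k : ℕ} (c : ZMod k → V) : Prop where
  three_le : 3 ≤ k
  inj : Function.Injective c
  adj_succ : ∀ i, G.Adj (c i) (c (i + 1))

theorem IsCyclic.of_nat {k : ℕ} (hk : 3 ≤ k) (f : ℕ → V) (h0 : f k = f 0)
    (hinj : ∀ i < k, ∀ j < k, f i = f j → i = j) (hadj : ∀ i < k, G.Adj (f i) (f (i + 1))) :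
    IsCyclic G (fun i : ZMod k => f i.val) := by
  have : NeZero k := ⟨by omega⟩
  have : Fact (1 < k) := ⟨by omega⟩
  refine ⟨hk, fun i j hij => ZMod.val_injective k
    (hinj _ (ZMod.val_lt i) _ (ZMod.val_lt j) hij), fun i => ?_⟩
  have hi := ZMod.val_lt i
  have h := hadj _ hi
  by_cases hlt : i.val + 1 < k
  · have : (i + 1).val = i.val + 1 := by
      rw [ZMod.val_add_of_lt] <;> rw [ZMod.val_one]; exact hlt
    simpa [this] using h
  · have hk' : i.val + 1 = k := by omega
    have : (i + 1).val = 0 := by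
      rw [ZMod.val_add, ZMod.val_one, hk', Nat.mod_self]
    rw [hk', h0] at h
    simpa [this] using h

/-- The ends are variables tied to `f` by equations, so that the induction can shift `f` and the
ends need not be literally values of `f`. -/
theorem exists_walk_of_nat (f : ℕ → V) (n : ℕ) (hadj : ∀ i < n, G.Adj (f i) (f (i + 1))) (x y : V)
    (hx : x = f 0) (hy : y = f n) :
    ∃ p : G.Walk x y, p.length = n ∧ ∀ i ≤ n, p.getVert i = f i := by
  induction n generalizing f x with
  | zero => subst hx; subst hy; exact ⟨.nil, rfl, fun i hi => by simp [Nat.le_zero.mp hi]⟩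
  | succ n ih =>
    obtain ⟨p, hp, hv⟩ := ih (fun i => f (i + 1)) (fun i hi => hadj _ (by omega)) (f 1) rfl hy
    subst hx
    refine ⟨.cons (hadj 0 (by omega)) p, by simp [hp], fun i hi => ?_⟩
    cases i with
    | zero => simp
    | succ i => rw [Walk.getVert_cons_succ]; exact hv i (by omega)

theorem IsCyclic.exists_walk {k : ℕ} {c : ZMod k → V} (hc : IsCyclic G c) (a : ZMod k) :
    ∃ p : G.Walk (c a) (c a), p.IsCycle ∧ p.length = k ∧
      (∀ i : ℕ, i ≤ k → p.getVert i = c (a + i)) := by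
  have hk := hc.three_le
  have : NeZero k := ⟨by omega⟩
  obtain ⟨p, hp, hv⟩ := exists_walk_of_nat (G := G) (fun i : ℕ => c (a + (i + 1 : ℕ))) (k - 1)
    (fun i _ => by
      have := hc.adj_succ (a + (i + 1 : ℕ))
      push_cast at this ⊢; convert this using 2; ring) (c (a + 1)) (c a)
    (by simp) (by rw [Nat.sub_add_cancel (by omega)]; simp)
  have hinj : ∀ i j : ℕ, i < k → j < k → (i : ZMod k) = j → i = j := fun i j hi hj h => by
    have := congrArg ZMod.val h
    rwa [ZMod.val_natCast_of_lt hi, ZMod.val_natCast_of_lt hj] at this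
  have hpath : p.IsPath := by
    rw [← Walk.IsPath.getVert_injOn_iff]
    intro i hi j hj hij
    simp only [Set.mem_ofPred, hp] at hi hj
    rw [hv i hi, hv j hj] at hij
    have h1 := hc.inj hij
    push_cast at h1
    exact hinj i j (by omega) (by omega) (by simpa using h1)
  refine ⟨.cons (hc.adj_succ a) p, ?_, by simp [hp]; omega, fun i hi => ?_⟩
  · rw [Walk.cons_isCycle_iff]
    refine ⟨hpath, fun he => ?_⟩
    -- The first edge cannot recur on the path: vertex `i` of the path is `c (a + i + 1)`, so a
    -- recurrence makes `i + 1` a multiple of `k`, or forces `i = 0` and `k = 2`.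
    rw [← Walk.adj_toSubgraph_iff_mem_edges, Walk.toSubgraph_adj_iff] at he
    obtain ⟨i, hi, hlt⟩ := he
    rw [hv i (by omega), hv (i + 1) (by omega)] at hi
    rw [Sym2.eq_iff] at hi
    have h1 : ∀ m : ℕ, m ≤ k → ((m : ℕ) : ZMod k) = 0 → m = 0 ∨ m = k := fun m hm h => by
      rcases hm.lt_or_eq with h' | h'
      · exact .inl (hinj m 0 h' (by omega) (by simpa using h))
      · exact .inr h'
    rcases hi with ⟨h, h'⟩ | ⟨h, h'⟩
    · have h2 := hc.inj h
      have := h1 (i + 1) (by omega) (by push_cast at h2 ⊢; linear_combination h2)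
      omega
    · have h2 := hc.inj h
      have := hinj (i + 1) 1 (by omega) (by omega) (by push_cast at h2 ⊢; linear_combination h2)
      have h3 := hc.inj h'
      have := h1 (i + 2) (by omega) (by push_cast at h3 ⊢; linear_combination h3)
      omega
  · cases i with
    | zero => simp
    | succ i => rw [Walk.getVert_cons_succ, hv i (by omega)]

theorem IsCyclic.of_isCycle {a : V} {p : G.Walk a a} (hp : p.IsCycle) :
    IsCyclic G (fun i : ZMod p.length => p.getVert i.val) :=
  .of_nat hp.three_le_length p.getVert (by simp) (fun i hi j hj h =>
    hp.getVert_injOn' (by simp; omega) (by simp; omega) h) fun _ hi => p.adj_getVert_succ hi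

theorem mem_support_iff_of_getVert {k : ℕ} {c : ZMod k → V} (hk : 3 ≤ k) {x a : V}
    {p : G.Walk x x} {s : ZMod k} (hl : p.length = k)
    (hv : ∀ i : ℕ, i ≤ k → p.getVert i = c (s + i)) : a ∈ p.support ↔ ∃ i, c i = a := by
  have : NeZero k := ⟨by omega⟩
  rw [Walk.mem_support_iff_exists_getVert]
  constructor
  · rintro ⟨n, hn, hle⟩
    exact ⟨_, (hv n (hl ▸ hle)).symm.trans hn⟩
  · rintro ⟨i, rfl⟩
    refine ⟨(i - s).val, ?_, by rw [hl]; exact (ZMod.val_lt _).le⟩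
    rw [hv _ (ZMod.val_lt _).le]
    simp

/-- Two cycles of a cactus with two common vertices have the same edges. -/
theorem IsCactus.edges_subset (hG : IsCactus G) {k l : ℕ} {c : ZMod k → V} {d : ZMod l → V}
    (hc : IsCyclic G c) (hd : IsCyclic G d) {x y : V} (hxy : x ≠ y) (hxc : x ∈ Set.range c)
    (hyc : y ∈ Set.range c) (hxd : x ∈ Set.range d) (hyd : y ∈ Set.range d) (t : ZMod l) :
    ∃ i, s(d t, d (t + 1)) = s(c i, c (i + 1)) := by
  obtain ⟨p, hp, hpl, hpv⟩ := hc.exists_walk 0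
  obtain ⟨q, hq, hql, hqv⟩ := hd.exists_walk t
  have h : p.toSubgraph = q.toSubgraph := by
    by_contra hne
    refine hxy (hG _ _ p q hp hq hne ⟨?_, ?_⟩ ⟨?_, ?_⟩) <;> rw [Walk.mem_verts_toSubgraph]
    · exact (mem_support_iff_of_getVert hc.three_le hpl hpv).2 hxc
    · exact (mem_support_iff_of_getVert hd.three_le hql hqv).2 hxd
    · exact (mem_support_iff_of_getVert hc.three_le hpl hpv).2 hyc
    · exact (mem_support_iff_of_getVert hd.three_le hql hqv).2 hyd
  have h3 := hd.three_le
  have h1 := q.toSubgraph_adj_getVert (i := 0) (by omega)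
  rw [hqv 0 (by omega), hqv (0 + 1) (by omega), ← h, Walk.toSubgraph_adj_iff] at h1
  obtain ⟨i, hi, hlt⟩ := h1
  rw [hpv _ (by omega), hpv _ (by omega)] at hi
  refine ⟨(i : ZMod k), ?_⟩
  have hi' := hi.symm
  push_cast at hi'
  simp only [add_zero, zero_add] at hi'
  rw [← hi']

def cycleEdges {k : ℕ} (c : ZMod k → V) : Set (Sym2 V) :=
  {e | ∃ i, e = s(c i, c (i + 1))}

/-- A cycle of a cactus has no ears. -/
theorem IsCactus.eq_of_reachable (hG : IsCactus G) {k : ℕ} {c : ZMod k → V}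
    (hc : IsCyclic G c) {i j : ZMod k}
    (h : (G.deleteEdges (cycleEdges c)).Reachable (c i) (c j)) : i = j := by
  classical
  by_contra hij
  -- Among all walks off the cycle edges that join different cycle vertices a shortest one is taken;
  -- its interior then avoids the cycle.
  have hex : ∃ n, ∃ i j : ZMod k, i ≠ j ∧
      ∃ p : (G.deleteEdges (cycleEdges c)).Walk (c i) (c j), p.length = n := by
    obtain ⟨p⟩ := h
    exact ⟨_, i, j, hij, p, rfl⟩
  have hmin := @Nat.find_min _ _ hex
  obtain ⟨i, j, hij, p, hp⟩ := Nat.find_spec hex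
  set m := Nat.find hex with hm
  have hle : m ≤ p.bypass.length := by
    by_contra hlt
    exact hmin (not_le.mp hlt) ⟨i, j, hij, _, rfl⟩
  have hql : p.bypass.length = m := le_antisymm (hp ▸ p.length_bypass_le_length) hle
  have hqp := p.bypass_isPath
  generalize p.bypass = q at hql hqp
  clear hle hp p
  have hint : ∀ t, 0 < t → t < m → ∀ l, q.getVert t ≠ c l := by
    intro t ht0 htm l hl
    by_cases hil : l = i
    · subst hil
      refine hmin (m := m - t) (by omega) ⟨l, j, hij, (q.drop t).copy hl rfl, ?_⟩
      simp [hql]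
    · refine hmin (m := t) htm ⟨i, l, Ne.symm hil, (q.take t).copy rfl hl, ?_⟩
      simp [hql]; omega
  have hm0 : 0 < m := by
    rw [← hql]
    rcases Nat.eq_zero_or_pos q.length with h0 | h0
    · exact absurd (hc.inj (Walk.eq_of_length_eq_zero h0)) hij
    · exact h0
  have h3 := hc.three_le
  have : NeZero k := ⟨by omega⟩
  -- The ear from `c i` to `c j` is closed by the arc of length `d` that leads from `c j` forward to
  -- `c i`.
  set d := (i - j).val with hd
  have hdk : d < k := ZMod.val_lt _
  have hdc : (d : ZMod k) = i - j := by simp [hd]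
  have hd0 : 0 < d := by
    rcases Nat.eq_zero_or_pos d with h0 | h0
    · rw [h0] at hdc; simp only [Nat.cast_zero] at hdc
      exact absurd (sub_eq_zero.mp hdc.symm) hij
    · exact h0
  have hfirst := q.adj_getVert_succ (i := 0) (by omega)
  rw [deleteEdges_adj] at hfirst
  have hmd : 3 ≤ m + d := by
    by_contra hlt
    have hm1 : m = 1 := by omega
    have hd1 : d = 1 := by omega
    apply hfirst.2
    refine ⟨j, ?_⟩
    have e1 : q.getVert (0 + 1) = c j := by
      have := q.getVert_length
      rw [hql, hm1] at this; exact this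
    rw [q.getVert_zero, e1, Sym2.eq_swap]
    rw [hd1] at hdc; push_cast at hdc
    rw [hdc]; simp
  let f : ℕ → V := fun t => if t ≤ m then q.getVert t else c (j + (t - m : ℕ))
  have hf1 : ∀ t ≤ m, f t = q.getVert t := fun t ht => by simp [f, ht]
  have hf2 : ∀ t, m ≤ t → f t = c (j + (t - m : ℕ)) := fun t ht => by
    rcases ht.eq_or_lt with h | h
    · subst h
      have := q.getVert_length
      rw [hql] at this
      simp [f, this]
    · simp [f, not_le.mpr h]
  have hcast : ∀ a b : ℕ, a < k → b < k → (a : ZMod k) = b → a = b := fun a b ha hb h => by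
    have := congrArg ZMod.val h
    rwa [ZMod.val_natCast_of_lt ha, ZMod.val_natCast_of_lt hb] at this
  have hcross : ∀ a b : ℕ, a ≤ m → m < b → b < m + d → f a ≠ f b := by
    intro a b ha hb hb' hab
    rw [hf1 a ha, hf2 b hb.le] at hab
    rcases Nat.eq_zero_or_pos a with h0 | h0
    · subst h0
      rw [q.getVert_zero] at hab
      have h1 := hc.inj hab
      have := hcast d (b - m) hdk (by omega) (by rw [hdc]; linear_combination h1)
      omega
    · rcases ha.lt_or_eq with h1 | h1
      · exact hint a h0 h1 _ hab
      · have := q.getVert_length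
        rw [hql] at this
        rw [h1, this] at hab
        have h1 := hc.inj hab
        have := hcast (b - m) 0 (by omega) (by omega) (by push_cast; linear_combination -h1)
        omega
  have hcyc : IsCyclic G (fun t : ZMod (m + d) => f t.val) := by
    refine .of_nat hmd f ?_ ?_ ?_
    · rw [hf2 _ (by omega), hf1 0 (by omega), q.getVert_zero, Nat.add_sub_cancel_left, hdc]
      simp
    · intro a ha b hb hab
      rcases le_or_gt a m with h1 | h1 <;> rcases le_or_gt b m with h2 | h2
      · rw [hf1 a h1, hf1 b h2] at hab
        exact hqp.getVert_injOn (by simpa [hql] using h1) (by simpa [hql] using h2) hab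
      · exact absurd hab (hcross a b h1 h2 hb)
      · exact absurd hab.symm (hcross b a h2 h1 ha)
      · rw [hf2 a h1.le, hf2 b h2.le] at hab
        have h3 := hc.inj hab
        have := hcast (a - m) (b - m) (by omega) (by omega) (by linear_combination h3)
        omega
    · intro a ha
      rcases lt_or_ge a m with h1 | h1
      · rw [hf1 a h1.le, hf1 (a + 1) h1]
        exact (deleteEdges_adj.mp (q.adj_getVert_succ (by omega))).1
      · rw [hf2 a h1, hf2 (a + 1) (by omega)]
        have := hc.adj_succ (j + (a - m : ℕ))
        rw [Nat.sub_add_comm h1]; push_cast; rw [← add_assoc]; exact this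
  have : NeZero (m + d) := ⟨by omega⟩
  have : Fact (1 < m + d) := ⟨by omega⟩
  -- The two cycles share `c i` and `c j`, so the first edge of the ear is an edge of `c`, contrary
  -- to its choice.
  obtain ⟨l, hl⟩ := hG.edges_subset hc hcyc (hc.inj.ne hij) ⟨i, rfl⟩ ⟨j, rfl⟩
    ⟨0, by simp [f]⟩ ⟨(m : ZMod (m + d)), by
      show f _ = _
      rw [ZMod.val_natCast_of_lt (by omega), hf2 m le_rfl]; simp⟩ 0
  apply hfirst.2
  refine ⟨l, ?_⟩
  rw [← hl]
  simp only [zero_add, ZMod.val_zero, ZMod.val_one]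
  rw [hf1 0 (by omega), hf1 1 (by omega)]

/-- A chordless cycle together with the map that sends each vertex to the position on the
cycle of its attachment point; different branches at the cycle are not adjacent. -/
structure IsRing (G : SimpleGraph V) {k : ℕ} (c : ZMod k → V) (π : V → ZMod k) : Prop where
  three_le : 3 ≤ k
  adj_succ : ∀ i, G.Adj (c i) (c (i + 1))
  proj : ∀ i, π (c i) = i
  adj : ∀ v w, G.Adj v w → π v = π w ∨
    (v = c (π v) ∧ w = c (π w) ∧ (π w = π v + 1 ∨ π v = π w + 1))

/-- The attachment point of `v` is the cycle vertex in its component after the cycle edges are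
deleted; it is unique by `IsCactus.eq_of_reachable`. Edges that survive the deletion keep the
attachment point, and all others are cycle edges. -/
theorem IsCactus.exists_isRing (hG : IsCactus G) (hconn : G.Connected) {k : ℕ} {c : ZMod k → V}
    (hc : IsCyclic G c) : ∃ π, IsRing G c π := by
  classical
  set H := G.deleteEdges (cycleEdges c) with hH
  have hex : ∀ v, ∃ i, H.Reachable v (c i) := by
    intro v
    obtain ⟨p⟩ := hconn.preconnected v (c 0)
    generalize hx : c 0 = x at p
    induction p with
    | nil => exact ⟨0, hx ▸ .rfl⟩
    | @cons v w _ h p ih =>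
      obtain ⟨i, hi⟩ := ih hx
      by_cases he : s(v, w) ∈ cycleEdges c
      · obtain ⟨j, hj⟩ := he
        rcases Sym2.eq_iff.mp hj with ⟨h1, -⟩ | ⟨h1, -⟩
        · exact ⟨j, h1 ▸ .rfl⟩
        · exact ⟨j + 1, h1 ▸ .rfl⟩
      · have : H.Adj v w := deleteEdges_adj.mpr ⟨h, he⟩
        exact ⟨i, this.reachable.trans hi⟩
  choose π hπ using hex
  have huniq : ∀ v i, H.Reachable v (c i) → π v = i := fun v i h =>
    hG.eq_of_reachable hc ((hπ v).symm.trans h)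
  have hproj : ∀ i, π (c i) = i := fun i => huniq _ _ .rfl
  refine ⟨π, hc.three_le, hc.adj_succ, hproj, fun v w h => ?_⟩
  by_cases he : s(v, w) ∈ cycleEdges c
  · obtain ⟨j, hj⟩ := he
    rcases Sym2.eq_iff.mp hj with ⟨rfl, rfl⟩ | ⟨rfl, rfl⟩ <;> simp [hproj]
  · have : H.Adj v w := deleteEdges_adj.mpr ⟨h, he⟩
    exact .inl (huniq _ _ (this.reachable.trans (hπ w)))

theorem IsRing.inj {k : ℕ} {c : ZMod k → V} {π : V → ZMod k} (h : IsRing G c π) :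
    Function.Injective c := fun i j hij => by rw [← h.proj i, hij, h.proj]

theorem IsRing.isCyclic {k : ℕ} {c : ZMod k → V} {π : V → ZMod k} (h : IsRing G c π) :
    IsCyclic G c := ⟨h.three_le, h.inj, h.adj_succ⟩

theorem IsRing.adj_iff {k : ℕ} {c : ZMod k → V} {π : V → ZMod k} (h : IsRing G c π)
    (i j : ZMod k) : G.Adj (c i) (c j) ↔ j = i + 1 ∨ i = j + 1 := by
  constructor
  · intro ha
    rcases h.adj _ _ ha with h1 | ⟨-, -, h1⟩
    · rw [h.proj, h.proj] at h1; subst h1; exact absurd ha (G.loopless.irrefl _)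
    · simpa [h.proj] using h1
  · rintro (rfl | rfl)
    · exact h.adj_succ i
    · exact (h.adj_succ j).symm

end Cycles

/-! ### Forts, tails and pendant paths -/

section Tails

variable {V : Type u} {G : SimpleGraph V}

/-- No vertex outside the fort `F` has exactly one neighbour in it, so rule 2 cannot enter. All
obstructions to colouring below are forts. -/
theorem IsPowerDominating.notMem_of_fort {S F : Set V} (hS : IsPowerDominating G S)
    (h1 : ∀ v ∈ S, v ∉ F) (h2 : ∀ v ∈ S, ∀ w, G.Adj v w → w ∉ F)
    (h3 : ∀ v, v ∉ F → ∀ w ∈ F, G.Adj v w → ∃ x ∈ F, x ≠ w ∧ G.Adj v x) (v : V) : v ∉ F := by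
  induction hS v with
  | self h => exact h1 _ h
  | dominate h ha => exact h2 _ h _ ha
  | force _ ha _ ih ih' =>
    intro hw
    obtain ⟨x, hx, hne, hax⟩ := h3 _ ih _ hw ha
    exact ih' x hax hne hx

/-- `l` lists the vertices of a path that hangs at `v`, starting with the neighbour of `v`. -/
inductive IsTail (G : SimpleGraph V) : V → List V → Prop
  | leaf {v y : V} : (∀ z, G.Adj y z ↔ z = v) → IsTail G v [y]
  | cons {v y x : V} {l : List V} : v ≠ x → (∀ z, G.Adj y z ↔ z = v ∨ z = x) →
      IsTail G y (x :: l) → IsTail G v (y :: x :: l)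

namespace IsTail

variable {v y x : V} {l : List V}

theorem mem_or_eq (h : IsTail G v l) : ∀ z ∈ l, ∀ w, G.Adj z w → w ∈ l ∨ w = v := by
  induction h with
  | leaf h => intro z hz w hw; rw [List.mem_singleton] at hz; subst hz; exact .inr ((h w).1 hw)
  | cons hne h ht ih =>
    intro z hz w hw
    rcases List.mem_cons.1 hz with rfl | hz
    · rcases (h w).1 hw with rfl | rfl <;> simp
    · rcases ih z hz w hw with h | h <;> simp [h]

/-- One induction for three claims: absence of repetitions needs that the attachment vertex is off
the list, which in turn needs that it sees only the first vertex. -/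
theorem aux (h : IsTail G v l) : v ∉ l ∧ l.Nodup ∧ ∀ z ∈ l, G.Adj v z → l.head? = some z := by
  induction h with
  | @leaf v y h =>
    have : G.Adj y v := (h v).2 rfl
    simpa using this.ne.symm
  | @cons v y x l hne h ht ih =>
    obtain ⟨h1, h2, h3⟩ := ih
    have hv : v ∉ x :: l := fun hm => by
      have := h3 v hm ((h v).2 (.inl rfl))
      simp only [List.head?_cons, Option.some.injEq] at this
      exact hne this.symm
    have hvy : v ≠ y := ((h v).2 (.inl rfl)).ne.symm
    refine ⟨fun hm => ?_, List.nodup_cons.2 ⟨h1, h2⟩, fun z hz ha => ?_⟩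
    · rcases List.mem_cons.1 hm with h | h
      · exact hvy h
      · exact hv h
    · rcases List.mem_cons.1 hz with rfl | hz
      · simp
      · rcases ht.mem_or_eq z hz v ha.symm with h | h
        · exact absurd h hv
        · exact absurd h hvy

theorem notMem (h : IsTail G v l) : v ∉ l := h.aux.1

theorem nodup (h : IsTail G v l) : l.Nodup := h.aux.2.1

theorem ne_nil (h : IsTail G v l) : l ≠ [] := by cases h <;> simp

theorem adj_head (h : IsTail G v (y :: l)) : G.Adj v y := by
  cases h with
  | leaf h => exact ((h v).2 rfl).symm
  | cons _ h => exact ((h v).2 (.inl rfl)).symm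

theorem eq_head (h : IsTail G v (y :: l)) {z : V} (hz : z ∈ y :: l) (ha : G.Adj v z) : z = y := by
  simpa using (h.aux.2.2 z hz ha).symm

theorem ncard_le (h : IsTail G v l) : ∀ z ∈ l, (G.neighborSet z).ncard ≤ 2 := by
  induction h with
  | @leaf v y h =>
    intro z hz
    rw [List.mem_singleton] at hz; subst hz
    have : G.neighborSet z = {v} := by ext w; simpa using h w
    simp [this]
  | @cons v y x l _ h _ ih =>
    intro z hz
    rcases List.mem_cons.1 hz with rfl | hz
    · have : G.neighborSet z = {v, x} := by ext w; simpa using h w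
      rw [this]; exact Set.ncard_insert_le _ _ |>.trans (by simp)
    · exact ih z hz

theorem isChain (h : IsTail G v l) : l.IsChain G.Adj := by
  induction h with
  | leaf h => simp
  | cons _ h _ ih => exact List.IsChain.cons_cons ((h _).2 (.inr rfl)) ih

theorem adj_getElem (h : IsTail G v l) : ∀ i j (hi : i < l.length) (hj : j < l.length),
    G.Adj l[i] l[j] ↔ i + 1 = j ∨ j + 1 = i := by
  induction h with
  | leaf h =>
    intro i j hi hj
    simp only [List.length_singleton] at hi hj
    simp [Nat.lt_one_iff.1 hi, Nat.lt_one_iff.1 hj]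
  | @cons v y x l _ h ht ih =>
    have key : ∀ j (hj : j < (x :: l).length), G.Adj y (x :: l)[j] ↔ j = 0 := by
      intro j hj
      constructor
      · intro ha
        have h1 := ht.eq_head (List.getElem_mem hj) ha
        exact (ht.nodup.getElem_inj_iff (hj := by simp)).1 (h1.trans (by simp : x = (x :: l)[0]))
      · rintro rfl
        exact ht.adj_head
    intro i j hi hj
    cases i with
    | zero =>
      cases j with
      | zero => simp
      | succ j =>
        rw [List.getElem_cons_zero, List.getElem_cons_succ, key j (by simpa using hj)]; omega
    | succ i =>
      cases j with
      | zero =>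
        rw [List.getElem_cons_zero, List.getElem_cons_succ, G.adj_comm,
          key i (by simpa using hi)]; omega
      | succ j =>
        rw [List.getElem_cons_succ, List.getElem_cons_succ,
          ih i j (by simpa using hi) (by simpa using hj)]; omega

/-- Each tail vertex has at most one neighbour further down, so forcing runs to the leaf as soon as
`v` and its neighbours off the tail are coloured. -/
theorem observed {S : Set V} (h : IsTail G v l) (hv : Observed G S v)
    (hn : ∀ z, G.Adj v z → z ∉ l → Observed G S z) : ∀ z ∈ l, Observed G S z := by
  induction h with
  | @leaf v y h =>
    intro z hz
    rw [List.mem_singleton] at hz; subst hz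
    exact .force hv ((h v).2 rfl).symm fun w hw hne => hn w hw (by simpa using hne)
  | @cons v y x l hne h ht ih =>
    have hT : IsTail G v (y :: x :: l) := .cons hne h ht
    have hy : Observed G S y := .force hv hT.adj_head fun w hw hwy =>
      hn w hw fun hm => hwy (hT.eq_head hm hw)
    intro z hz
    rcases List.mem_cons.1 hz with rfl | hz
    · exact hy
    · refine ih hy (fun w hw hwl => ?_) z hz
      rcases (h w).1 hw with rfl | rfl
      · exact hv
      · simp at hwl

theorem of_nat (f : ℕ → V) (m : ℕ) (hm : 1 ≤ m)
    (hlast : ∀ z, G.Adj (f m) z ↔ z = f (m - 1))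
    (hmid : ∀ i, 1 ≤ i → i < m → f (i - 1) ≠ f (i + 1) ∧
      ∀ z, G.Adj (f i) z ↔ z = f (i - 1) ∨ z = f (i + 1)) (n : ℕ) (i : ℕ) (hi : i + n + 1 = m) :
    IsTail G (f i) ((List.range' (i + 1) (n + 1)).map f) := by
  induction n generalizing i with
  | zero =>
    have : m = i + 1 := by omega
    subst this
    exact .leaf (by simpa using hlast)
  | succ n ih =>
    have h := ih (i + 1) (by omega)
    obtain ⟨h1, h2⟩ := hmid (i + 1) (by omega) (by omega)
    exact .cons h1 (by simpa using h2) h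

end IsTail

theorem reachable_of_isChain {s : Set V} {y : V} {l : List V} (h : (y :: l).IsChain G.Adj)
    (hs : ∀ z ∈ y :: l, z ∈ s) (z : V) (hz : z ∈ y :: l) :
    (G.induce s).Reachable ⟨y, hs y (by simp)⟩ ⟨z, hs z hz⟩ := by
  induction l generalizing y with
  | nil => simp only [List.mem_singleton] at hz; subst hz; exact .rfl
  | cons x l ih =>
    rcases List.mem_cons.1 hz with rfl | hz
    · exact .rfl
    · rw [List.isChain_cons_cons] at h
      have : (G.induce s).Adj ⟨y, hs y (by simp)⟩ ⟨x, hs x (by simp)⟩ := h.1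
      exact this.reachable.trans (ih h.2 (fun w hw => hs w (by simp [hw])) hz)

/-- The form in which connectivity is mostly used: a set that no edge into `s` leaves contains the
component of each of its vertices. -/
theorem mem_of_reachable_induce {s A : Set V} (hA : ∀ z ∈ A, ∀ w, w ∈ s → G.Adj z w → w ∈ A)
    {a b : s} (h : (G.induce s).Reachable a b) (ha : (a : V) ∈ A) : (b : V) ∈ A := by
  obtain ⟨p⟩ := h
  induction p with
  | nil => exact ha
  | cons hadj _ ih => exact ih (hA _ ha _ (Subtype.property _) hadj)

theorem isPathGraph_of_list [Finite V] {L : List V} (hnd : L.Nodup) (hmem : ∀ v, v ∈ L)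
    (hadj : ∀ i j (hi : i < L.length) (hj : j < L.length),
      G.Adj L[i] L[j] ↔ i + 1 = j ∨ j + 1 = i) : IsPathGraph G := by
  classical
  refine ⟨L.length, ⟨RelIso.symm ⟨hnd.getEquivOfForallMemList L hmem, ?_⟩⟩⟩
  intro a b
  rw [pathGraph_adj]
  exact hadj a b a.2 b.2

theorem IsTail.isPendantPathAt {v : V} {l : List V} (h : IsTail G v l)
    (hdeg : 3 ≤ (G.neighborSet v).ncard) {P : Finset V} (hP : ∀ w, w ∈ P ↔ w ∈ l) :
    IsPendantPathAt G v P := by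
  classical
  obtain ⟨y, l, rfl⟩ : ∃ y l', l = y :: l' := List.exists_cons_of_ne_nil h.ne_nil
  have hs : ∀ z ∈ y :: l, z ∈ ({v}ᶜ : Set V) := fun z hz hzv => h.notMem (hzv ▸ hz)
  refine ⟨hdeg, ⟨(deleteVertex G v).connectedComponentMk ⟨y, hs y (by simp)⟩, ?_⟩, l.length, ?_⟩
  · ext z
    simp only [SetLike.mem_coe, hP, Set.mem_image, ConnectedComponent.mem_supp_iff,
      ConnectedComponent.eq]
    constructor
    · intro hz
      exact ⟨⟨z, hs z hz⟩, (reachable_of_isChain h.isChain hs z hz).symm, rfl⟩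
    · rintro ⟨w, hw, rfl⟩
      exact mem_of_reachable_induce (A := {z | z ∈ y :: l}) (fun z hz w hw ha =>
        (h.mem_or_eq z hz w ha).resolve_right hw) hw.symm (by simp)
  · let e : Fin (y :: l).length ≃ (P : Set V) :=
      (h.nodup.getEquiv (y :: l)).trans (Equiv.subtypeEquivRight fun w => by simp [hP])
    have he : ∀ i, (e i : V) = (y :: l)[i] := fun i => rfl
    refine ⟨RelIso.symm ⟨e, ?_⟩, fun x => ?_⟩
    · intro a b
      rw [pathGraph_adj]
      exact h.adj_getElem a b a.2 b.2
    · obtain ⟨i, rfl⟩ := e.surjective x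
      have : (RelIso.symm (⟨e, fun {a b} => by
        rw [pathGraph_adj]; exact h.adj_getElem a b a.2 b.2⟩ : pathGraph (l.length + 1) ≃g
          G.induce (P : Set V))) (e i) = i := e.symm_apply_apply i
      rw [this, he]
      constructor
      · intro ha
        have h1 := h.eq_head (List.getElem_mem i.2) ha
        exact Fin.ext ((h.nodup.getElem_inj_iff (hj := by simp)).1
          (h1.trans (by simp : y = (y :: l)[0])))
      · rintro rfl
        exact h.adj_head

/-- Tails serve for inductions, pendant paths for the statement; together with
`IsTail.isPendantPathAt` this translates between them. The path is numbered from `1` on, and the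
attachment vertex gets number `0`. -/
theorem IsPendantPathAt.exists_isTail {v : V} {P : Finset V} (h : IsPendantPathAt G v P) :
    ∃ l, IsTail G v l ∧ ∀ w, w ∈ P ↔ w ∈ l := by
  obtain ⟨-, ⟨K, hK⟩, m, φ, hφ⟩ := h
  let g : ℕ → V := fun i => if h : i < m + 1 then φ.symm ⟨i, h⟩ else v
  have hg : ∀ i (h : i < m + 1), g i = φ.symm ⟨i, h⟩ := fun i h => dif_pos h
  have hvP : v ∉ P := by
    intro hv
    have : v ∈ (P : Set V) := hv
    rw [hK] at this
    obtain ⟨x, -, hx⟩ := this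
    exact x.2 hx
  have hgP : ∀ i, i < m + 1 → g i ∈ P := fun i h => by rw [hg i h]; exact (φ.symm _).2
  have hsurj : ∀ w ∈ P, ∃ i, i < m + 1 ∧ g i = w := by
    intro w hw
    refine ⟨φ ⟨w, hw⟩, (φ ⟨w, hw⟩).2, ?_⟩
    rw [hg _ (φ ⟨w, hw⟩).2]
    simp
  have hcl : ∀ z ∈ P, ∀ w, G.Adj z w → w ∈ P ∨ w = v := by
    intro z hz w hw
    by_cases hwv : w = v
    · exact .inr hwv
    · left
      have hz' : z ∈ (P : Set V) := hz
      have : w ∈ (P : Set V) := by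
        rw [hK] at hz' ⊢
        obtain ⟨x, hx, rfl⟩ := hz'
        have ha : (deleteVertex G v).Adj x ⟨w, hwv⟩ := hw
        exact ⟨⟨w, hwv⟩, (K.mem_supp_congr_adj ha).1 hx, rfl⟩
      exact this
  have hadj : ∀ i j, i < m + 1 → j < m + 1 → (G.Adj (g i) (g j) ↔ i + 1 = j ∨ j + 1 = i) := by
    intro i j hi hj
    have h1 : (G.induce (P : Set V)).Adj (φ.symm ⟨i, hi⟩) (φ.symm ⟨j, hj⟩) ↔ _ :=
      φ.symm.map_rel_iff
    rw [pathGraph_adj] at h1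
    rw [hg i hi, hg j hj]
    exact h1
  have hv0 : ∀ i, i < m + 1 → (G.Adj (g i) v ↔ i = 0) := by
    intro i hi
    have := hφ (φ.symm ⟨i, hi⟩)
    rw [← hg i hi] at this
    rw [G.adj_comm, this]
    simp [Fin.ext_iff]
  have hinj : ∀ i j, i < m + 1 → j < m + 1 → g i = g j → i = j := by
    intro i j hi hj hij
    rw [hg i hi, hg j hj] at hij
    simpa using φ.symm.injective (Subtype.ext hij)
  let f : ℕ → V := fun i => if i = 0 then v else g (i - 1)
  have hnb : ∀ i, i < m + 1 → ∀ z, G.Adj (g i) z ↔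
      (i = 0 ∧ z = v) ∨ ∃ j, j < m + 1 ∧ z = g j ∧ (i + 1 = j ∨ j + 1 = i) := by
    intro i hi z
    constructor
    · intro ha
      rcases hcl _ (hgP i hi) z ha with h | rfl
      · obtain ⟨j, hj, rfl⟩ := hsurj z h
        exact .inr ⟨j, hj, rfl, (hadj i j hi hj).1 ha⟩
      · exact .inl ⟨(hv0 i hi).1 ha, rfl⟩
    · rintro (⟨h0, rfl⟩ | ⟨j, hj, rfl, h⟩)
      · exact (hv0 i hi).2 h0
      · exact (hadj i j hi hj).2 h
  refine ⟨_, IsTail.of_nat f (m + 1) (by omega) ?_ ?_ m 0 (by omega), ?_⟩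
  · intro z
    simp only [f, Nat.add_sub_cancel, Nat.add_eq_zero_iff, one_ne_zero, and_false, if_false]
    rw [hnb m (by omega)]
    split_ifs with h0
    · subst h0
      exact ⟨by rintro (⟨-, h⟩ | ⟨j, hj, -, h⟩) <;> [exact h; omega], fun h => .inl ⟨rfl, h⟩⟩
    · constructor
      · rintro (⟨h, -⟩ | ⟨j, hj, rfl, h⟩)
        · exact absurd h h0
        · congr 1; omega
      · rintro rfl
        exact .inr ⟨m - 1, by omega, rfl, by omega⟩
  · intro i hi him
    obtain ⟨i, rfl⟩ : ∃ i', i = i' + 1 := ⟨i - 1, by omega⟩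
    simp only [f, Nat.add_sub_cancel, Nat.add_eq_zero_iff, one_ne_zero, and_false, if_false]
    constructor
    · split_ifs with h0
      · intro hv; exact hvP (hv ▸ hgP _ (by omega))
      · intro h; have := hinj _ _ (by omega) (by omega) h; omega
    · intro z
      rw [hnb i (by omega)]
      split_ifs with h0
      · subst h0
        constructor
        · rintro (⟨-, h⟩ | ⟨j, hj, rfl, h⟩)
          · exact .inl h
          · right; congr 1; omega
        · rintro (h | rfl)
          · exact .inl ⟨rfl, h⟩
          · exact .inr ⟨1, by omega, rfl, by omega⟩
      · constructor
        · rintro (⟨h, -⟩ | ⟨j, hj, rfl, h | h⟩)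
          · exact absurd h h0
          · right; congr 1; omega
          · left; congr 1; omega
        · rintro (rfl | rfl)
          · exact .inr ⟨i - 1, by omega, rfl, by omega⟩
          · exact .inr ⟨i + 1, by omega, rfl, by omega⟩
  · intro w
    simp only [List.mem_map, List.mem_range'_1]
    constructor
    · intro hw
      obtain ⟨i, hi, rfl⟩ := hsurj w hw
      exact ⟨i + 1, by omega, by simp [f]⟩
    · rintro ⟨i, hi, rfl⟩
      have : f i = g (i - 1) := by simp only [f]; rw [if_neg (by omega)]
      rw [this]
      exact hgP _ (by omega)

/-- A set that is avoided by a power dominating set and attached by a single edge is a tail. -/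
theorem IsPowerDominating.exists_isTail [Finite V] {R : Set V} (hR : IsPowerDominating G R)
    {v y : V} {K : Set V} (hvR : v ∉ R) (hKR : Disjoint R K) (hvK : v ∉ K) (hy : y ∈ K)
    (hvy : G.Adj v y) (huniq : ∀ z ∈ K, G.Adj v z → z = y)
    (hcl : ∀ z ∈ K, ∀ w, G.Adj z w → w ∈ K ∨ w = v) :
    ∃ l, IsTail G v l ∧ ∀ w, w ∈ K ↔ w ∈ l := by
  obtain ⟨n, hn⟩ : ∃ n, K.ncard = n := ⟨_, rfl⟩
  induction n generalizing v y K with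
  | zero => rw [Set.ncard_eq_zero] at hn; simp [hn] at hy
  | succ n ih =>
    have hyR : y ∉ R := fun h => Set.disjoint_left.1 hKR h hy
    by_cases hK : K ⊆ {y}
    · refine ⟨[y], .leaf fun z => ⟨fun ha => ?_, fun h => h ▸ hvy.symm⟩, fun w =>
        ⟨fun hw => by simpa using hK hw, fun hw => by simp at hw; exact hw ▸ hy⟩⟩
      rcases hcl y hy z ha with h | h
      · rw [hK h] at ha; exact absurd ha (G.loopless.irrefl _)
      · exact h
    · obtain ⟨z₀, hz₀, hz₀y⟩ := Set.not_subset.1 hK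
      -- Otherwise `K \ {y}` is a fort: `v` sees only `y` in `K`, so `y` is the only outside vertex
      -- with neighbours there. If `y` has none, the condition holds vacuously.
      have hnf : ¬ ∀ w ∈ K \ {y}, G.Adj y w → ∃ x ∈ K \ {y}, x ≠ w ∧ G.Adj y x := by
        intro hf
        refine hR.notMem_of_fort (F := K \ {y}) (fun r hr h => Set.disjoint_left.1 hKR hr h.1) ?_ ?_
          z₀ ⟨hz₀, hz₀y⟩
        · intro r hr w ha hw
          rcases hcl w hw.1 r ha.symm with h | h
          · exact Set.disjoint_left.1 hKR hr h
          · exact hvR (h ▸ hr)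
        · intro a ha w hw haw
          rcases hcl w hw.1 a haw.symm with h | rfl
          · have : a = y := by by_contra hne; exact ha ⟨h, hne⟩
            subst this
            exact hf w hw haw
          · exact absurd (huniq w hw.1 haw) hw.2
      push Not at hnf
      obtain ⟨x, hx, hyx, hux⟩ := hnf
      obtain ⟨l, hl, hKl⟩ := ih (v := y) (y := x) (K := K \ {y}) hyR
        (hKR.mono_right Set.sdiff_subset) (by simp) hx hyx
        (fun z hz ha => by by_contra hne; exact hux z hz hne ha)
        (fun z hz w ha => by
          by_cases hwy : w = y
          · exact .inr hwy
          rcases hcl z hz.1 w ha with h | rfl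
          · exact .inl ⟨h, hwy⟩
          · exact absurd (huniq z hz.1 ha.symm) hz.2)
        (by rw [Set.ncard_sdiff_singleton_of_mem hy, hn]; rfl)
      obtain ⟨x', l', rfl⟩ := List.exists_cons_of_ne_nil hl.ne_nil
      obtain rfl : x = x' := by
        by_contra hne
        exact hux x' ((hKl x').2 (by simp)) (Ne.symm hne) hl.adj_head
      refine ⟨y :: x :: l', .cons (fun h => hvK (h ▸ hx.1)) (fun z => ⟨fun ha => ?_, ?_⟩) hl,
        fun w => ?_⟩
      · rcases hcl y hy z ha with h | h
        · right
          by_contra hne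
          exact hux z ⟨h, ha.ne.symm⟩ hne ha
        · exact .inl h
      · rintro (rfl | rfl)
        · exact hvy.symm
        · exact hyx
      · rw [List.mem_cons, ← hKl]
        by_cases hwy : w = y <;> simp [hwy, hy]

/-- A tail extends to a pendant path, unless the whole graph is a path. -/
theorem IsTail.isPathGraph_or [Finite V] (hG : G.Connected) {u : V} {l : List V}
    (h : IsTail G u l) : IsPathGraph G ∨ ∃ P, IsPendantPath G P ∧ ∀ z ∈ l, z ∈ P := by
  classical
  -- Induction on the number of vertices off the tail: an attachment vertex of degree 2 joins the
  -- tail, one of degree 1 completes a path, and one of degree at least 3 makes the tail a pendant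
  -- path.
  obtain ⟨n, hn⟩ : ∃ n, Nat.card V - l.length = n := ⟨_, rfl⟩
  induction n generalizing u l with
  | zero =>
    exfalso
    have := Fintype.ofFinite V
    have h1 := (List.nodup_cons.2 ⟨h.notMem, h.nodup⟩).length_le_card
    rw [← Nat.card_eq_fintype_card, List.length_cons] at h1
    omega
  | succ n ih =>
    obtain ⟨y, l, rfl⟩ := List.exists_cons_of_ne_nil h.ne_nil
    by_cases hdeg : 3 ≤ (G.neighborSet u).ncard
    · exact .inr ⟨(y :: l).toFinset, ⟨u, h.isPendantPathAt hdeg (by simp)⟩, by simp⟩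
    have hpos : 0 < (G.neighborSet u).ncard := by
      rw [Set.ncard_pos]; exact ⟨y, h.adj_head⟩
    by_cases h1 : (G.neighborSet u).ncard = 1
    · left
      obtain ⟨a, ha⟩ := Set.ncard_eq_one.1 h1
      have hya : y ∈ G.neighborSet u := h.adj_head
      rw [ha] at hya
      have hN : ∀ z, G.Adj u z ↔ z = y := fun z => by
        rw [← mem_neighborSet, ha, Set.mem_singleton_iff.1 hya, Set.mem_singleton_iff]
      have hall : ∀ w, w ∈ u :: y :: l := by
        intro w
        obtain ⟨p⟩ := hG.preconnected u w
        have : ∀ (a b : V) (p : G.Walk a b), a ∈ u :: y :: l → b ∈ u :: y :: l := by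
          intro a b p
          induction p with
          | nil => exact id
          | cons hadj _ ih =>
            intro hm
            apply ih
            rcases List.mem_cons.1 hm with rfl | hm
            · rw [(hN _).1 hadj]; simp
            · rcases h.mem_or_eq _ hm _ hadj with h | h
              · exact List.mem_cons_of_mem _ h
              · simp [h]
        exact this _ _ p (by simp)
      refine isPathGraph_of_list (List.nodup_cons.2 ⟨h.notMem, h.nodup⟩) hall ?_
      have key : ∀ j (hj : j < (y :: l).length), G.Adj u (y :: l)[j] ↔ j = 0 := by
        intro j hj
        rw [hN]
        constructor
        · intro h1
          exact (h.nodup.getElem_inj_iff (hj := by simp)).1 (h1.trans (by simp : y = (y :: l)[0]))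
        · rintro rfl
          rfl
      intro i j hi hj
      cases i with
      | zero =>
        cases j with
        | zero => simp
        | succ j =>
          rw [List.getElem_cons_zero, List.getElem_cons_succ, key j (by simpa using hj)]; omega
      | succ i =>
        cases j with
        | zero =>
          rw [List.getElem_cons_zero, List.getElem_cons_succ, G.adj_comm,
            key i (by simpa using hi)]; omega
        | succ j =>
          rw [List.getElem_cons_succ, List.getElem_cons_succ,
            h.adj_getElem i j (by simpa using hi) (by simpa using hj)]; omega
    · obtain ⟨a, b, hab, hN⟩ := Set.ncard_eq_two.1 (by omega : (G.neighborSet u).ncard = 2)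
      have hya : y ∈ G.neighborSet u := h.adj_head
      have : ∃ x, x ≠ y ∧ ∀ z, G.Adj u z ↔ z = x ∨ z = y := by
        rw [hN] at hya
        rcases hya with rfl | hy
        · exact ⟨b, hab.symm, fun z => by rw [← mem_neighborSet, hN]; simp [or_comm]⟩
        · rw [Set.mem_singleton_iff] at hy
          subst hy
          exact ⟨a, hab, fun z => by rw [← mem_neighborSet, hN]; simp⟩
      obtain ⟨x, hxy, hx⟩ := this
      rcases ih (IsTail.cons hxy hx h) (by simp at hn ⊢; omega) with h | ⟨P, hP, hm⟩
      · exact .inl h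
      · exact .inr ⟨P, hP, fun z hz => hm z (by simp [List.mem_cons.1 hz])⟩

end Tails

/-! ### Cut vertices and `R1` on a cycle -/

section Rings

variable {V : Type u} {G : SimpleGraph V}

theorem natCast_zmod_inj {k i j : ℕ} (hi : i < k) (hj : j < k) (h : (i : ZMod k) = j) : i = j := by
  have h1 := congrArg ZMod.val h
  rwa [ZMod.val_natCast_of_lt hi, ZMod.val_natCast_of_lt hj] at h1

theorem one_ne_zero_zmod {k : ℕ} (hk : 3 ≤ k) : (1 : ZMod k) ≠ 0 := fun h => by
  have := natCast_zmod_inj (k := k) (i := 1) (j := 0) (by omega) (by omega) (by simpa using h)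
  omega

theorem two_ne_zero_zmod {k : ℕ} (hk : 3 ≤ k) : (1 + 1 : ZMod k) ≠ 0 := fun h => by
  have := natCast_zmod_inj (k := k) (i := 2) (j := 0) (by omega) (by omega)
    (by push_cast; linear_combination h)
  omega

theorem exists_natCast_zmod {k : ℕ} (hk : 3 ≤ k) (a i : ZMod k) :
    ∃ t : ℕ, t < k ∧ i = a + t := by
  have : NeZero k := ⟨by omega⟩
  exact ⟨(i - a).val, ZMod.val_lt _, by simp⟩

theorem mem_cycleSets_iff [Fintype V] {C : Finset V} :
    C ∈ cycleSets G ↔ ∃ (k : ℕ) (c : ZMod k → V), IsCyclic G c ∧ ∀ w, w ∈ C ↔ ∃ i, c i = w := by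
  simp only [cycleSets, Finset.mem_filter, Finset.mem_univ, true_and]
  constructor
  · rintro ⟨a, p, hp, hC⟩
    have hc := IsCyclic.of_isCycle hp
    have h3 := hp.three_le_length
    have : NeZero p.length := ⟨by omega⟩
    refine ⟨_, _, hc, fun w => ?_⟩
    rw [hC, Walk.mem_support_iff_exists_getVert]
    constructor
    · rintro ⟨n, rfl, hn⟩
      rcases hn.lt_or_eq with h | h
      · exact ⟨(n : ZMod p.length), by rw [ZMod.val_natCast_of_lt h]⟩
      · exact ⟨0, by simp [h]⟩
    · rintro ⟨i, rfl⟩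
      exact ⟨_, rfl, (ZMod.val_lt i).le⟩
  · rintro ⟨k, c, hc, hC⟩
    obtain ⟨p, hp, hl, hv⟩ := hc.exists_walk 0
    exact ⟨_, p, hp, fun w => by rw [hC, mem_support_iff_of_getVert hc.three_le hl hv]⟩

theorem IsCyclic.exists_pred {k : ℕ} {c : ZMod k → V} (hc : IsCyclic G c) (i : ZMod k) :
    G.Adj (c i) (c (i - 1)) := by
  have := hc.adj_succ (i - 1)
  rw [sub_add_cancel] at this
  exact this.symm

theorem IsCyclic.succ_ne_pred {k : ℕ} {c : ZMod k → V} (hc : IsCyclic G c) (i : ZMod k) :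
    c (i + 1) ≠ c (i - 1) := fun h =>
  two_ne_zero_zmod hc.three_le (by linear_combination hc.inj h)

/-- A cycle vertex has two different neighbours on the cycle, so a cycle through a tail vertex also
contains the next one, down to the leaf, which has only one neighbour. -/
theorem IsTail.notMem_cycle {v : V} {l : List V} (h : IsTail G v l) {k : ℕ} {c : ZMod k → V}
    (hc : IsCyclic G c) : ∀ i, c i ∉ l := by
  induction h with
  | @leaf v y h =>
    intro i hi
    rw [List.mem_singleton] at hi
    subst hi
    exact hc.succ_ne_pred i
      (((h _).1 (hc.adj_succ i)).trans ((h _).1 (hc.exists_pred i)).symm)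
  | @cons v y x l hne h ht ih =>
    intro i hi
    rcases List.mem_cons.1 hi with rfl | hi
    · rcases (h _).1 (hc.adj_succ i) with h1 | h1
      · rcases (h _).1 (hc.exists_pred i) with h2 | h2
        · exact hc.succ_ne_pred i (h1.trans h2.symm)
        · exact ih (i - 1) (by simp [h2])
      · exact ih (i + 1) (by simp [h1])
    · exact ih i hi

theorem IsPendantPathAt.unique {v z : V} {P Q : Finset V} (hP : IsPendantPathAt G v P)
    (hQ : IsPendantPathAt G v Q) (hzP : z ∈ P) (hzQ : z ∈ Q) : P = Q := by
  obtain ⟨-, ⟨K, hK⟩, -⟩ := hP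
  obtain ⟨-, ⟨L, hL⟩, -⟩ := hQ
  have h1 : z ∈ (P : Set V) := hzP
  have h2 : z ∈ (Q : Set V) := hzQ
  rw [hK] at h1; rw [hL] at h2
  obtain ⟨a, ha, rfl⟩ := h1
  obtain ⟨b, hb, hab⟩ := h2
  obtain rfl := Subtype.ext hab
  rw [ConnectedComponent.mem_supp_iff] at ha hb
  rw [← Finset.coe_inj, hK, hL, ← ha, ← hb]

theorem IsPendantPath.ncard_le {P : Finset V} (hP : IsPendantPath G P) {z : V} (hz : z ∈ P) :
    (G.neighborSet z).ncard ≤ 2 := by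
  obtain ⟨v, hv⟩ := hP
  obtain ⟨l, hl, hm⟩ := hv.exists_isTail
  exact hl.ncard_le z ((hm z).1 hz)

theorem IsPendantPath.notMem_cycle {P : Finset V} (hP : IsPendantPath G P) {k : ℕ}
    {c : ZMod k → V} (hc : IsCyclic G c) (i : ZMod k) : c i ∉ P := by
  obtain ⟨v, hv⟩ := hP
  obtain ⟨l, hl, hm⟩ := hv.exists_isTail
  rw [hm]
  exact hl.notMem_cycle hc i

theorem isCutVertex_iff [Finite V] (hG : G.Connected) {x : V} :
    IsCutVertex G x ↔ ∃ a b, ¬ (deleteVertex G x).Reachable a b := by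
  have h1 : numComponents G = 1 := by
    have := hG.preconnected.subsingleton_connectedComponent
    have := hG.nonempty
    exact Nat.card_of_subsingleton (G.connectedComponentMk (Classical.arbitrary V))
  rw [IsCutVertex, h1, numComponents, Finite.one_lt_card_iff_nontrivial]
  constructor
  · rintro ⟨p, q, hpq⟩
    induction p using ConnectedComponent.ind
    induction q using ConnectedComponent.ind
    exact ⟨_, _, fun h => hpq (ConnectedComponent.sound h)⟩
  · rintro ⟨a, b, h⟩
    exact ⟨_, _, fun he => h (ConnectedComponent.exact he)⟩

namespace IsRing

variable {k : ℕ} {c : ZMod k → V} {π : V → ZMod k}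

theorem proj_eq_of_adj (h : IsRing G c π) {v w : V} (ha : G.Adj v w) (hv : v ≠ c (π v)) :
    π w = π v := by
  rcases h.adj v w ha with h1 | h1
  · exact h1.symm
  · exact absurd h1.1 hv

theorem proj_ne (h : IsRing G c π) (i : ZMod k) : i + 1 ≠ i := fun he =>
  one_ne_zero_zmod h.three_le (by linear_combination he)

theorem ne_of_proj_ne (h : IsRing G c π) {v : V} {i : ZMod k} (hv : π v ≠ i) : v ≠ c i :=
  fun he => hv (he ▸ h.proj i)

/-- A walk from a vertex outside the branch at `c i` stays in its own branch until the attachment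
point, and the cycle minus `c i` is still a path. Thus everything outside that branch lies in one
component of `G - c i`. -/
theorem reachable_succ (h : IsRing G c π) (hG : G.Connected) {v : V} {i : ZMod k}
    (hv : π v ≠ i) : (deleteVertex G (c i)).Reachable ⟨v, h.ne_of_proj_ne hv⟩
      ⟨c (i + 1), h.inj.ne (h.proj_ne i)⟩ := by
  have hne : ∀ j : ℕ, 0 < j → j < k → i + (j : ZMod k) ≠ i := fun j hj0 hjk he => by
    have := natCast_zmod_inj (k := k) (i := j) (j := 0) hjk (by omega)
      (by push_cast; linear_combination he)
    omega
  have hcyc : ∀ j : ℕ, ∀ (hj0 : 0 < j) (hjk : j < k), (deleteVertex G (c i)).Reachable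
      ⟨c (i + j), h.inj.ne (hne j hj0 hjk)⟩ ⟨c (i + 1), h.inj.ne (h.proj_ne i)⟩ := by
    intro j hj0
    induction j, hj0 using Nat.le_induction with
    | base => intro _; simp
    | succ j hj0 ih =>
      intro hjk
      have : (deleteVertex G (c i)).Adj ⟨c (i + j), h.inj.ne (hne j hj0 (by omega))⟩
          ⟨c (i + (j + 1 : ℕ)), h.inj.ne (hne (j + 1) (by omega) hjk)⟩ := by
        have h1 : G.Adj (c (i + j)) (c (i + (j + 1 : ℕ))) := by
          have h1 := h.adj_succ (i + j)
          push_cast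
          rwa [← add_assoc]
        exact h1
      exact this.symm.reachable.trans (ih (by omega))
  have h2 : ∀ (v x : V) (p : G.Walk v x), x = c i → ∀ hv : π v ≠ i,
      (deleteVertex G (c i)).Reachable ⟨v, h.ne_of_proj_ne hv⟩
        ⟨c (π v), h.inj.ne hv⟩ := by
    intro v x p
    induction p with
    | nil => rintro rfl hv; exact absurd (h.proj i) hv
    | @cons v w _ ha p ih =>
      intro hx hv
      by_cases hvc : v = c (π v)
      · have : (⟨v, h.ne_of_proj_ne hv⟩ : ({c i}ᶜ : Set V)) = ⟨c (π v), h.inj.ne hv⟩ :=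
          Subtype.ext hvc
        rw [this]
      · have hw := h.proj_eq_of_adj ha hvc
        have h3 := ih hx (by rwa [hw])
        have h4 : (deleteVertex G (c i)).Adj ⟨v, h.ne_of_proj_ne hv⟩
          ⟨w, h.ne_of_proj_ne (by rwa [hw])⟩ := ha
        simp only [hw] at h3
        exact h4.reachable.trans h3
  obtain ⟨p⟩ := hG.preconnected v (c i)
  obtain ⟨t, htk, ht⟩ := exists_natCast_zmod h.three_le i (π v)
  refine (h2 v _ p rfl hv).trans ?_
  have ht0 : 0 < t := by
    rcases Nat.eq_zero_or_pos t with h0 | h0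
    · subst h0; simp at ht; exact absurd ht hv
    · exact h0
  convert hcyc t ht0 htk using 2
  exact Subtype.ext (congrArg c ht)

theorem proj_eq_of_reachable (h : IsRing G c π) {i : ZMod k} {a b : ({c i}ᶜ : Set V)}
    (hab : (deleteVertex G (c i)).Reachable a b) (ha : π a = i) : π b = i :=
  mem_of_reachable_induce (A := {z | π z = i ∧ z ≠ c i}) (fun z hz w hw hadj =>
    ⟨(h.proj_eq_of_adj hadj (by rw [hz.1]; exact hz.2)).trans hz.1, hw⟩) hab ⟨ha, a.2⟩ |>.1

theorem isCutVertex_iff [Finite V] (h : IsRing G c π) (hG : G.Connected) (i : ZMod k) :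
    IsCutVertex G (c i) ↔ ∃ v, π v = i ∧ v ≠ c i := by
  rw [CactusPD.isCutVertex_iff hG]
  constructor
  · rintro ⟨a, b, hab⟩
    by_contra! hn
    exact hab ((h.reachable_succ hG (fun ha => a.2 (hn a ha))).trans
      (h.reachable_succ hG (fun hb => b.2 (hn b hb))).symm)
  · rintro ⟨v, hv, hvi⟩
    refine ⟨⟨v, hvi⟩, ⟨c (i + 1), h.inj.ne (h.proj_ne i)⟩, fun hr => ?_⟩
    have := h.proj_eq_of_reachable hr hv
    simp only [h.proj] at this
    exact h.proj_ne i this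

theorem three_le_of_isTail [Finite V] (h : IsRing G c π) {i : ZMod k} {l : List V}
    (hl : IsTail G (c i) l) :
    3 ≤ (G.neighborSet (c i)).ncard := by
  obtain ⟨y, l, rfl⟩ := List.exists_cons_of_ne_nil hl.ne_nil
  have hcyc := h.isCyclic
  have hy : ∀ j, c j ≠ y := fun j hj => hl.notMem_cycle hcyc j (by simp [hj])
  have : ({c (i + 1), c (i - 1), y} : Set V) ⊆ G.neighborSet (c i) := by
    rintro z (rfl | rfl | rfl)
    · exact h.adj_succ i
    · exact hcyc.exists_pred i
    · exact hl.adj_head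
  refine le_trans (Eq.ge ?_) (Set.ncard_le_ncard this (Set.toFinite _))
  exact Set.ncard_eq_three.2 ⟨_, _, _, hcyc.succ_ne_pred i, hy _, hy _, rfl⟩

/-- Without `c i` the rest of the ring is one component, so `c(G - v) = 2` leaves one component for
the branch, and `p(v) = 1` makes it a pendant path. Cycle vertices lie in no pendant path, so
`numPendant` is here the plain count. -/
theorem mem_R1_iff [Finite V] (h : IsRing G c π) (hG : G.Connected) (i : ZMod k) :
    c i ∈ R1 G ↔ ∃ l, IsTail G (c i) l ∧ ∀ w, w ∈ l ↔ π w = i ∧ w ≠ c i := by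
  classical
  have hcyc := h.isCyclic
  have hnp : ¬ (IsCutVertex G (c i) ∧ ∃ P, IsPendantPath G P ∧ c i ∈ P) := by
    rintro ⟨-, P, hP, hm⟩
    exact hP.notMem_cycle hcyc i hm
  constructor
  · rintro ⟨h2, hp⟩
    rw [numPendant, if_neg hnp] at hp
    obtain ⟨P, hP⟩ := Set.ncard_eq_one.1 hp
    have hPP : IsPendantPathAt G (c i) P := by
      have : P ∈ {P | IsPendantPathAt G (c i) P} := by rw [hP]; rfl
      exact this
    obtain ⟨l, hl, -⟩ := hPP.exists_isTail
    have hcl : ∀ a b : ({c i}ᶜ : Set V), (deleteVertex G (c i)).Reachable a b →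
        (a : V) ∈ l → (b : V) ∈ l := fun a b hab ha =>
      mem_of_reachable_induce (A := {z | z ∈ l}) (fun z hz w hw hadj =>
        (hl.mem_or_eq z hz w hadj).resolve_right hw) hab ha
    have hsub : ∀ z ∈ l, π z = i ∧ z ≠ c i := by
      intro z hz
      refine ⟨?_, fun he => hl.notMem (he ▸ hz)⟩
      by_contra hne
      exact hl.notMem_cycle hcyc _ (hcl _ _ (h.reachable_succ hG hne) hz)
    refine ⟨l, hl, fun w => ⟨hsub w, fun hw => ?_⟩⟩
    by_contra hwl
    obtain ⟨y, hy⟩ := List.exists_mem_of_ne_nil _ hl.ne_nil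
    obtain ⟨p, q, -, hpq⟩ := Nat.card_eq_two_iff.1 h2
    let H := deleteVertex G (c i)
    have e1 : H.connectedComponentMk ⟨y, (hsub y hy).2⟩ ≠ H.connectedComponentMk ⟨w, hw.2⟩ :=
      fun he => hwl (hcl _ _ (ConnectedComponent.exact he) hy)
    have e2 : H.connectedComponentMk ⟨y, (hsub y hy).2⟩ ≠
        H.connectedComponentMk ⟨c (i + 1), h.inj.ne (h.proj_ne i)⟩ :=
      fun he => hl.notMem_cycle hcyc _ (hcl _ _ (ConnectedComponent.exact he) hy)
    have e3 : H.connectedComponentMk ⟨w, hw.2⟩ ≠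
        H.connectedComponentMk ⟨c (i + 1), h.inj.ne (h.proj_ne i)⟩ := fun he => by
      have := h.proj_eq_of_reachable (ConnectedComponent.exact he) hw.1
      simp only [h.proj] at this
      exact h.proj_ne i this
    have hmem : ∀ K : H.ConnectedComponent, K = p ∨ K = q := fun K => by
      have : K ∈ ({p, q} : Set H.ConnectedComponent) := by rw [hpq]; trivial
      simpa using this
    -- Three pairwise different components do not fit into two.
    rcases hmem (H.connectedComponentMk ⟨y, (hsub y hy).2⟩) with r1 | r1 <;>
    rcases hmem (H.connectedComponentMk ⟨w, hw.2⟩) with r2 | r2 <;>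
    rcases hmem (H.connectedComponentMk ⟨c (i + 1), h.inj.ne (h.proj_ne i)⟩) with r3 | r3 <;>
    simp [r1, r2, r3] at e1 e2 e3
  · rintro ⟨l, hl, hm⟩
    have hdeg := h.three_le_of_isTail hl
    have hP := hl.isPendantPathAt hdeg (P := l.toFinset) (by simp)
    constructor
    · obtain ⟨-, ⟨K, hK⟩, -⟩ := hP
      let H := deleteVertex G (c i)
      refine Nat.card_eq_two_iff.2 ⟨K,
        H.connectedComponentMk ⟨c (i + 1), h.inj.ne (h.proj_ne i)⟩, ?_, ?_⟩
      · intro he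
        have : c (i + 1) ∈ (l.toFinset : Set V) := by
          rw [hK, he]
          exact ⟨⟨c (i + 1), h.inj.ne (h.proj_ne i)⟩, rfl, rfl⟩
        exact hl.notMem_cycle hcyc (i + 1) (by simpa using this)
      · ext L
        simp only [Set.mem_insert_iff, Set.mem_singleton_iff, Set.mem_univ, iff_true]
        induction L using ConnectedComponent.ind with | _ a
        by_cases ha : π a = i
        · left
          have : (a : V) ∈ (l.toFinset : Set V) := by
            simpa using (hm a).2 ⟨ha, a.2⟩
          rw [hK] at this
          obtain ⟨b, hb, hba⟩ := this
          rw [← Subtype.ext hba]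
          exact hb
        · right
          exact ConnectedComponent.sound (h.reachable_succ hG ha)
    · rw [numPendant, if_neg hnp, Set.ncard_eq_one]
      refine ⟨l.toFinset, Set.eq_singleton_iff_unique_mem.2 ⟨hP, fun Q hQ => ?_⟩⟩
      obtain ⟨l', hl', hm'⟩ := IsPendantPathAt.exists_isTail hQ
      obtain ⟨y, l', rfl⟩ := List.exists_cons_of_ne_nil hl'.ne_nil
      refine IsPendantPathAt.unique hQ hP (z := y) ((hm' y).2 (by simp)) ?_
      rw [List.mem_toFinset, hm]
      have hy : y ≠ c (π y) := fun he => hl'.notMem_cycle hcyc (π y) (by simp [← he])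
      have h1 := h.proj_eq_of_adj hl'.adj_head.symm hy
      rw [h.proj] at h1
      exact ⟨h1.symm, hl'.adj_head.ne.symm⟩

end IsRing

end Rings

/-! ### Segments as arcs, and the condition on their cut vertices -/

section Segments

variable {V : Type u} {G : SimpleGraph V} {k : ℕ} {c : ZMod k → V} {π : V → ZMod k}

/-- `S` consists of the `m` vertices that follow `c a` on the cycle `c`. -/
def IsArc (c : ZMod k → V) (a : ZMod k) (m : ℕ) (S : Finset V) : Prop :=
  ∀ w, w ∈ S ↔ ∃ i : ℕ, 0 < i ∧ i ≤ m ∧ c (a + i) = w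

/-- Consecutive vertices of `d` are neighbours on the chordless ring `c`, so every step is `+1` or
`-1`; injectivity forbids turning back, and the first direction persists. -/
theorem IsRing.exists_affine (h : IsRing G c π) {d : ZMod k → V} (hd : IsCyclic G d)
    (hr : ∀ i, ∃ j, c j = d i) :
    ∃ s, (∀ i : ℕ, d i = c (s + i)) ∨ ∀ i : ℕ, d i = c (s - i) := by
  choose σ hσ using hr
  have hinj : Function.Injective σ := fun i j hij => hd.inj (by rw [← hσ, hij, hσ])
  have hstep : ∀ i, σ (i + 1) = σ i + 1 ∨ σ i = σ (i + 1) + 1 := fun i => by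
    have := hd.adj_succ i
    rwa [← hσ, ← hσ, h.adj_iff] at this
  have h2 : ∀ i : ZMod k, i + 1 + 1 ≠ i := fun i hi =>
    two_ne_zero_zmod h.three_le (by linear_combination hi)
  refine ⟨σ 0, ?_⟩
  rcases hstep 0 with h0 | h0
  · left
    have : ∀ i : ℕ, σ i = σ 0 + i ∧ σ (i + 1) = σ 0 + i + 1 := by
      intro i
      induction i with
      | zero => simpa using h0
      | succ i ih =>
        obtain ⟨h3, h4⟩ := ih
        push_cast
        refine ⟨by rw [h4]; ring, ?_⟩
        rcases hstep (i + 1) with h5 | h5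
        · rw [h5, h4]; ring
        · exact absurd (hinj (by linear_combination h4 - h3 - h5)) (h2 i)
    intro i
    rw [← hσ, (this i).1]
  · right
    have : ∀ i : ℕ, σ i = σ 0 - i ∧ σ (i + 1) = σ 0 - i - 1 := by
      intro i
      induction i with
      | zero => simp [h0]
      | succ i ih =>
        obtain ⟨h3, h4⟩ := ih
        push_cast
        refine ⟨by rw [h4]; ring, ?_⟩
        rcases hstep (i + 1) with h5 | h5
        · exact absurd (hinj (by linear_combination h4 - h3 + h5)) (h2 i)
        · linear_combination h4 - h5
    intro i
    rw [← hσ, (this i).1]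

theorem IsRing.isSegment_iff (h : IsRing G c π) {C S : Finset V}
    (hC : ∀ w, w ∈ C ↔ ∃ i, c i = w) :
    IsSegment G C S ↔ ∃ a m, m < k ∧ IsArc c a m S := by
  constructor
  · rintro ⟨x, p, n, hp, hpC, hn1, hnl, hS⟩
    have h3 := hp.three_le_length
    have hd := IsCyclic.of_isCycle hp
    have hl : p.length = k := by
      have e1 : Set.range c = Set.range (fun i : ZMod p.length => p.getVert i.val) := by
        have : NeZero p.length := ⟨by omega⟩
        ext w
        rw [Set.mem_range, ← hC, hpC, Walk.mem_support_iff_exists_getVert]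
        constructor
        · rintro ⟨t, rfl, ht⟩
          rcases ht.lt_or_eq with h1 | h1
          · exact ⟨(t : ZMod p.length), by simp only [ZMod.val_natCast_of_lt h1]⟩
          · exact ⟨0, by simp [h1]⟩
        · rintro ⟨i, rfl⟩
          exact ⟨_, rfl, (ZMod.val_lt i).le⟩
      have e2 := Nat.card_range_of_injective h.inj
      rw [e1, Nat.card_range_of_injective hd.inj, Nat.card_zmod, Nat.card_zmod] at e2
      exact e2
    subst hl
    obtain ⟨s, hs⟩ := h.exists_affine hd (fun i => by
      rw [← hC, hpC]; exact Walk.getVert_mem_support _ _)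
    have hval : ∀ i : ℕ, i < n → p.getVert i = p.getVert ((i : ZMod p.length).val) := by
      intro i hi
      rw [ZMod.val_natCast_of_lt (by omega)]
    rcases hs with hs | hs
    · refine ⟨s, n - 1, by omega, fun w => ?_⟩
      rw [hS]
      constructor
      · rintro ⟨i, hi0, hi, rfl⟩
        exact ⟨i, hi0, by omega, by rw [hval i hi, ← hs i]⟩
      · rintro ⟨i, hi0, hi, rfl⟩
        exact ⟨i, hi0, by omega, by rw [hval i (by omega), ← hs i]⟩
    -- For a walk against the direction of `c` the segment is the arc after `c (s - n)` read
    -- backwards, with `i` and `n - i` exchanged.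
    · refine ⟨s - n, n - 1, by omega, fun w => ?_⟩
      rw [hS]
      constructor
      · rintro ⟨i, hi0, hi, rfl⟩
        refine ⟨n - i, by omega, by omega, ?_⟩
        rw [hval i hi, hs i, Nat.cast_sub hi.le]; congr 1; ring
      · rintro ⟨i, hi0, hi, rfl⟩
        refine ⟨n - i, by omega, by omega, ?_⟩
        rw [hval _ (by omega), hs, Nat.cast_sub (by omega)]; congr 1; ring
  · rintro ⟨a, m, hm, hS⟩
    obtain ⟨p, hp, hl, hv⟩ := h.isCyclic.exists_walk a
    refine ⟨_, p, m + 1, hp, fun w => by rw [hC, mem_support_iff_of_getVert h.three_le hl hv],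
      by omega, by omega, fun w => ?_⟩
    rw [hS]
    constructor
    · rintro ⟨i, hi0, hi, rfl⟩
      exact ⟨i, hi0, by omega, hv i (by omega)⟩
    · rintro ⟨i, hi0, hi, rfl⟩
      exact ⟨i, hi0, by omega, (hv i (by omega)).symm⟩

/-- The cut vertices among the `m` vertices that follow `c a` are in `R₁(G)`, and they are
contained in a pair of consecutive vertices. -/
def ArcCondition (G : SimpleGraph V) (c : ZMod k → V) (a : ZMod k) (m : ℕ) : Prop :=
  (∀ i : ℕ, 0 < i → i ≤ m → IsCutVertex G (c (a + i)) → c (a + i) ∈ R1 G) ∧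
  ∃ j, ∀ i : ℕ, 0 < i → i ≤ m → IsCutVertex G (c (a + i)) → i = j ∨ i = j + 1

theorem IsRing.arc_inj (h : IsRing G c π) {a : ZMod k} {i j : ℕ} (hi : i < k) (hj : j < k)
    (he : c (a + i) = c (a + j)) : i = j :=
  natCast_zmod_inj hi hj (by linear_combination h.inj he)

/-- The three cases of the condition become one: only the positions `j` and `j + 1` may carry cut
vertices, and none, one or both of them do. -/
theorem IsRing.cutVertexCondition_iff (h : IsRing G c π) {a : ZMod k} {m : ℕ} (hm : m < k)
    {S : Finset V} (hS : IsArc c a m S) : CutVertexCondition G S ↔ ArcCondition G c a m := by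
  have hmem : ∀ w, w ∈ {w | w ∈ S ∧ IsCutVertex G w} ↔
      ∃ i : ℕ, 0 < i ∧ i ≤ m ∧ IsCutVertex G (c (a + i)) ∧ c (a + i) = w := by
    intro w
    rw [Set.mem_ofPred_eq, hS]
    constructor
    · rintro ⟨⟨i, h0, hi, rfl⟩, hc⟩; exact ⟨i, h0, hi, hc, rfl⟩
    · rintro ⟨i, h0, hi, hc, rfl⟩; exact ⟨⟨i, h0, hi, rfl⟩, hc⟩
  constructor
  · rintro (h0 | ⟨x, hx, h1⟩ | ⟨x, hx, y, hy, hxy, h2⟩)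
    · have hn : ∀ i : ℕ, 0 < i → i ≤ m → ¬ IsCutVertex G (c (a + i)) := fun i hi him hc => by
        have := (hmem _).2 ⟨i, hi, him, hc, rfl⟩
        rw [h0] at this; exact this
      exact ⟨fun i hi him hc => absurd hc (hn i hi him), 0, fun i hi him hc =>
        absurd hc (hn i hi him)⟩
    · have hn : ∀ i : ℕ, 0 < i → i ≤ m → IsCutVertex G (c (a + i)) → c (a + i) = x :=
        fun i hi him hc => by
          have := (hmem _).2 ⟨i, hi, him, hc, rfl⟩
          rw [h1] at this; exact this
      refine ⟨fun i hi him hc => hn i hi him hc ▸ hx, ?_⟩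
      have : x ∈ {w | w ∈ S ∧ IsCutVertex G w} := by rw [h1]; rfl
      obtain ⟨j, hj0, hj, -, hjx⟩ := (hmem x).1 this
      exact ⟨j, fun i hi him hc => .inl
        (h.arc_inj (by omega) (by omega) ((hn i hi him hc).trans hjx.symm))⟩
    · have hn : ∀ i : ℕ, 0 < i → i ≤ m → IsCutVertex G (c (a + i)) →
          c (a + i) = x ∨ c (a + i) = y := fun i hi him hc => by
        have := (hmem _).2 ⟨i, hi, him, hc, rfl⟩
        rw [h2] at this; exact this
      refine ⟨fun i hi him hc => ?_, ?_⟩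
      · rcases hn i hi him hc with h | h <;> rw [h] <;> assumption
      have e1 : x ∈ {w | w ∈ S ∧ IsCutVertex G w} := by rw [h2]; simp
      have e2 : y ∈ {w | w ∈ S ∧ IsCutVertex G w} := by rw [h2]; simp
      obtain ⟨p, hp0, hp, -, rfl⟩ := (hmem x).1 e1
      obtain ⟨q, hq0, hq, -, rfl⟩ := (hmem y).1 e2
      -- Adjacent vertices of the arc are consecutive on it: wrapping around would mean `p + 1 = k`
      -- and hence `q = 0`.
      have hpq : q = p + 1 ∨ p = q + 1 := by
        have key : ∀ p q : ℕ, p ≤ m → 0 < q → q ≤ m → a + (q : ZMod k) = a + p + 1 →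
            q = p + 1 := by
          intro p q hp hq0 hq he
          have e : ((p + 1 : ℕ) : ZMod k) = (q : ℕ) := by push_cast; linear_combination -he
          rcases Nat.lt_or_ge (p + 1) k with hlt | hge
          · exact (natCast_zmod_inj hlt (by omega) e).symm
          · have : p + 1 = k := by omega
            rw [this, ZMod.natCast_self] at e
            have := natCast_zmod_inj (k := k) (i := 0) (j := q) (by omega) (by omega) (by simpa)
            omega
        rcases (h.adj_iff _ _).1 hxy with he | he
        · exact .inl (key p q hp hq0 hq he)
        · exact .inr (key q p hq hp0 hp he)
      refine ⟨min p q, fun i hi him hc => ?_⟩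
      rcases hn i hi him hc with e | e <;>
      · have := h.arc_inj (by omega) (by omega) e
        omega
  · rintro ⟨h1, j, hj⟩
    by_cases hj1 : 0 < j ∧ j ≤ m ∧ IsCutVertex G (c (a + j)) <;>
    by_cases hj2 : j + 1 ≤ m ∧ IsCutVertex G (c (a + (j + 1 : ℕ)))
    · refine .inr (.inr ⟨_, h1 j hj1.1 hj1.2.1 hj1.2.2, _,
        h1 (j + 1) (by omega) hj2.1 hj2.2, ?_, ?_⟩)
      · rw [h.adj_iff]; push_cast; left; ring
      · ext w
        rw [hmem]
        constructor
        · rintro ⟨i, hi, him, hc, rfl⟩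
          rcases hj i hi him hc with rfl | rfl <;> simp
        · rintro (rfl | rfl)
          · exact ⟨j, hj1.1, hj1.2.1, hj1.2.2, rfl⟩
          · exact ⟨j + 1, by omega, hj2.1, hj2.2, rfl⟩
    · refine .inr (.inl ⟨_, h1 j hj1.1 hj1.2.1 hj1.2.2, ?_⟩)
      ext w
      rw [hmem]
      constructor
      · rintro ⟨i, hi, him, hc, rfl⟩
        rcases hj i hi him hc with rfl | rfl
        · simp
        · exact absurd ⟨him, hc⟩ hj2
      · rintro rfl
        exact ⟨j, hj1.1, hj1.2.1, hj1.2.2, rfl⟩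
    · refine .inr (.inl ⟨_, h1 (j + 1) (by omega) hj2.1 hj2.2, ?_⟩)
      ext w
      rw [hmem]
      constructor
      · rintro ⟨i, hi, him, hc, rfl⟩
        rcases hj i hi him hc with rfl | rfl
        · exact absurd ⟨hi, him, hc⟩ hj1
        · simp
      · rintro rfl
        exact ⟨j + 1, by omega, hj2.1, hj2.2, rfl⟩
    · refine .inl ?_
      ext w
      rw [hmem]
      constructor
      · rintro ⟨i, hi, him, hc, rfl⟩
        rcases hj i hi him hc with rfl | rfl
        · exact absurd ⟨hi, him, hc⟩ hj1
        · exact absurd ⟨him, hc⟩ hj2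
      · rintro ⟨⟩

/-! ### Connected power dominating sets meet every cycle in an arc -/

theorem IsConnPowerDominating.nonempty {R : Set V} (hR : IsConnPowerDominating G R) :
    R.Nonempty := Set.nonempty_coe_sort.1 hR.2.nonempty

theorem IsConnPowerDominating.mem_of_closed {R A : Set V} (hR : IsConnPowerDominating G R)
    (hA : ∀ z ∈ A, z ∈ R → ∀ w ∈ R, G.Adj z w → w ∈ A) {r : V} (hr : r ∈ R) (hrA : r ∈ A) :
    ∀ w ∈ R, w ∈ A := fun w hw =>
  (mem_of_reachable_induce (s := R) (A := A ∩ R) (fun z hz w hw ha =>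
    ⟨hA z hz.1 hz.2 w hw ha, hw⟩) (hR.2.preconnected ⟨r, hr⟩ ⟨w, hw⟩) ⟨hrA, hr⟩).1

namespace IsRing

variable {R : Set V}

/-- If `R` missed the cycle, connectivity would put it into one branch, without the attachment
point. The other branches then form a fort: only `c (π r)` borders on them, and it has two cycle
neighbours there. -/
theorem exists_mem (h : IsRing G c π) (hR : IsConnPowerDominating G R) : ∃ i, c i ∈ R := by
  by_contra! hn
  obtain ⟨r, hr⟩ := hR.nonempty
  have hne : ∀ v ∈ R, v ≠ c (π v) := fun v hv he => hn _ (he ▸ hv)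
  have hall := hR.mem_of_closed (A := {z | π z = π r}) (fun z hz hzR w _ ha =>
    (h.proj_eq_of_adj ha (hne z hzR)).trans hz) hr rfl
  refine hR.1.notMem_of_fort (F := {v | π v ≠ π r}) (fun v hv hF => hF (hall v hv))
    (fun v hv w ha hF => hF ((h.proj_eq_of_adj ha (hne v hv)).trans (hall v hv))) ?_
    (c (π r + 1)) (by simpa [h.proj] using one_ne_zero_zmod h.three_le)
  intro v hv w hw ha
  have hv' : π v = π r := by simpa using hv
  rcases h.adj v w ha with h1 | ⟨h1, h2, h3⟩
  · exact absurd (h1.symm.trans hv') hw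
  · rw [hv'] at h1 h3
    have m1 : c (π r + 1) ∈ {v | π v ≠ π r} := by
      simpa [h.proj] using one_ne_zero_zmod h.three_le
    have m2 : c (π r - 1) ∈ {v | π v ≠ π r} := by
      simpa [h.proj] using one_ne_zero_zmod h.three_le
    rcases h3 with h3 | h3
    · exact ⟨_, m2, by rw [h2, h3]; exact (h.isCyclic.succ_ne_pred _).symm,
        h1 ▸ h.isCyclic.exists_pred _⟩
    · refine ⟨_, m1, ?_, h1 ▸ h.adj_succ _⟩
      rw [h2, show π w = π r - 1 by rw [h3]; ring]
      exact h.isCyclic.succ_ne_pred _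

/-- Within `R` the branch changes only along a cycle edge with both ends in `R`, so the property of
having the attachment point in `R` spreads from one cycle vertex to all of `R`. -/
theorem proj_mem (h : IsRing G c π) (hR : IsConnPowerDominating G R) :
    ∀ r ∈ R, c (π r) ∈ R := by
  obtain ⟨i, hi⟩ := h.exists_mem hR
  refine hR.mem_of_closed (A := {z | c (π z) ∈ R}) (fun z hz hzR w hw ha => ?_) hi
    (by simpa [h.proj] using hi)
  rcases h.adj z w ha with h1 | ⟨-, h1, -⟩
  · rw [Set.mem_ofPred_eq, ← h1]; exact hz
  · rw [Set.mem_ofPred_eq, ← h1]; exact hw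

/-- A second gap would disconnect `R`, because the branches between two gaps can be left only
through cycle vertices that are missing. -/
theorem exists_arc (h : IsRing G c π) (hR : IsConnPowerDominating G R) :
    ∃ a m, m < k ∧ ∀ i, c i ∉ R ↔ ∃ t : ℕ, 0 < t ∧ t ≤ m ∧ c (a + t) = c i := by
  classical
  by_cases hall : ∀ i, c i ∈ R
  · exact ⟨0, 0, by have := h.three_le; omega, fun i => ⟨fun hi => absurd (hall i) hi,
      fun ⟨t, ht, ht', _⟩ => by omega⟩⟩
  obtain ⟨a, ha, ha1⟩ : ∃ a, c a ∈ R ∧ c (a + 1) ∉ R := by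
    by_contra! hn
    obtain ⟨a, ha⟩ := h.exists_mem hR
    apply hall
    have : ∀ t : ℕ, c (a + t) ∈ R := by
      intro t
      induction t with
      | zero => simpa using ha
      | succ t ih => push_cast; rw [← add_assoc]; exact hn _ ih
    intro i
    obtain ⟨t, -, rfl⟩ := exists_natCast_zmod h.three_le a i
    exact this t
  have h3 := h.three_le
  have hex : ∃ t : ℕ, 0 < t ∧ c (a + t) ∈ R := ⟨k, by omega, by simpa using ha⟩
  obtain ⟨hn0, hnR⟩ := Nat.find_spec hex
  have hmin := fun t => @Nat.find_min _ _ hex t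
  have hnk : Nat.find hex ≤ k := Nat.find_min' hex ⟨by omega, by simpa using ha⟩
  set n := Nat.find hex with hn
  have hnot : ∀ t : ℕ, 0 < t → t < n → c (a + t) ∉ R := fun t h0 ht hc => hmin t ht ⟨h0, hc⟩
  have hn2 : 2 ≤ n := by
    by_contra hlt
    have : n = 1 := by omega
    rw [this] at hnR
    exact ha1 (by simpa using hnR)
  refine ⟨a, n - 1, by omega, fun i => ⟨fun hi => ?_, ?_⟩⟩
  · obtain ⟨t, htk, rfl⟩ := exists_natCast_zmod h.three_le a i
    have ht0 : 0 < t := by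
      rcases Nat.eq_zero_or_pos t with h0 | h0
      · subst h0; simp at hi; exact absurd ha hi
      · exact h0
    refine ⟨t, ht0, ?_, rfl⟩
    by_contra hnt
    have hnt : n < t := by
      rcases (by omega : n = t ∨ n < t) with h1 | h1
      · exact absurd (h1 ▸ hnR) hi
      · exact h1
    -- `c (a + n)` is the first vertex of `R` after the gap, and `c (a + t)` is missing again; the
    -- part of `R` attached at the positions `n, …, t - 1` would be cut off from `c a`.
    have hcl := hR.mem_of_closed (A := {z | ∃ s : ℕ, n ≤ s ∧ s < t ∧ π z = a + s})
      (fun z hz hzR w hw hadj => by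
        obtain ⟨s, hs1, hs2, hs⟩ := hz
        rcases h.adj z w hadj with e | ⟨e1, e2, e | e⟩
        · exact ⟨s, hs1, hs2, e ▸ hs⟩
        · have e3 : π w = a + (s + 1 : ℕ) := by rw [e, hs]; push_cast; ring
          refine ⟨s + 1, by omega, ?_, e3⟩
          by_contra hlt
          have : s + 1 = t := by omega
          rw [e3, this] at e2
          exact hi (e2 ▸ hw)
        · have e3 : π w = a + (s - 1 : ℕ) := by
            rw [Nat.cast_sub (by omega)]; push_cast; linear_combination hs - e
          refine ⟨s - 1, ?_, by omega, e3⟩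
          by_contra hlt
          rw [e3] at e2
          exact hnot (s - 1) (by omega) (by omega) (e2 ▸ hw))
      hnR ⟨n, le_rfl, hnt, h.proj _⟩ (c a) ha
    obtain ⟨s, hs1, hs2, hs⟩ := hcl
    rw [h.proj] at hs
    have := natCast_zmod_inj (k := k) (i := s) (j := 0) (by omega) (by omega)
      (by push_cast; linear_combination -hs)
    omega
  · rintro ⟨t, ht0, ht, he⟩
    rw [← he]
    exact hnot t ht0 (by omega)

/-- With a cycle vertex `R` misses its whole branch, by `proj_mem`. The branch is not a fort, so `c
i` has exactly one neighbour in it, and `IsPowerDominating.exists_isTail` applies. -/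
theorem mem_R1_of_notMem [Finite V] (h : IsRing G c π) (hG : G.Connected)
    (hR : IsConnPowerDominating G R) {i : ZMod k} (hi : c i ∉ R) (hcut : IsCutVertex G (c i)) :
    c i ∈ R1 G := by
  have hdis : ∀ r ∈ R, π r ≠ i := fun r hr he => hi (he ▸ h.proj_mem hR r hr)
  obtain ⟨z₀, hz₀⟩ := (h.isCutVertex_iff hG i).1 hcut
  have hcl : ∀ z, π z = i ∧ z ≠ c i → ∀ w, G.Adj z w → (π w = i ∧ w ≠ c i) ∨ w = c i := by
    intro z hz w ha
    by_cases hw : w = c i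
    · exact .inr hw
    · exact .inl ⟨(h.proj_eq_of_adj ha (hz.1 ▸ hz.2)).trans hz.1, hw⟩
  have hnf : ¬ ∀ w, (π w = i ∧ w ≠ c i) → G.Adj (c i) w →
      ∃ x, (π x = i ∧ x ≠ c i) ∧ x ≠ w ∧ G.Adj (c i) x := by
    intro hf
    refine hR.1.notMem_of_fort (F := {z | π z = i ∧ z ≠ c i}) (fun v hv hF => hdis v hv hF.1)
      (fun v hv w ha hw => ?_) (fun v hv w hw ha => ?_) z₀ hz₀
    · rcases hcl w hw v ha.symm with h1 | rfl
      · exact hdis v hv h1.1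
      · exact hi hv
    · rcases hcl w hw v ha.symm with h1 | rfl
      · exact absurd h1 hv
      · exact hf w hw ha
  push Not at hnf
  obtain ⟨y, hy, hya, hyu⟩ := hnf
  obtain ⟨l, hl, hm⟩ := hR.1.exists_isTail (K := {z | π z = i ∧ z ≠ c i}) hi
    (Set.disjoint_left.2 fun r hr hF => hdis r hr hF.1) (by simp) hy hya
    (fun z hz ha => by by_contra hne; exact hyu z hz hne ha) hcl
  exact (h.mem_R1_iff hG i).2 ⟨l, hl, fun w => (hm w).symm⟩

/-- Suppose that cut vertices are missed at positions `p` and `q > p + 1`. Everything attached from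
`p` to `q`, without these two vertices themselves, is a fort: each of them has two neighbours in it,
the next cycle vertex and the first vertex of its pendant path. -/
theorem arcCondition_of_disjoint [Finite V] (h : IsRing G c π) (hG : G.Connected)
    (hR : IsConnPowerDominating G R) {a : ZMod k} {m : ℕ} (hm : m < k)
    (hd : ∀ i : ℕ, 0 < i → i ≤ m → c (a + i) ∉ R) : ArcCondition G c a m := by
  classical
  refine ⟨fun i hi him hc => h.mem_R1_of_notMem hG hR (hd i hi him) hc, ?_⟩
  by_cases hex : ∃ j : ℕ, 0 < j ∧ j ≤ m ∧ IsCutVertex G (c (a + j))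
  swap
  · push Not at hex
    exact ⟨0, fun i hi him hc => absurd hc (hex i hi him)⟩
  obtain ⟨hp0, hpm, hpc⟩ := Nat.find_spec hex
  have hmin := fun t => @Nat.find_min' _ _ hex t
  set p := Nat.find hex with hp
  refine ⟨p, fun q hq hqm hqc => ?_⟩
  have hpq := hmin q ⟨hq, hqm, hqc⟩
  by_contra hne
  have hpq : p + 1 < q := by omega
  have hinj : ∀ s t : ℕ, s ≤ m → t ≤ m → a + (s : ZMod k) = a + t → s = t := fun s t hs ht he =>
    natCast_zmod_inj (k := k) (by omega) (by omega) (by linear_combination he)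
  have hdis : ∀ r ∈ R, ∀ s : ℕ, 0 < s → s ≤ m → π r ≠ a + s := fun r hr s h0 hs he =>
    hd s h0 hs (he ▸ h.proj_mem hR r hr)
  set F : Set V := {z | ∃ s : ℕ, p ≤ s ∧ s ≤ q ∧ π z = a + s ∧
    z ≠ c (a + p) ∧ z ≠ c (a + q)} with hF
  have hmid : ∀ s : ℕ, p < s → s < q → c (a + s) ∈ F := fun s h1 h2 =>
    ⟨s, h1.le, h2.le, h.proj _,
      fun he => by have := hinj _ _ (by omega) (by omega) (h.inj he); omega,
      fun he => by have := hinj _ _ (by omega) (by omega) (h.inj he); omega⟩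
  have hcl : ∀ z ∈ F, ∀ w, G.Adj z w → w ∈ F ∨ w = c (a + p) ∨ w = c (a + q) := by
    rintro z ⟨s, h1, h2, hz, hzp, hzq⟩ w ha
    by_cases hwp : w = c (a + p)
    · exact .inr (.inl hwp)
    by_cases hwq : w = c (a + q)
    · exact .inr (.inr hwq)
    left
    rcases h.adj z w ha with e | ⟨e1, e2, e⟩
    · exact ⟨s, h1, h2, e ▸ hz, hwp, hwq⟩
    · rw [hz] at e1
      have h1 : p < s := lt_of_le_of_ne h1 (by rintro rfl; exact hzp e1)
      have h2 : s < q := lt_of_le_of_ne h2 (by rintro rfl; exact hzq e1)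
      rcases e with e | e
      · exact ⟨s + 1, by omega, by omega, by rw [e, hz]; push_cast; ring, hwp, hwq⟩
      · refine ⟨s - 1, by omega, by omega, ?_, hwp, hwq⟩
        rw [Nat.cast_sub (by omega)]; push_cast; linear_combination hz - e
  have hbr : ∀ s : ℕ, s = p ∨ s = q → ∃ z ∈ F, π z = a + s ∧ z ≠ c (a + s) ∧
      G.Adj (c (a + s)) z := by
    intro s hs
    have hcut : IsCutVertex G (c (a + s)) := by rcases hs with rfl | rfl <;> assumption
    have h1 : c (a + s) ∉ R := hd s (by omega) (by omega)
    obtain ⟨l, hl, hm⟩ := (h.mem_R1_iff hG _).1 (h.mem_R1_of_notMem hG hR h1 hcut)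
    obtain ⟨y, l, rfl⟩ := List.exists_cons_of_ne_nil hl.ne_nil
    obtain ⟨e1, e2⟩ := (hm y).1 (by simp)
    have hy : ∀ j, y ≠ c j := fun j he => by
      rw [he, h.proj] at e1; exact e2 (he.trans (by rw [e1]))
    exact ⟨y, ⟨s, by omega, by omega, e1, hy _, hy _⟩, e1, e2, hl.adj_head⟩
  refine hR.1.notMem_of_fort (F := F) ?_ ?_ ?_ _ (hmid (p + 1) (by omega) hpq)
  · rintro v hv ⟨s, h1, h2, hz, -⟩
    exact hdis v hv s (by omega) (by omega) hz
  · intro v hv w ha hw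
    rcases hcl w hw v ha.symm with h1 | rfl | rfl
    · obtain ⟨s, h1, h2, hz, -⟩ := h1
      exact hdis v hv s (by omega) (by omega) hz
    · exact hd p hp0 hpm hv
    · exact hd q hq hqm hv
  · intro v hv w hw ha
    rcases hcl w hw v ha.symm with h1 | rfl | rfl
    · exact absurd h1 hv
    · obtain ⟨z, hzF, hz1, hz2, hz3⟩ := hbr p (.inl rfl)
      by_cases hzw : z = w
      · refine ⟨c (a + (p + 1 : ℕ)), hmid (p + 1) (by omega) hpq, ?_, ?_⟩
        · rintro he
          rw [hzw, ← he, h.proj] at hz1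
          have := hinj _ _ (by omega) (by omega) hz1; omega
        · push_cast; rw [← add_assoc]; exact h.adj_succ _
      · exact ⟨z, hzF, hzw, hz3⟩
    · obtain ⟨z, hzF, hz1, hz2, hz3⟩ := hbr q (.inr rfl)
      by_cases hzw : z = w
      · refine ⟨c (a + (q - 1 : ℕ)), hmid (q - 1) (by omega) (by omega), ?_, ?_⟩
        · rintro he
          rw [hzw, ← he, h.proj] at hz1
          have := hinj _ _ (by omega) (by omega) hz1; omega
        · rw [Nat.cast_sub (by omega)]; push_cast; rw [← add_sub_assoc]
          exact h.isCyclic.exists_pred _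
      · exact ⟨z, hzF, hzw, hz3⟩

end IsRing

end Segments

/-! ### Missed vertices off the cycles, and the lower bound -/

section Bounds

variable {V : Type u} {G : SimpleGraph V}

theorem exists_isCyclic_of_reachable {v a b : V} (hab : a ≠ b) (ha : G.Adj v a) (hb : G.Adj v b)
    (h : (deleteVertex G v).Reachable ⟨a, ha.ne.symm⟩ ⟨b, hb.ne.symm⟩) :
    ∃ (k : ℕ) (c : ZMod k → V), IsCyclic G c ∧ ∃ i, c i = v := by
  obtain ⟨p, hp⟩ := h.exists_isPath
  have hl : 0 < p.length := by
    rcases Nat.eq_zero_or_pos p.length with h0 | h0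
    · exact absurd (congrArg Subtype.val (Walk.eq_of_length_eq_zero h0)) hab
    · exact h0
  -- The closed sequence consists of `v`, the path from `a` to `b`, and `v` again.
  let f : ℕ → V := fun t => if t = 0 ∨ p.length + 2 ≤ t then v else (p.getVert (t - 1) : V)
  have hf0 : f 0 = v := by simp [f]
  have hfl : f (p.length + 2) = v := by simp [f]
  have hfm : ∀ t, t ≤ p.length → f (t + 1) = p.getVert t := fun t ht => by
    simp only [f, Nat.add_sub_cancel]; rw [if_neg (by omega)]
  have hne : ∀ t, t ≤ p.length → f (t + 1) ≠ v := fun t ht => by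
    rw [hfm t ht]; exact (p.getVert t).2
  refine ⟨p.length + 2, _, IsCyclic.of_nat (by omega) f (hfl.trans hf0.symm) ?_ ?_, 0, by
    simpa using hf0⟩
  · intro i hi j hj hij
    cases i with
    | zero =>
      cases j with
      | zero => rfl
      | succ j => exact absurd (hij.symm.trans hf0) (hne j (by omega))
    | succ i =>
      cases j with
      | zero => exact absurd (hij.trans hf0) (hne i (by omega))
      | succ j =>
        rw [hfm i (by omega), hfm j (by omega)] at hij
        rw [hp.getVert_injOn (by simp; omega) (by simp; omega) (Subtype.ext hij)]
  · intro i hi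
    cases i with
    | zero => rw [hf0, hfm 0 (by omega), p.getVert_zero]; exact ha
    | succ i =>
      rcases (by omega : i < p.length ∨ i = p.length) with h1 | h1
      · rw [hfm i (by omega), hfm (i + 1) (by omega)]
        exact p.adj_getVert_succ h1
      · rw [h1, hfl, hfm _ le_rfl, p.getVert_length]; exact hb.symm

/-- `R` lies in one component `K` of `G - v`, and `v` has a single neighbour `u` in `K` because it
is on no cycle. The other vertices are not reached by rule 1 and do not form a fort, so they hang at
`v` as a tail, if there are any. Then `v` with this tail is a tail at `u`. -/
theorem mem_pendantPath_of_notMem [Finite V] (hG : G.Connected) {R : Set V}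
    (hR : IsConnPowerDominating G R) {v : V} (hv : v ∉ R)
    (hcyc : ∀ (k : ℕ) (c : ZMod k → V), IsCyclic G c → ∀ i, c i ≠ v) :
    IsPathGraph G ∨ ∃ P, IsPendantPath G P ∧ v ∈ P := by
  have hne : ∀ r ∈ R, r ≠ v := fun r hr he => hv (he ▸ hr)
  have hsub : R ⊆ ({v}ᶜ : Set V) := fun r hr => hne r hr
  have hRR : ∀ r (hr : r ∈ R) s (hs : s ∈ R),
      (deleteVertex G v).Reachable ⟨r, hne r hr⟩ ⟨s, hne s hs⟩ := fun r hr s hs =>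
    (hR.2.preconnected ⟨r, hr⟩ ⟨s, hs⟩).map (induceHomOfLE G hsub).toHom
  obtain ⟨r₀, hr₀⟩ := hR.nonempty
  let K : Set V := {w | ∃ hw : w ≠ v, (deleteVertex G v).Reachable ⟨w, hw⟩ ⟨r₀, hne r₀ hr₀⟩}
  have hKcl : ∀ z ∈ K, ∀ w, w ≠ v → G.Adj z w → w ∈ K := by
    rintro z ⟨hz, hzr⟩ w hw ha
    have : (deleteVertex G v).Adj ⟨w, hw⟩ ⟨z, hz⟩ := ha.symm
    exact ⟨hw, this.reachable.trans hzr⟩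
  have hRK : ∀ r ∈ R, r ∈ K := fun r hr => ⟨hne r hr, hRR r hr r₀ hr₀⟩
  have hu : ∃ u ∈ K, G.Adj v u := by
    obtain ⟨p⟩ := hG.preconnected r₀ v
    have : ∀ (a b : V) (p : G.Walk a b), b = v → a ∈ K → ∃ u ∈ K, G.Adj v u := by
      intro a b p
      induction p with
      | nil => rintro rfl ⟨h, -⟩; exact absurd rfl h
      | @cons a b _ ha p ih =>
        intro hb hK
        by_cases hbv : b = v
        · exact ⟨a, hK, hbv ▸ ha.symm⟩
        · exact ih hb (hKcl a hK b hbv ha)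
    exact this _ _ p rfl (hRK r₀ hr₀)
  obtain ⟨u, huK, hvu⟩ := hu
  have huu : ∀ z ∈ K, G.Adj v z → z = u := by
    rintro z ⟨hz, hzr⟩ ha
    by_contra hzu
    obtain ⟨k, c, hc, i, hi⟩ := exists_isCyclic_of_reachable hzu ha hvu (hzr.trans huK.2.symm)
    exact hcyc k c hc i hi
  suffices h : ∃ l, IsTail G u (v :: l) by
    obtain ⟨l, hl⟩ := h
    rcases hl.isPathGraph_or hG with h | ⟨P, hP, hm⟩
    · exact .inl h
    · exact .inr ⟨P, hP, hm v (by simp)⟩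
  by_cases hF : ∃ z₀, z₀ ≠ v ∧ z₀ ∉ K
  swap
  · push Not at hF
    exact ⟨[], .leaf fun z => ⟨fun ha => huu z (hF z ha.ne.symm) ha, fun h => h ▸ hvu⟩⟩
  obtain ⟨z₀, hz₀⟩ := hF
  let F : Set V := {z | z ≠ v ∧ z ∉ K}
  have hFcl : ∀ z ∈ F, ∀ w, G.Adj z w → w ∈ F ∨ w = v := by
    rintro z ⟨hzv, hzK⟩ w ha
    by_cases hwv : w = v
    · exact .inr hwv
    · exact .inl ⟨hwv, fun hw => hzK (hKcl w hw z hzv ha.symm)⟩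
  have hnf : ¬ ∀ w ∈ F, G.Adj v w → ∃ x ∈ F, x ≠ w ∧ G.Adj v x := by
    intro hf
    refine hR.1.notMem_of_fort (F := F) (fun r hr hrF => hrF.2 (hRK r hr))
      (fun r hr w ha hw => ?_) (fun a ha w hw haw => ?_) z₀ hz₀
    · rcases hFcl w hw r ha.symm with h | h
      · exact h.2 (hRK r hr)
      · exact hne r hr h
    · rcases hFcl w hw a haw.symm with h | rfl
      · exact absurd h ha
      · exact hf w hw haw
  push Not at hnf
  obtain ⟨y, hy, hvy, hyu⟩ := hnf
  have hyu' : ∀ z ∈ F, G.Adj v z → z = y := fun z hz ha => by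
    by_contra hne; exact hyu z hz hne ha
  obtain ⟨l, hl, hm⟩ := hR.1.exists_isTail (K := F) hv
    (Set.disjoint_left.2 fun r hr hrF => hrF.2 (hRK r hr)) (fun h => h.1 rfl) hy hvy hyu' hFcl
  obtain ⟨x, l, rfl⟩ := List.exists_cons_of_ne_nil hl.ne_nil
  obtain rfl : x = y := hyu' x ((hm x).2 (by simp)) hl.adj_head
  refine ⟨x :: l, .cons (fun h => hy.2 (h ▸ huK)) (fun z => ⟨fun ha => ?_, ?_⟩) hl⟩
  · by_cases hz : z ∈ K
    · exact .inl (huu z hz ha)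
    · exact .inr (hyu' z ⟨ha.ne.symm, hz⟩ ha)
  · rintro (rfl | rfl) <;> assumption

theorem IsCactus.exists_isRing_of_mem [Fintype V] (hC : IsCactus G) (hG : G.Connected)
    {C : Finset V} (h : C ∈ cycleSets G) :
    ∃ (k : ℕ) (c : ZMod k → V) (π : V → ZMod k), IsRing G c π ∧ ∀ w, w ∈ C ↔ ∃ i, c i = w := by
  obtain ⟨k, c, hc, hm⟩ := mem_cycleSets_iff.1 h
  obtain ⟨π, hπ⟩ := hC.exists_isRing hG hc
  exact ⟨k, c, π, hπ, hm⟩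

/-- Every vertex is in `R`, in a pendant path or in some `C \ R`; the latter is a segment by
`IsRing.exists_arc`, and feasible because `R` avoids it. -/
theorem card_le_of_isConnPowerDominating [Fintype V] (hG : G.Connected) (hC : IsCactus G)
    (hnp : ¬ IsPathGraph G) {R : Finset V} (hR : IsConnPowerDominating G (R : Set V)) :
    Fintype.card V ≤ R.card + ∑ P ∈ pendantPaths G, P.card +
      ∑ C ∈ cycleSets G, maxFeasible G C := by
  classical
  have hcov : (Finset.univ : Finset V) ⊆ R ∪ (pendantPaths G).biUnion id ∪
      (cycleSets G).biUnion fun C => C \ R := by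
    intro v _
    simp only [Finset.mem_union, Finset.mem_biUnion, Finset.mem_sdiff, id]
    by_cases hv : v ∈ R
    · exact .inl (.inl hv)
    by_cases hcyc : ∃ C ∈ cycleSets G, v ∈ C
    · obtain ⟨C, hC, hvC⟩ := hcyc
      exact .inr ⟨C, hC, hvC, hv⟩
    · rcases mem_pendantPath_of_notMem hG hR (v := v) (by simpa using hv) (by
        rintro k c hc i rfl
        have : NeZero k := ⟨by have := hc.three_le; omega⟩
        exact hcyc ⟨Finset.univ.image c, mem_cycleSets_iff.2 ⟨k, c, hc, by simp⟩, by simp⟩) with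
        h | ⟨P, hP, hvP⟩
      · exact absurd h hnp
      · exact .inl (.inr ⟨P, by simpa [pendantPaths] using hP, hvP⟩)
  have h1 := (Finset.card_le_card hcov).trans ((Finset.card_union_le _ _).trans
    (Nat.add_le_add ((Finset.card_union_le _ _).trans
      (Nat.add_le_add_left Finset.card_biUnion_le _)) Finset.card_biUnion_le))
  rw [Finset.card_univ] at h1
  refine h1.trans (Nat.add_le_add_left (Finset.sum_le_sum fun C hCC => ?_) _)
  obtain ⟨k, c, π, h, hm⟩ := hC.exists_isRing_of_mem hG hCC
  refine Finset.le_sup (f := Finset.card) ?_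
  rw [Finset.mem_filter]
  refine ⟨Finset.mem_univ _, (h.isSegment_iff hm).2 ?_, R, hR, ?_⟩
  · obtain ⟨a, m, hmk, harc⟩ := h.exists_arc hR
    refine ⟨a, m, hmk, fun w => ?_⟩
    rw [Finset.mem_sdiff, hm]
    constructor
    · rintro ⟨⟨i, rfl⟩, hw⟩
      exact (harc i).1 (by simpa using hw)
    · rintro ⟨t, ht0, ht, rfl⟩
      exact ⟨⟨_, rfl⟩, by simpa using (harc _).2 ⟨t, ht0, ht, rfl⟩⟩
  · rw [Finset.disjoint_coe]; exact Finset.disjoint_sdiff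

theorem cutVertexCondition_of_isFeasible [Fintype V] (hG : G.Connected) (hC : IsCactus G)
    {C S : Finset V} (hCC : C ∈ cycleSets G) (hS : IsSegment G C S) (hf : IsFeasible G S) :
    CutVertexCondition G S := by
  obtain ⟨k, c, π, h, hm⟩ := hC.exists_isRing_of_mem hG hCC
  obtain ⟨a, m, hmk, harc⟩ := (h.isSegment_iff hm).1 hS
  obtain ⟨R, hR, hd⟩ := hf
  exact (h.cutVertexCondition_iff hmk harc).2 (h.arcCondition_of_disjoint hG hR hmk
    fun i hi him hc => Set.disjoint_left.1 hd hc ((harc _).2 ⟨i, hi, him, rfl⟩))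

/-! ### The upper bound -/

theorem IsPendantPathAt.vertex_unique {x y : V} {P : Finset V} (hx : IsPendantPathAt G x P)
    (hy : IsPendantPathAt G y P) : x = y := by
  obtain ⟨l, hl, hm⟩ := hx.exists_isTail
  obtain ⟨l', hl', hm'⟩ := hy.exists_isTail
  obtain ⟨a, l, rfl⟩ := List.exists_cons_of_ne_nil hl.ne_nil
  rcases hl'.mem_or_eq a ((hm' a).1 ((hm a).2 (by simp))) x hl.adj_head.symm with h | h
  · exact absurd ((hm x).1 ((hm' x).2 h)) hl.notMem
  · exact h

theorem IsPendantPathAt.notMem {x : V} {P Q : Finset V} (hx : IsPendantPathAt G x P)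
    (hQ : IsPendantPath G Q) : x ∉ Q := fun h => by
  have := hQ.ncard_le h
  have := hx.1
  omega

/-- A walk inside `P` can leave `Q` only through the attachment vertex of `Q`, whose degree is too
large for a vertex of `P`. -/
theorem IsPendantPath.eq_of_mem {P Q : Finset V} (hP : IsPendantPath G P)
    (hQ : IsPendantPath G Q) {z : V} (hzP : z ∈ P) (hzQ : z ∈ Q) : P = Q := by
  have key : ∀ P Q : Finset V, IsPendantPath G P → IsPendantPath G Q → z ∈ P → z ∈ Q → P ⊆ Q := by
    rintro P Q hP hQ hzP hzQ w hw
    obtain ⟨x, hx⟩ := hP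
    obtain ⟨y, hy⟩ := hQ
    obtain ⟨l, hl, hm⟩ := hx.exists_isTail
    obtain ⟨l', hl', hm'⟩ := hy.exists_isTail
    obtain ⟨-, ⟨K, hK⟩, -⟩ := id hx
    have h1 : z ∈ (P : Set V) := hzP
    have h2 : w ∈ (P : Set V) := hw
    rw [hK] at h1 h2
    obtain ⟨a, ha, rfl⟩ := h1
    obtain ⟨b, hb, rfl⟩ := h2
    refine (mem_of_reachable_induce (A := {z | z ∈ P ∧ z ∈ Q}) (fun z hz w hw hadj => ?_)
      (K.reachable_of_mem_supp ha hb) ⟨hzP, hzQ⟩).2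
    have hwP : w ∈ P := (hm w).2
      ((hl.mem_or_eq z ((hm z).1 hz.1) w hadj).resolve_right hw)
    refine ⟨hwP, (hm' w).2 ((hl'.mem_or_eq z ((hm' z).1 hz.2) w hadj).resolve_right ?_)⟩
    rintro rfl
    exact hy.notMem ⟨x, hx⟩ hwP
  exact Finset.Subset.antisymm (key P Q hP hQ hzP hzQ) (key Q P hQ hP hzQ hzP)

theorem IsCactus.cycleSets_eq [Fintype V] (hG : IsCactus G) {C D : Finset V}
    (hC : C ∈ cycleSets G) (hD : D ∈ cycleSets G) {x y : V} (hxy : x ≠ y) (hxC : x ∈ C)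
    (hyC : y ∈ C) (hxD : x ∈ D) (hyD : y ∈ D) : C = D := by
  have key : ∀ C D : Finset V, C ∈ cycleSets G → D ∈ cycleSets G → x ∈ C → y ∈ C → x ∈ D →
      y ∈ D → C ⊆ D := by
    intro C D hC hD hxC hyC hxD hyD w hw
    obtain ⟨k, c, hc, hmc⟩ := mem_cycleSets_iff.1 hC
    obtain ⟨l, d, hd, hmd⟩ := mem_cycleSets_iff.1 hD
    obtain ⟨i, rfl⟩ := (hmc w).1 hw
    obtain ⟨j, hj⟩ := hG.edges_subset hd hc hxy ((hmd _).1 hxD) ((hmd _).1 hyD) ((hmc _).1 hxC)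
      ((hmc _).1 hyC) i
    rcases Sym2.eq_iff.1 hj with ⟨h, -⟩ | ⟨h, -⟩ <;> exact (hmd _).2 ⟨_, h.symm⟩
  exact Finset.Subset.antisymm (key C D hC hD hxC hyC hxD hyD) (key D C hD hC hxD hyD hxC hyC)

/-- A neighbour of an excluded vertex of a cycle lies on the cycle or in a pendant path. -/
theorem IsRing.mem_or_pendant [Finite V] {k : ℕ} {c : ZMod k → V} {π : V → ZMod k}
    (h : IsRing G c π) (hG : G.Connected) {i : ZMod k}
    (hi : IsCutVertex G (c i) → c i ∈ R1 G) {z : V} (hz : G.Adj (c i) z) :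
    z = c (i + 1) ∨ z = c (i - 1) ∨ IsCutVertex G (c i) ∧ ∃ P, IsPendantPathAt G (c i) P ∧ z ∈ P ∧
      ∀ w, w ∈ P ↔ π w = i ∧ w ≠ c i := by
  classical
  rcases h.adj _ _ hz with h1 | ⟨-, h1, h2⟩
  · right; right
    rw [h.proj] at h1
    have hcut := (h.isCutVertex_iff hG i).2 ⟨z, h1.symm, hz.ne.symm⟩
    obtain ⟨l, hl, hm⟩ := (h.mem_R1_iff hG i).1 (hi hcut)
    exact ⟨hcut, l.toFinset, hl.isPendantPathAt (h.three_le_of_isTail hl) (by simp),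
      by simpa using (hm z).2 ⟨h1.symm, hz.ne.symm⟩, by simpa using hm⟩
  · rw [h.proj] at h2
    rcases h2 with h2 | h2
    · left; rw [h1, h2]
    · right; left; rw [h1, h2]; congr 1; ring

/-- Colour enters from both ends. Inner vertices at positions other than `j` and `j + 1` have only
their two cycle neighbours, so the wave from the left gets up to `j` and the wave from the right
down to `j + 1`. -/
theorem IsRing.observed_arc [Finite V] {k : ℕ} {c : ZMod k → V} {π : V → ZMod k}
    (h : IsRing G c π) (hG : G.Connected) {R : Set V} {a : ZMod k} {m : ℕ}
    (harc : ArcCondition G c a m) (h0 : c a ∈ R) (h1 : c (a + (m + 1 : ℕ)) ∈ R) :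
    ∀ i ≤ m, Observed G R (c (a + i)) := by
  obtain ⟨hR1, j, hj⟩ := harc
  have hnb : ∀ i : ℕ, 0 < i → i ≤ m → i ≠ j → i ≠ j + 1 → ∀ z, G.Adj (c (a + i)) z →
      z = c (a + (i + 1 : ℕ)) ∨ z = c (a + (i - 1 : ℕ)) := by
    intro i hi him hij hij' z hz
    rcases h.mem_or_pendant hG (hR1 i hi him) hz with h | h | h
    · left; rw [h]; push_cast; congr 1; ring
    · right; rw [h, Nat.cast_sub hi]; push_cast; congr 1; ring
    · rcases hj i hi him h.1 with h | h <;> contradiction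
  have hadj : ∀ i : ℕ, G.Adj (c (a + i)) (c (a + (i + 1 : ℕ))) := fun i => by
    push_cast; rw [← add_assoc]; exact h.adj_succ _
  -- Two consecutive positions are carried along, since forcing the next vertex requires that the
  -- previous one is coloured.
  have hleft : ∀ i : ℕ, (i ≤ m → i ≤ j → Observed G R (c (a + i))) ∧
      (i + 1 ≤ m → i + 1 ≤ j → Observed G R (c (a + (i + 1 : ℕ)))) := by
    intro i
    induction i with
    | zero =>
      refine ⟨fun _ _ => .self (by simpa using h0), fun _ _ => .dominate h0 ?_⟩
      simpa using hadj 0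
    | succ i ih =>
      refine ⟨ih.2, fun h1 h2 => .force (ih.2 (by omega) (by omega)) (hadj _) fun z hz hne => ?_⟩
      rcases hnb (i + 1) (by omega) (by omega) (by omega) (by omega) z hz with h | h
      · exact absurd h hne
      · rw [h]; exact ih.1 (by omega) (by omega)
  have hright : ∀ t i : ℕ, (i + t = m + 1 → j < i → Observed G R (c (a + i))) ∧
      (i + t = m → j < i → Observed G R (c (a + i))) := by
    intro t
    induction t with
    | zero =>
      intro i
      refine ⟨fun hi _ => .self (by rw [add_zero] at hi; rwa [hi]), fun hi _ => ?_⟩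
      rw [add_zero] at hi
      subst hi
      exact .dominate h1 (hadj i).symm
    | succ t ih =>
      intro i
      refine ⟨fun hi hji => (ih i).2 (by omega) hji, fun hi hji => ?_⟩
      refine .force ((ih (i + 1)).2 (by omega) (by omega)) (hadj i).symm fun z hz hne => ?_
      rcases hnb (i + 1) (by omega) (by omega) (by omega) (by omega) z hz with h | h
      · rw [h]; exact (ih (i + 1 + 1)).1 (by omega) (by omega)
      · exact absurd h hne
  intro i hi
  rcases Nat.lt_or_ge j i with h | h
  · exact (hright (m - i) i).2 (by omega) h
  · exact (hleft i).1 hi h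

end Bounds

/-! ### The remaining vertices form a connected power dominating set -/

section Upper

variable {V : Type u} {G : SimpleGraph V}

/-- The vertices outside all pendant paths and outside the segments `f C`. -/
def remaining [Fintype V] (G : SimpleGraph V) (f : Finset V → Finset V) : Set V :=
  {v | (∀ P, IsPendantPath G P → v ∉ P) ∧ ∀ C ∈ cycleSets G, v ∉ f C}

variable [Fintype V] (hG : G.Connected) (hC : IsCactus G) {f : Finset V → Finset V}
  (hf : ∀ C ∈ cycleSets G, IsSegment G C (f C) ∧ CutVertexCondition G (f C))

include hG hC hf

theorem exists_ring_segment {C : Finset V} (h : C ∈ cycleSets G) :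
    ∃ (k : ℕ) (c : ZMod k → V) (π : V → ZMod k) (a : ZMod k) (m : ℕ), IsRing G c π ∧
      (∀ w, w ∈ C ↔ ∃ i, c i = w) ∧ m < k ∧ IsArc c a m (f C) ∧ ArcCondition G c a m := by
  obtain ⟨k, c, π, hr, hm⟩ := hC.exists_isRing_of_mem hG h
  obtain ⟨a, m, hmk, harc⟩ := (hr.isSegment_iff hm).1 (hf C h).1
  exact ⟨k, c, π, a, m, hr, hm, hmk, harc, (hr.cutVertexCondition_iff hmk harc).1 (hf C h).2⟩

theorem segment_subset {C : Finset V} (h : C ∈ cycleSets G) {x : V} (hx : x ∈ f C) : x ∈ C := by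
  obtain ⟨k, c, π, a, m, hr, hm, hmk, harc, -⟩ := exists_ring_segment hG hC hf h
  obtain ⟨i, -, -, rfl⟩ := (harc x).1 hx
  exact (hm _).2 ⟨_, rfl⟩

theorem segment_neighbor {C : Finset V} (h : C ∈ cycleSets G) {x z : V} (hx : x ∈ f C)
    (hz : G.Adj x z) : z ∈ C ∨ ∃ P, IsPendantPathAt G x P ∧ z ∈ P := by
  obtain ⟨k, c, π, a, m, hr, hm, hmk, harc, hcond⟩ := exists_ring_segment hG hC hf h
  obtain ⟨i, hi, him, rfl⟩ := (harc x).1 hx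
  rcases hr.mem_or_pendant hG (hcond.1 i hi him) hz with h | h | ⟨-, P, hP, hzP, -⟩
  · exact .inl ((hm z).2 ⟨_, h.symm⟩)
  · exact .inl ((hm z).2 ⟨_, h.symm⟩)
  · exact .inr ⟨P, hP, hzP⟩

omit hG hC hf in
theorem notMem_pendantPath_of_mem_cycle {C P : Finset V} (h : C ∈ cycleSets G)
    (hP : IsPendantPath G P) {x : V} (hx : x ∈ C) : x ∉ P := by
  obtain ⟨k, c, hc, hm⟩ := mem_cycleSets_iff.1 h
  obtain ⟨i, rfl⟩ := (hm x).1 hx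
  exact hP.notMem_cycle hc i

/-- The neighbours of a segment vertex are on `C` or in a pendant path, and cycles avoid pendant
paths. A second cycle through the vertex would share one more vertex with `C`. -/
theorem eq_of_mem_segment {C D : Finset V} (h : C ∈ cycleSets G) (hD : D ∈ cycleSets G) {x : V}
    (hx : x ∈ f C) (hxD : x ∈ D) : C = D := by
  obtain ⟨l, d, hd, hmd⟩ := mem_cycleSets_iff.1 hD
  obtain ⟨j, rfl⟩ := (hmd x).1 hxD
  rcases segment_neighbor hG hC hf h hx (hd.adj_succ j) with h1 | ⟨P, hP, hz⟩
  · exact hC.cycleSets_eq h hD (hd.adj_succ j).ne (segment_subset hG hC hf h hx) h1 hxD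
      ((hmd _).2 ⟨_, rfl⟩)
  · exact absurd hz (IsPendantPath.notMem_cycle ⟨_, hP⟩ hd _)

theorem mem_remaining_of_mem_cycle {C : Finset V} (h : C ∈ cycleSets G) {x : V} (hx : x ∈ C)
    (hxf : x ∉ f C) : x ∈ remaining G f := by
  refine ⟨fun P hP => notMem_pendantPath_of_mem_cycle h hP hx, fun D hD hxD => ?_⟩
  obtain rfl := eq_of_mem_segment hG hC hf hD h hxD hx
  exact hxf hxD

/-- The vertices of `C` outside the segment occupy the positions `m + 1, …, k`, which is a path
along the cycle to the base `c a`. In the retraction of `remaining_preconnected` the base replaces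
the segment. -/
theorem exists_base {C : Finset V} (h : C ∈ cycleSets G) :
    ∃ b, b ∈ remaining G f ∧ ∀ x ∈ C, x ∉ f C → ∀ (hb : b ∈ remaining G f)
      (hx : x ∈ remaining G f), (G.induce (remaining G f)).Reachable ⟨x, hx⟩ ⟨b, hb⟩ := by
  obtain ⟨k, c, π, a, m, hr, hm, hmk, harc, hcond⟩ := exists_ring_segment hG hC hf h
  have hmem : ∀ i : ℕ, m < i → i ≤ k → c (a + i) ∈ remaining G f := by
    intro i hi hik
    refine mem_remaining_of_mem_cycle hG hC hf h ((hm _).2 ⟨_, rfl⟩) fun hx => ?_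
    obtain ⟨j, hj0, hj, he⟩ := (harc _).1 hx
    rcases hik.lt_or_eq with h1 | rfl
    · have := hr.arc_inj (by omega) (by omega) he; omega
    · have := hr.arc_inj (i := j) (j := 0) (a := a) (by omega) (by omega) (by simpa using he); omega
  have ha : c a ∈ remaining G f := by simpa using hmem k hmk le_rfl
  refine ⟨c a, ha, fun x hx hxf hb hx' => ?_⟩
  have key : ∀ t i : ℕ, ∀ hit : i + t = k, ∀ hi : m < i,
      (G.induce (remaining G f)).Reachable ⟨c (a + i), hmem i hi (by omega)⟩ ⟨c a, ha⟩ := by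
    intro t
    induction t with
    | zero =>
      intro i hi _
      rw [add_zero] at hi; subst hi
      simp
    | succ t ih =>
      intro i hi hmi
      have : (G.induce (remaining G f)).Adj ⟨c (a + i), hmem i hmi (by omega)⟩
          ⟨c (a + (i + 1 : ℕ)), hmem (i + 1) (by omega) (by omega)⟩ := by
        have : G.Adj (c (a + i)) (c (a + (i + 1 : ℕ))) := by
          push_cast; rw [← add_assoc]; exact hr.adj_succ _
        exact this
      exact this.reachable.trans (ih (i + 1) (by omega) (by omega))
  obtain ⟨i, rfl⟩ := (hm x).1 hx
  obtain ⟨t, htk, rfl⟩ := exists_natCast_zmod hr.three_le a i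
  rcases Nat.eq_zero_or_pos t with h0 | h0
  · subst h0; simp
  · have : m < t := by
      by_contra hlt
      exact hxf ((harc _).2 ⟨t, h0, by omega, rfl⟩)
    exact key (k - t) t (by omega) this

/-- The graph is retracted to the remaining vertices: `ρ` moves a pendant path to its attachment
vertex, then `σ` moves a segment to the base of its cycle. Adjacent vertices get images that are
connected within the remaining set, so the connectivity of `G` carries over. -/
theorem remaining_preconnected : (G.induce (remaining G f)).Preconnected := by
  classical
  have := hG.nonempty
  choose! base hbase hreach using fun C => exists_base hG hC hf (C := C)
  have h1 : ∀ v, ∃ x, (∀ P, IsPendantPath G P → x ∉ P) ∧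
      ((∀ P, IsPendantPath G P → v ∉ P) ∧ x = v ∨ ∃ P, IsPendantPathAt G x P ∧ v ∈ P) := by
    intro v
    by_cases hv : ∃ P, IsPendantPath G P ∧ v ∈ P
    · obtain ⟨P, ⟨x, hx⟩, hvP⟩ := hv
      exact ⟨x, fun Q hQ => hx.notMem hQ, .inr ⟨P, hx, hvP⟩⟩
    · push Not at hv
      exact ⟨v, hv, .inl ⟨hv, rfl⟩⟩
  have h2 : ∀ x, (∀ P, IsPendantPath G P → x ∉ P) → ∃ r, r ∈ remaining G f ∧
      (x ∈ remaining G f ∧ r = x ∨ ∃ C ∈ cycleSets G, x ∈ f C ∧ r = base C) := by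
    intro x hx
    by_cases hxf : ∃ C ∈ cycleSets G, x ∈ f C
    · obtain ⟨C, hCC, hxC⟩ := hxf
      exact ⟨base C, hbase C hCC, .inr ⟨C, hCC, hxC, rfl⟩⟩
    · push Not at hxf
      exact ⟨x, ⟨hx, hxf⟩, .inl ⟨⟨hx, hxf⟩, rfl⟩⟩
  choose ρ hρ hρ' using h1
  choose! σ hσ hσ' using h2
  let g : V → remaining G f := fun v => ⟨σ (ρ v), hσ _ (hρ v)⟩
  have hρadj : ∀ v w, G.Adj v w → ρ v = ρ w ∨ G.Adj (ρ v) (ρ w) := by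
    have key : ∀ v w P, G.Adj v w → IsPendantPathAt G (ρ v) P → v ∈ P → ρ v = ρ w := by
      intro v w P ha hP hv
      obtain ⟨l, hl, hm⟩ := hP.exists_isTail
      rcases hl.mem_or_eq v ((hm v).1 hv) w ha with h | h
      · rcases hρ' w with ⟨h3, -⟩ | ⟨Q, hQ, hwQ⟩
        · exact absurd ((hm w).2 h) (h3 P ⟨_, hP⟩)
        · obtain rfl := IsPendantPath.eq_of_mem ⟨_, hP⟩ ⟨_, hQ⟩ ((hm w).2 h) hwQ
          exact hP.vertex_unique hQ
      · rcases hρ' w with ⟨-, h3⟩ | ⟨Q, hQ, hwQ⟩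
        · rw [h3, h]
        · exact absurd (h ▸ hwQ) (hρ v Q ⟨_, hQ⟩)
    intro v w ha
    rcases hρ' v with ⟨-, h3⟩ | ⟨P, hP, hv⟩
    · rcases hρ' w with ⟨-, h4⟩ | ⟨Q, hQ, hw⟩
      · right; rw [h3, h4]; exact ha
      · exact .inl (key w v Q ha.symm hQ hw).symm
    · exact .inl (key v w P ha hP hv)
  have hkey : ∀ x y C, (hx : ∀ P, IsPendantPath G P → x ∉ P) →
      (hy : ∀ P, IsPendantPath G P → y ∉ P) → G.Adj x y → C ∈ cycleSets G → x ∈ f C →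
      σ x = base C → (G.induce (remaining G f)).Reachable ⟨σ x, hσ x hx⟩ ⟨σ y, hσ y hy⟩ := by
    intro x y C hx hy ha hCC hxC hbx
    have hyC : y ∈ C := by
      rcases segment_neighbor hG hC hf hCC hxC ha with h | ⟨P, hP, hyP⟩
      · exact h
      · exact absurd hyP (hy P ⟨_, hP⟩)
    rcases hσ' y hy with ⟨h3, h4⟩ | ⟨D, hDD, hyD, h4⟩
    · have := hreach C hCC y hyC (h3.2 C hCC) (hbase C hCC) h3
      simp only [hbx, h4]
      exact this.symm
    · obtain rfl := eq_of_mem_segment hG hC hf hDD hCC hyD hyC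
      simp only [hbx, h4, Reachable.refl]
  have hgadj : ∀ v w, G.Adj v w → (G.induce (remaining G f)).Reachable (g v) (g w) := by
    intro v w ha
    rcases hρadj v w ha with h | h
    · have : g v = g w := Subtype.ext (by simp only [g, h])
      rw [this]
    · rcases hσ' (ρ v) (hρ v) with ⟨h3, h4⟩ | ⟨C, hCC, hx, h4⟩
      · rcases hσ' (ρ w) (hρ w) with ⟨h5, h6⟩ | ⟨C, hCC, hx, h6⟩
        · have : (G.induce (remaining G f)).Adj (g v) (g w) := by
            show G.Adj (σ (ρ v)) (σ (ρ w))
            rw [h4, h6]; exact h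
          exact this.reachable
        · exact (hkey _ _ C (hρ w) (hρ v) h.symm hCC hx h6).symm
      · exact hkey _ _ C (hρ v) (hρ w) h hCC hx h4
  have hg : ∀ v w, (G.induce (remaining G f)).Reachable (g v) (g w) := by
    intro v w
    obtain ⟨p⟩ := hG.preconnected v w
    induction p with
    | nil => rfl
    | cons ha _ ih => exact (hgadj _ _ ha).trans ih
  have hid : ∀ r : remaining G f, g r = r := by
    intro r
    have e1 : ρ r = r := by
      rcases hρ' r with ⟨-, h⟩ | ⟨P, hP, h⟩
      · exact h
      · exact absurd h (r.2.1 P ⟨_, hP⟩)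
    have e2 : σ r = r := by
      rcases hσ' r r.2.1 with ⟨-, h⟩ | ⟨C, hCC, h, -⟩
      · exact h
      · exact absurd h (r.2.2 C hCC)
    exact Subtype.ext (by simp only [g, e1, e2])
  intro r s
  have := hg r s
  rwa [hid, hid] at this

/-- Segments are coloured from their ends by `IsRing.observed_arc`, and afterwards each pendant path
from its attachment vertex by `IsTail.observed`. -/
theorem remaining_isPowerDominating : IsPowerDominating G (remaining G f) := by
  have hseg : ∀ C ∈ cycleSets G, ∀ x ∈ C, Observed G (remaining G f) x := by
    intro C h x hx
    by_cases hxf : x ∈ f C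
    swap
    · exact .self (mem_remaining_of_mem_cycle hG hC hf h hx hxf)
    obtain ⟨k, c, π, a, m, hr, hm, hmk, harc, hcond⟩ := exists_ring_segment hG hC hf h
    obtain ⟨i, hi0, hi, rfl⟩ := (harc x).1 hxf
    refine hr.observed_arc hG hcond ?_ ?_ i hi
    · refine mem_remaining_of_mem_cycle hG hC hf h ((hm _).2 ⟨_, rfl⟩) fun hx => ?_
      obtain ⟨j, hj0, hj, he⟩ := (harc _).1 hx
      have := hr.arc_inj (i := j) (j := 0) (a := a) (by omega) (by omega) (by simpa using he)
      omega
    · refine mem_remaining_of_mem_cycle hG hC hf h ((hm _).2 ⟨_, rfl⟩) fun hx => ?_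
      obtain ⟨j, hj0, hj, he⟩ := (harc _).1 hx
      rcases (by omega : m + 1 < k ∨ m + 1 = k) with h1 | h1
      · have := hr.arc_inj (by omega) h1 he; omega
      · rw [h1] at he
        have := hr.arc_inj (i := j) (j := 0) (a := a) (by omega) (by omega) (by simpa using he)
        omega
  have hnp : ∀ v, (∀ P, IsPendantPath G P → v ∉ P) → Observed G (remaining G f) v ∧
      (v ∈ remaining G f ∨ ∃ C ∈ cycleSets G, v ∈ f C) := by
    intro v hv
    by_cases hvf : ∃ C ∈ cycleSets G, v ∈ f C
    · obtain ⟨C, hCC, hvC⟩ := hvf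
      exact ⟨hseg C hCC v (segment_subset hG hC hf hCC hvC), .inr ⟨C, hCC, hvC⟩⟩
    · push Not at hvf
      exact ⟨.self ⟨hv, hvf⟩, .inl ⟨hv, hvf⟩⟩
  intro v
  by_cases hv : ∃ P, IsPendantPath G P ∧ v ∈ P
  swap
  · push Not at hv
    exact (hnp v hv).1
  obtain ⟨P, ⟨x, hx⟩, hvP⟩ := hv
  obtain ⟨l, hl, hm⟩ := hx.exists_isTail
  obtain ⟨h1, h2⟩ := hnp x fun Q hQ => hx.notMem hQ
  refine hl.observed h1 (fun z hz hzl => ?_) v ((hm v).1 hvP)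
  rcases h2 with h2 | ⟨C, hCC, hxC⟩
  · exact .dominate h2 hz
  · rcases segment_neighbor hG hC hf hCC hxC hz with h | ⟨Q, hQ, hzQ⟩
    · exact hseg C hCC z h
    · obtain ⟨k, c, π, a, m, hr, hmC, hmk, harc, hcond⟩ := exists_ring_segment hG hC hf hCC
      obtain ⟨i, hi, him, rfl⟩ := (harc x).1 hxC
      obtain ⟨y, l, rfl⟩ := List.exists_cons_of_ne_nil hl.ne_nil
      have hyP : y ∈ P := (hm y).2 (by simp)
      -- The branch at an attachment vertex inside a segment is a single pendant path, so `y` and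
      -- `z` would belong to the same one.
      exfalso
      have hside : ∀ z', G.Adj (c (a + i)) z' → (∃ P, IsPendantPath G P ∧ z' ∈ P) →
          IsCutVertex G (c (a + i)) ∧ ∃ P, IsPendantPathAt G (c (a + i)) P ∧ z' ∈ P ∧
            ∀ w, w ∈ P ↔ π w = a + i ∧ w ≠ c (a + i) := by
        rintro z' hz' ⟨Q, hQ, hzQ⟩
        rcases hr.mem_or_pendant hG (hcond.1 i hi him) hz' with h | h | h
        · exact absurd (h ▸ hzQ) (hQ.notMem_cycle hr.isCyclic _)
        · exact absurd (h ▸ hzQ) (hQ.notMem_cycle hr.isCyclic _)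
        · exact h
      obtain ⟨-, P', hP', hyP', hP''⟩ := hside y hl.adj_head ⟨P, ⟨_, hx⟩, hyP⟩
      obtain ⟨-, Q', hQ', hzQ', hQ''⟩ := hside z hz ⟨Q, ⟨_, hQ⟩, hzQ⟩
      obtain rfl := hx.unique hP' hyP hyP'
      exact hzl ((hm z).1 ((hP'' z).2 ((hQ'' z).1 hzQ')))

theorem remaining_nonempty (hne : (cycleSets G).Nonempty ∨ ∃ v, 3 ≤ (G.neighborSet v).ncard) :
    (remaining G f).Nonempty := by
  rcases (cycleSets G).eq_empty_or_nonempty with h0 | ⟨C, h⟩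
  · obtain ⟨v, hv⟩ := hne.resolve_left (by simp [h0])
    refine ⟨v, fun P hP hvP => ?_, by simp [h0]⟩
    have := hP.ncard_le hvP
    omega
  · obtain ⟨b, hb, -⟩ := exists_base hG hC hf h
    exact ⟨b, hb⟩

theorem isConnPowerDominating_remaining
    (hne : (cycleSets G).Nonempty ∨ ∃ v, 3 ≤ (G.neighborSet v).ncard) :
    IsConnPowerDominating G (remaining G f) :=
  ⟨remaining_isPowerDominating hG hC hf,
    { preconnected := remaining_preconnected hG hC hf
      nonempty := (remaining_nonempty hG hC hf hne).to_subtype }⟩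

/-- Pendant paths and segments are pairwise disjoint, so the sizes of the removed sets add up. The
additive form avoids truncated subtraction. -/
theorem connPowerDomNumber_le
    (hne : (cycleSets G).Nonempty ∨ ∃ v, 3 ≤ (G.neighborSet v).ncard) :
    connPowerDomNumber G + ∑ P ∈ pendantPaths G, P.card + ∑ C ∈ cycleSets G, (f C).card ≤
      Fintype.card V := by
  classical
  have hpp : ∀ P, P ∈ pendantPaths G ↔ IsPendantPath G P := fun P => by simp [pendantPaths]
  let A := (pendantPaths G).biUnion id
  let B := (cycleSets G).biUnion f
  have hA : A.card = ∑ P ∈ pendantPaths G, P.card := by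
    refine Finset.card_biUnion fun P hP Q hQ hPQ => ?_
    rw [Function.onFun, Finset.disjoint_left]
    exact fun z hz hz' => hPQ (((hpp P).1 hP).eq_of_mem ((hpp Q).1 hQ) hz hz')
  have hB : B.card = ∑ C ∈ cycleSets G, (f C).card := by
    refine Finset.card_biUnion fun C hCC D hDD hCD => ?_
    rw [Function.onFun, Finset.disjoint_left]
    exact fun z hz hz' => hCD (eq_of_mem_segment hG hC hf hCC hDD hz
      (segment_subset hG hC hf hDD hz'))
  have hAB : Disjoint A B := by
    rw [Finset.disjoint_left]
    intro z hz hz'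
    obtain ⟨P, hP, hzP⟩ := Finset.mem_biUnion.1 hz
    obtain ⟨C, hCC, hzC⟩ := Finset.mem_biUnion.1 hz'
    exact notMem_pendantPath_of_mem_cycle hCC ((hpp P).1 hP) (segment_subset hG hC hf hCC hzC) hzP
  have hR : ((Finset.univ \ (A ∪ B) : Finset V) : Set V) = remaining G f := by
    ext v
    simp [A, B, remaining, hpp]
  have h1 : connPowerDomNumber G ≤ (Finset.univ \ (A ∪ B)).card :=
    Nat.sInf_le ⟨_, hR ▸ isConnPowerDominating_remaining hG hC hf hne, rfl⟩
  have h2 := Finset.card_sdiff_add_card_eq_card (Finset.subset_univ (A ∪ B))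
  rw [Finset.card_union_of_disjoint hAB, hA, hB, Finset.card_univ] at h2
  omega

end Upper

/-! ### Feasible segments, paths and cycles, and the formula -/

section Formula

variable {V : Type u} {G : SimpleGraph V}

theorem empty_segment [Fintype V] (hG : G.Connected) (hC : IsCactus G) {C : Finset V}
    (h : C ∈ cycleSets G) : IsSegment G C ∅ := by
  obtain ⟨k, c, π, hr, hm⟩ := hC.exists_isRing_of_mem hG h
  exact (hr.isSegment_iff hm).2 ⟨0, 0, by have := hr.three_le; omega, fun w => by
    simp only [Finset.notMem_empty, false_iff]
    rintro ⟨i, h0, h1, -⟩; omega⟩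

theorem cutVertexCondition_empty : CutVertexCondition G ∅ := .inl (by simp)

/-- For sufficiency only `S` and the pendant paths are removed; on all other cycles the chosen
segment is empty. -/
theorem isFeasible_iff [Fintype V] (hG : G.Connected) (hC : IsCactus G) {C S : Finset V}
    (h : C ∈ cycleSets G) (hS : IsSegment G C S) : IsFeasible G S ↔ CutVertexCondition G S := by
  classical
  refine ⟨cutVertexCondition_of_isFeasible hG hC h hS, fun hcv => ?_⟩
  have hf : ∀ D ∈ cycleSets G, IsSegment G D (if D = C then S else ∅) ∧
      CutVertexCondition G (if D = C then S else ∅) := by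
    intro D hD
    split_ifs with he
    · exact ⟨he ▸ hS, hcv⟩
    · exact ⟨empty_segment hG hC hD, cutVertexCondition_empty⟩
  refine ⟨_, isConnPowerDominating_remaining hG hC hf (.inl ⟨C, h⟩), ?_⟩
  rw [Set.disjoint_left]
  intro v hv hvS
  exact hv.2 C h (by simpa using hvS)

theorem exists_maxFeasible [Fintype V] (hG : G.Connected) (hC : IsCactus G) {C : Finset V}
    (h : C ∈ cycleSets G) :
    ∃ S, IsSegment G C S ∧ CutVertexCondition G S ∧ S.card = maxFeasible G C := by
  classical
  have hne : (Finset.univ.filter fun S : Finset V => IsSegment G C S ∧ IsFeasible G S).Nonempty :=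
    ⟨∅, by
      rw [Finset.mem_filter]
      exact ⟨Finset.mem_univ _, empty_segment hG hC h, (isFeasible_iff hG hC h
        (empty_segment hG hC h)).2 cutVertexCondition_empty⟩⟩
  obtain ⟨S, hS, hmax⟩ := Finset.exists_mem_eq_sup _ hne Finset.card
  rw [Finset.mem_filter] at hS
  exact ⟨S, hS.2.1, (isFeasible_iff hG hC h hS.2.1).1 hS.2.2, by rw [maxFeasible]; convert hmax.symm⟩

theorem IsPathGraph.ncard_le [Finite V] (h : IsPathGraph G) (v : V) :
    (G.neighborSet v).ncard ≤ 2 := by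
  obtain ⟨n, ⟨φ⟩⟩ := h
  -- For the end with number `0` the truncated `0 - 1` only adds a superfluous element to the bound.
  have hsub : (fun w => ((φ w : Fin n) : ℕ)) '' G.neighborSet v ⊆
      {((φ v : Fin n) : ℕ) - 1, ((φ v : Fin n) : ℕ) + 1} := by
    rintro _ ⟨w, hw, rfl⟩
    have := φ.map_rel_iff.2 hw
    rw [pathGraph_adj] at this
    simp only [Set.mem_insert_iff, Set.mem_singleton_iff]
    omega
  rw [← Set.ncard_image_of_injective (G.neighborSet v)
    (f := fun w => ((φ w : Fin n) : ℕ)) (Fin.val_injective.comp φ.injective)]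
  exact (Set.ncard_le_ncard hsub (Set.toFinite _)).trans
    ((Set.ncard_insert_le _ _).trans (by simp))

theorem IsCycleGraph.ncard_le [Finite V] (h : IsCycleGraph G) (v : V) :
    (G.neighborSet v).ncard ≤ 2 := by
  obtain ⟨n, hn, ⟨φ⟩⟩ := h
  obtain ⟨n, rfl⟩ : ∃ m, n = m + 2 := ⟨n - 2, by omega⟩
  have hsub : φ '' G.neighborSet v ⊆ {φ v - 1, φ v + 1} := by
    rintro _ ⟨w, hw, rfl⟩
    rw [← cycleGraph_neighborSet]
    exact φ.map_rel_iff.2 hw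
  rw [← Set.ncard_image_of_injective (G.neighborSet v) φ.injective]
  exact (Set.ncard_le_ncard hsub (Set.toFinite _)).trans
    ((Set.ncard_insert_le _ _).trans (by simp))

theorem IsRing.isCycleGraph [Finite V] {k : ℕ} {c : ZMod k → V} {π : V → ZMod k}
    (h : IsRing G c π) (hG : G.Connected) (hdeg : ∀ v, (G.neighborSet v).ncard ≤ 2) :
    IsCycleGraph G := by
  have hN : ∀ i, ∀ z, G.Adj (c i) z → ∃ j, c j = z := by
    intro i z hz
    by_contra! hn
    have hsub : ({c (i + 1), c (i - 1), z} : Set V) ⊆ G.neighborSet (c i) := by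
      rintro w (rfl | rfl | rfl)
      · exact h.adj_succ i
      · exact h.isCyclic.exists_pred i
      · exact hz
    have h3 : ({c (i + 1), c (i - 1), z} : Set V).ncard = 3 :=
      Set.ncard_eq_three.2 ⟨_, _, _, h.isCyclic.succ_ne_pred i, hn _, hn _, rfl⟩
    have := Set.ncard_le_ncard hsub (Set.toFinite _)
    have := hdeg (c i)
    omega
  have hsurj : Function.Surjective c := by
    intro v
    obtain ⟨p⟩ := hG.preconnected (c 0) v
    have : ∀ (a b : V) (p : G.Walk a b), (∃ j, c j = a) → ∃ j, c j = b := by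
      intro a b p
      induction p with
      | nil => exact id
      | cons ha _ ih => rintro ⟨j, rfl⟩; exact ih (hN j _ ha)
    exact this _ _ p ⟨0, rfl⟩
  have h3 := h.three_le
  obtain ⟨n, rfl⟩ : ∃ n, k = n + 2 := ⟨k - 2, by omega⟩
  refine ⟨n + 2, h3, ⟨RelIso.symm ⟨Equiv.ofBijective (α := Fin (n + 2)) c ⟨h.inj, hsurj⟩, ?_⟩⟩⟩
  intro a b
  rw [cycleGraph_adj]
  refine (h.adj_iff a b).trans ?_
  constructor
  · rintro (h | h)
    · right; rw [h]; exact add_sub_cancel_left (G := ZMod (n + 2)) a 1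
    · left; rw [h]; exact add_sub_cancel_left (G := ZMod (n + 2)) b 1
  · rintro (h | h)
    · right; exact (eq_add_of_sub_eq' (G := ZMod (n + 2)) h)
    · left; exact (eq_add_of_sub_eq' (G := ZMod (n + 2)) h)

/-- In a tree of maximum degree 2 the tail at a leaf can only grow into the whole path, as a pendant
path needs a vertex of degree 3. If there is a cycle, no edge leaves it, so it is everything. -/
theorem isPathGraph_or_isCycleGraph [Finite V] (hG : G.Connected) (hC : IsCactus G)
    (hdeg : ∀ v, (G.neighborSet v).ncard ≤ 2) : IsPathGraph G ∨ IsCycleGraph G := by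
  classical
  have := Fintype.ofFinite V
  by_cases hac : G.IsAcyclic
  · left
    rcases subsingleton_or_nontrivial V with hs | hnt
    · have := hG.nonempty
      obtain ⟨v⟩ := this
      refine isPathGraph_of_list (L := [v]) (by simp) (fun w => by simp [Subsingleton.elim w v]) ?_
      intro i j hi hj
      simp only [List.length_singleton] at hi hj
      simp [Nat.lt_one_iff.1 hi, Nat.lt_one_iff.1 hj]
    · obtain ⟨y, hy⟩ := IsTree.exists_vert_degree_one_of_nontrivial (G := G) ⟨hG, hac⟩
      obtain ⟨v, hv⟩ := (degree_eq_one_iff_existsUnique_adj (G := G)).1 hy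
      have ht : IsTail G v [y] := .leaf fun z => ⟨fun h => hv.2 z h, fun h => h ▸ hv.1⟩
      refine (ht.isPathGraph_or hG).resolve_right ?_
      rintro ⟨P, ⟨x, hx⟩, -⟩
      have := hx.1
      have := hdeg x
      omega
  · right
    simp only [IsAcyclic, not_forall, not_not] at hac
    obtain ⟨v, p, hp⟩ := hac
    obtain ⟨π, hπ⟩ := hC.exists_isRing hG (IsCyclic.of_isCycle hp)
    exact hπ.isCycleGraph hG hdeg

theorem connPowerDomNumber_eq_one {v : V} (h : IsPowerDominating G {v}) :
    connPowerDomNumber G = 1 := by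
  have hmem : 1 ∈ {k | ∃ S : Finset V, IsConnPowerDominating G (S : Set V) ∧ S.card = k} := by
    refine ⟨{v}, ⟨by simpa using h, ?_⟩, by simp⟩
    rw [Finset.coe_singleton]
    exact ⟨fun a b => by rw [Subsingleton.elim a b]⟩
  refine le_antisymm (Nat.sInf_le hmem) ?_
  obtain ⟨S, hS, hc⟩ := Nat.sInf_mem ⟨_, hmem⟩
  rw [connPowerDomNumber, ← hc, Nat.one_le_iff_ne_zero, Finset.card_ne_zero]
  exact_mod_cast hS.nonempty

theorem IsPathGraph.connPowerDomNumber_eq (hG : G.Connected) (h : IsPathGraph G) :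
    connPowerDomNumber G = 1 := by
  obtain ⟨n, ⟨φ⟩⟩ := h
  obtain ⟨v⟩ := hG.nonempty
  have hn : 0 < n := (φ v).pos
  refine connPowerDomNumber_eq_one (v := φ.symm ⟨0, hn⟩) ?_
  have key : ∀ i (hi : i < n), Observed G {φ.symm ⟨0, hn⟩} (φ.symm ⟨i, hi⟩) := by
    intro i
    induction i using Nat.strong_induction_on with
    | _ i ih =>
      intro hi
      rcases Nat.eq_zero_or_pos i with rfl | h0
      · exact .self rfl
      refine .force (ih (i - 1) (by omega) (by omega)) (φ.symm.map_rel_iff.2 ?_) fun z hz hne => ?_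
      · rw [pathGraph_adj]; simp; omega
      · obtain ⟨⟨j, hj⟩, rfl⟩ := φ.symm.surjective z
        have h1 := φ.symm.map_rel_iff.1 hz
        rw [pathGraph_adj] at h1
        simp only at h1
        refine ih j ?_ hj
        by_contra hlt
        refine hne ?_
        congr 2
        omega
  intro w
  have := key (φ w) (φ w).2
  simpa using this

theorem IsCycleGraph.connPowerDomNumber_eq (h : IsCycleGraph G) : connPowerDomNumber G = 1 := by
  obtain ⟨n, hn, ⟨φ⟩⟩ := h
  obtain ⟨n, rfl⟩ : ∃ m, n = m + 2 := ⟨n - 2, by omega⟩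
  refine connPowerDomNumber_eq_one (v := φ.symm 0) ?_
  let c : ZMod (n + 2) → V := φ.symm
  have hadj : ∀ i j, G.Adj (c i) (c j) ↔ j = i + 1 ∨ i = j + 1 := by
    intro i j
    refine (φ.symm.map_rel_iff.trans cycleGraph_adj).trans ?_
    constructor
    · rintro (h | h)
      · right; exact eq_add_of_sub_eq' (G := ZMod (n + 2)) h
      · left; exact eq_add_of_sub_eq' (G := ZMod (n + 2)) h
    · rintro (h | h)
      · right; rw [h]; exact add_sub_cancel_left (G := ZMod (n + 2)) i 1
      · left; rw [h]; exact add_sub_cancel_left (G := ZMod (n + 2)) j 1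
  have hsurj : ∀ z, ∃ j, c j = z := φ.symm.surjective
  have key : ∀ i : ℕ, Observed G {c 0} (c i) ∧ Observed G {c 0} (c (i + 1)) := by
    intro i
    induction i with
    | zero =>
      refine ⟨by rw [Nat.cast_zero]; exact .self rfl, .dominate rfl ((hadj _ _).2 (.inl ?_))⟩
      rw [Nat.cast_zero]
    | succ i ih =>
      push_cast
      refine ⟨ih.2, .force ih.2 ((hadj _ _).2 (.inl rfl)) fun z hz hne => ?_⟩
      obtain ⟨j, rfl⟩ := hsurj z
      rcases (hadj _ _).1 hz with rfl | h
      · exact absurd rfl hne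
      · rw [← add_right_cancel h]; exact ih.1
  intro w
  obtain ⟨j, rfl⟩ := hsurj w
  have := (key j.val).1
  rwa [ZMod.natCast_zmod_val] at this

/-- The upper bound with maximum segments meets the lower bound for a minimum set. As an equation in
natural numbers it also shows that the truncated subtractions of the program are exact. -/
theorem connPowerDomNumber_add [Fintype V] (hG : G.Connected) (hC : IsCactus G)
    (hn : ¬ (IsPathGraph G ∨ IsCycleGraph G)) :
    connPowerDomNumber G + ∑ P ∈ pendantPaths G, P.card + ∑ C ∈ cycleSets G, maxFeasible G C =
      Fintype.card V := by
  have hdeg : ∃ v, 3 ≤ (G.neighborSet v).ncard := by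
    by_contra! h
    exact hn (isPathGraph_or_isCycleGraph hG hC fun v => by have := h v; omega)
  choose! f hf1 hf2 hf3 using fun C => exists_maxFeasible hG hC (C := C)
  refine le_antisymm ?_ ?_
  · rw [← Finset.sum_congr rfl hf3]
    exact connPowerDomNumber_le hG hC (fun C h => ⟨hf1 C h, hf2 C h⟩) (.inr hdeg)
  · obtain ⟨R, hR, hc⟩ := exists_isConnPowerDominating hG
    rw [← hc]
    exact card_le_of_isConnPowerDominating hG hC (fun h => hn (.inl h)) hR

end Formula

/-! ### Program logic with running times, and the input format -/

section Machine

/-- `P` halts when started in `σ`, and the final store and the running time satisfy `Q`. -/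
def Halts (P : Prog) (σ : Store) (Q : Store → ℕ → Prop) : Prop :=
  ∃ τ t, Exec P σ τ t ∧ Q τ t

namespace Halts

variable {P P' : Prog} {σ : Store} {Q Q' : Store → ℕ → Prop} {b : Test}

theorem mono (h : Halts P σ Q) (hQ : ∀ τ t, Q τ t → Q' τ t) : Halts P σ Q' := by
  obtain ⟨τ, t, he, hq⟩ := h
  exact ⟨τ, t, he, hQ τ t hq⟩

/-- This and the next rules are equivalences, so that `simp` executes loop-free programs
symbolically, with the cost. -/
theorem skip_iff : Halts .skip σ Q ↔ Q σ 1 :=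
  ⟨fun ⟨_, _, he, hq⟩ => by cases he; exact hq, fun h => ⟨_, _, .skip σ, h⟩⟩

theorem assign_iff {i : ℕ} {e : Expr} :
    Halts (.assign i e) σ Q ↔ Q (σ.setReg i (e.eval σ)) (e.cost + 1) :=
  ⟨fun ⟨_, _, he, hq⟩ => by cases he; exact hq, fun h => ⟨_, _, .assign σ i e, h⟩⟩

theorem write_iff {a : ℕ} {e f : Expr} :
    Halts (.write a e f) σ Q ↔ Q (σ.setArr a (e.eval σ) (f.eval σ)) (e.cost + f.cost + 1) :=
  ⟨fun ⟨_, _, he, hq⟩ => by cases he; exact hq, fun h => ⟨_, _, .write σ a e f, h⟩⟩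

theorem seq_iff : Halts (.seq P P') σ Q ↔
    Halts P σ fun τ s => Halts P' τ fun ρ t => Q ρ (s + t) := by
  constructor
  · rintro ⟨τ, t, he, hq⟩
    cases he with
    | seq h1 h2 => exact ⟨_, _, h1, _, _, h2, hq⟩
  · rintro ⟨τ, s, h1, ρ, t, h2, hq⟩
    exact ⟨_, _, .seq h1 h2, hq⟩

theorem ite_iff : Halts (.ite b P P') σ Q ↔
    (b.holds σ → Halts P σ fun τ t => Q τ (b.cost + t)) ∧
    (¬ b.holds σ → Halts P' σ fun τ t => Q τ (b.cost + t)) := by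
  constructor
  · rintro ⟨τ, t, he, hq⟩
    cases he with
    | ite_true hb h => exact ⟨fun _ => ⟨_, _, h, hq⟩, fun hn => absurd hb hn⟩
    | ite_false hb h => exact ⟨fun hn => absurd hn hb, fun _ => ⟨_, _, h, hq⟩⟩
  · rintro ⟨h1, h2⟩
    by_cases hb : b.holds σ
    · obtain ⟨τ, t, h, hq⟩ := h1 hb
      exact ⟨_, _, .ite_true hb h, hq⟩
    · obtain ⟨τ, t, h, hq⟩ := h2 hb
      exact ⟨_, _, .ite_false hb h, hq⟩

/-- The rule for loops: `I τ t` holds whenever the test is reached in the store `τ` at time `t`. -/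
theorem while_rule (I : Store → ℕ → Prop) (μ : Store → ℕ)
    (hstep : ∀ τ t, I τ t → b.holds τ →
      Halts P τ fun ρ s => I ρ (t + b.cost + s) ∧ μ ρ < μ τ)
    (h0 : I σ 0) (hQ : ∀ τ t, I τ t → ¬ b.holds τ → Q τ (t + b.cost)) :
    Halts (.while b P) σ Q := by
  suffices h : ∀ n σ t, μ σ = n → I σ t → Halts (.while b P) σ fun τ s => Q τ (t + s) by
    simpa using h _ σ 0 rfl h0
  intro n
  induction n using Nat.strong_induction_on with
  | _ n ih =>
    intro σ t hn hI
    by_cases hb : b.holds σ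
    · obtain ⟨τ, s, he, hI', hlt⟩ := hstep σ t hI hb
      obtain ⟨ρ, s', he', hq⟩ := ih _ (hn ▸ hlt) τ _ rfl hI'
      refine ⟨ρ, _, .while_true hb he he', ?_⟩
      convert hq using 1
      ring
    · exact ⟨σ, _, .while_false hb, hQ σ t hI hb⟩

/-- The rule for loops with a known number of rounds. -/
theorem for_rule (N : ℕ) (I : ℕ → Store → Prop) (cost : ℕ → ℕ)
    (hb : ∀ i τ, i ≤ N → I i τ → (b.holds τ ↔ i < N))
    (hstep : ∀ i τ, i < N → I i τ → Halts P τ fun ρ s => I (i + 1) ρ ∧ b.cost + s ≤ cost i)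
    (h0 : I 0 σ) :
    Halts (.while b P) σ fun τ t => I N τ ∧ t ≤ ∑ i ∈ Finset.range N, cost i + b.cost := by
  -- Induction on the number `m` of rounds left. The bound for a round may depend on `i`, so that
  -- degrees and cycle lengths can be summed.
  suffices h : ∀ m i σ, i + m = N → I i σ → Halts (.while b P) σ fun τ t =>
      I N τ ∧ t ≤ ∑ j ∈ Finset.range m, cost (i + j) + b.cost by
    simpa using h N 0 σ (by omega) h0
  intro m
  induction m with
  | zero =>
    intro i σ hi hI
    rw [add_zero] at hi
    subst hi
    exact ⟨σ, _, .while_false (by rw [hb i σ le_rfl hI]; omega), hI, by simp⟩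
  | succ m ih =>
    intro i σ hi hI
    obtain ⟨τ, s, he, hI', hs⟩ := hstep i σ (by omega) hI
    obtain ⟨ρ, t, he', hI'', ht⟩ := ih (i + 1) τ (by omega) hI'
    refine ⟨ρ, _, .while_true ((hb i σ (by omega) hI).2 (by omega)) he he', hI'', ?_⟩
    rw [Finset.sum_range_succ', add_zero]
    have : ∑ j ∈ Finset.range m, cost (i + (j + 1)) = ∑ j ∈ Finset.range m, cost (i + 1 + j) :=
      Finset.sum_congr rfl fun j _ => by congr 1; ring
    omega

end Halts

namespace Store

variable (σ : Store)

theorem setReg_reg (i x j : ℕ) : (σ.setReg i x).reg j = if j = i then x else σ.reg j := by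
  simp [setReg, Function.update_apply]

theorem setReg_arr (i x : ℕ) : (σ.setReg i x).arr = σ.arr := rfl

theorem setArr_reg (a j x : ℕ) : (σ.setArr a j x).reg = σ.reg := rfl

theorem setArr_arr (a j x b : ℕ) : (σ.setArr a j x).arr b =
    if b = a then Function.update (σ.arr a) j x else σ.arr b := by
  by_cases h : b = a
  · subst h; simp [setArr]
  · simp [setArr, h]

end Store

/-! ### Adjacency lists -/

section Input

variable {n : ℕ} {G : SimpleGraph (Fin n)} {adj : Fin n → List (Fin n)}

/-- The position of the list of the vertex `j` in the concatenation of the adjacency lists. -/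
def listStart (adj : Fin n → List (Fin n)) (j : ℕ) : ℕ :=
  if j ≤ n then ∑ v : Fin n, if v.val < j then (adj v).length else 0 else 0

/-- The concatenation of the adjacency lists. -/
def listEntry (adj : Fin n → List (Fin n)) (j : ℕ) : ℕ :=
  ((List.ofFn adj).flatten.map Fin.val).getD j 0

theorem listStart_succ (v : Fin n) :
    listStart adj (v + 1) = listStart adj v + (adj v).length := by
  rw [listStart, listStart, if_pos (by omega), if_pos (by omega),
    ← Finset.add_sum_erase _ _ (Finset.mem_univ v),
    ← Finset.add_sum_erase (a := v) _ (fun w : Fin n => if w.val < v.val then (adj w).length else 0)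
      (Finset.mem_univ v)]
  simp only [lt_add_iff_pos_right, zero_lt_one, if_true, lt_irrefl, if_false, zero_add]
  rw [add_comm]
  congr 1
  refine Finset.sum_congr rfl fun w hw => ?_
  have : w.val ≠ v.val := fun h => (Finset.mem_erase.1 hw).1 (Fin.ext h)
  have : w.val < v.val + 1 ↔ w.val < v.val := by omega
  simp only [this]

theorem listEntry_start (v : Fin n) (i : ℕ) (hi : i < (adj v).length) :
    listEntry adj (listStart adj v + i) = ((adj v)[i] : Fin n) := by
  have key : ∀ m : ℕ, ∀ (adj : Fin m → List (Fin n)) (v : Fin m) (i : ℕ) (hi : i < (adj v).length),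
      (List.ofFn adj).flatten[(∑ w : Fin m, if w.val < v.val then (adj w).length else 0) + i]? =
        some (adj v)[i] := by
    intro m
    induction m with
    | zero => intro _ v; exact v.elim0
    | succ m ih =>
      intro adj v i hi
      rw [List.ofFn_succ, List.flatten_cons, Fin.sum_univ_succ]
      refine Fin.cases (fun hi => ?_) (fun v hi => ?_) v hi
      · simp only [Fin.val_zero, not_lt_zero, if_false, Finset.sum_const_zero,
          zero_add]
        rw [List.getElem?_append_left hi, List.getElem?_eq_getElem hi]
      · simp only [Fin.val_zero, Fin.val_succ, Nat.zero_lt_succ, if_true, Nat.succ_lt_succ_iff]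
        rw [List.getElem?_append_right (by omega), ← ih (fun w => adj w.succ) v i hi]
        congr 1
        omega
  rw [listEntry, listStart, if_pos (by omega), List.getD_eq_getElem?_getD, List.getElem?_map,
    key n adj v i hi]
  rfl

theorem IsAdjacencyList.length_eq (h : IsAdjacencyList G adj) (v : Fin n) :
    (adj v).length = (G.neighborSet v).ncard := by
  classical
  have : G.neighborSet v = ((adj v).toFinset : Set (Fin n)) := by
    ext w; simp [(h v).2 w]
  rw [this, Set.ncard_coe_finset, List.toFinset_card_of_nodup (h v).1]

/-- The store holds the input: the order of the graph and the adjacency lists. -/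
structure HoldsInput (adj : Fin n → List (Fin n)) (σ : Store) : Prop where
  reg0 : σ.reg 0 = n
  arr0 : σ.arr 0 = listStart adj
  arr1 : σ.arr 1 = listEntry adj

end Input

end Machine

/-! ### Search trees, fundamental cycles and local criteria -/

section SearchTrees

variable {V : Type u} {G : SimpleGraph V} {r : V} {pos : V → ℕ} {par : V → V}

/-- A spanning tree with root `r`, given by parents; `pos` numbers parents before children. -/
structure IsSearchTree (G : SimpleGraph V) (r : V) (pos : V → ℕ) (par : V → V) : Prop where
  inj : Function.Injective pos
  adj : ∀ v, v ≠ r → G.Adj v (par v)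
  lt : ∀ v, v ≠ r → pos (par v) < pos v

/-- Every non-tree edge occurs once, directed from its later to its earlier end; the ends need not
be comparable in the tree. In a search tree no vertex precedes the root, so the value of `par` at
the root is irrelevant. -/
def IsBackEdge (G : SimpleGraph V) (pos : V → ℕ) (par : V → V) (u w : V) : Prop :=
  G.Adj u w ∧ pos w < pos u ∧ par u ≠ w

def IsTreeEdge (r : V) (par : V → V) (x y : V) : Prop :=
  (x ≠ r ∧ par x = y) ∨ (y ≠ r ∧ par y = x)

/-- `c` runs around the cycle which the back edge `uw` closes with the tree. -/
structure IsFundCycle (G : SimpleGraph V) (r : V) (par : V → V) (u w : V) {k : ℕ}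
    (c : ZMod k → V) : Prop where
  isCyclic : IsCyclic G c
  left_mem : ∃ i, c i = u
  right_mem : ∃ i, c i = w
  edge : ∀ i, IsTreeEdge r par (c i) (c (i + 1)) ∨ s(c i, c (i + 1)) = s(u, w)
  par_mem : ∃ m, ∀ i, c i ≠ m → c i ≠ r ∧ ∃ j, c j = par (c i)

theorem IsTreeEdge.symm {x y : V} (h : IsTreeEdge r par x y) : IsTreeEdge r par y x := Or.symm h

theorem IsSearchTree.root_le (h : IsSearchTree G r pos par) (v : V) : pos r ≤ pos v := by
  obtain ⟨n, hn⟩ : ∃ n, pos v = n := ⟨_, rfl⟩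
  induction n using Nat.strong_induction_on generalizing v with
  | _ n ih =>
    by_cases hv : v = r
    · rw [hv]
    · exact (ih _ (hn ▸ h.lt v hv) (par v) rfl).trans (h.lt v hv).le

theorem IsTreeEdge.adj (h : IsSearchTree G r pos par) {x y : V} (hxy : IsTreeEdge r par x y) :
    G.Adj x y := by
  rcases hxy with ⟨hx, rfl⟩ | ⟨hy, rfl⟩
  · exact h.adj x hx
  · exact (h.adj y hy).symm

theorem IsBackEdge.not_isTreeEdge (h : IsSearchTree G r pos par) {u w : V}
    (hb : IsBackEdge G pos par u w) : ¬ IsTreeEdge r par u w := by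
  rintro (⟨-, h1⟩ | ⟨h1, rfl⟩)
  · exact hb.2.2 h1
  · exact absurd hb.2.1 (h.lt w h1).not_gt

/-- `l` is the path in the tree from a child of `a` down to `u`. -/
inductive IsClimb (r : V) (par : V → V) (u : V) : V → List V → Prop
  | nil : IsClimb r par u u []
  | cons {x : V} {l : List V} : IsClimb r par u x l → x ≠ r → IsClimb r par u (par x) (x :: l)

namespace IsClimb

variable {u a : V} {l : List V}

theorem isChain (h : IsClimb r par u a l) :
    (a :: l).IsChain (IsTreeEdge r par) ∧ (a :: l).getLast? = some u := by
  induction h with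
  | nil => simp
  | cons _ hx ih =>
    refine ⟨List.IsChain.cons_cons (.inr ⟨hx, rfl⟩) ih.1, ?_⟩
    rw [List.getLast?_cons_cons]; exact ih.2

theorem isChain_reverse (h : IsClimb r par u a l) :
    (l.reverse ++ [a]).IsChain (IsTreeEdge r par) ∧ (l.reverse ++ [a]).head? = some u := by
  have h1 := h.isChain
  rw [← List.reverse_cons, List.isChain_reverse, List.head?_reverse]
  exact ⟨h1.1.imp fun _ _ => IsTreeEdge.symm, h1.2⟩

theorem eq_of_nil (h : IsClimb r par u a []) : a = u := by
  cases h; rfl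

theorem par_mem (h : IsClimb r par u a l) : ∀ x ∈ l, x ≠ r ∧ par x ∈ a :: l := by
  induction h with
  | nil => simp
  | cons _ hx ih =>
    intro y hy
    rcases List.mem_cons.1 hy with rfl | hy
    · exact ⟨hx, by simp⟩
    · exact ⟨(ih y hy).1, List.mem_cons_of_mem _ (ih y hy).2⟩

theorem pos_le (h : IsClimb r par u a l) (ht : IsSearchTree G r pos par) : pos a ≤ pos u := by
  induction h with
  | nil => exact le_rfl
  | cons _ hx ih => exact (ht.lt _ hx).le.trans ih

/-- The cycle leads from the common ancestor `m` down along `A` to `u`, over the back edge to `w`,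
and up along `B`. The default value `m` of `getD` closes it. -/
theorem isFundCycle {w m : V} {A B : List V} (hA : IsClimb r par u m A)
    (hB : IsClimb r par w m B.reverse) (ht : IsSearchTree G r pos par)
    (hb : IsBackEdge G pos par u w) (hnd : (m :: (A ++ B)).Nodup) :
    IsFundCycle G r par u w (fun i : ZMod (A.length + B.length + 1) =>
      (m :: (A ++ B)).getD i.val m) := by
  obtain ⟨hA1, hA2⟩ := hA.isChain
  obtain ⟨hB1, hB2⟩ := hB.isChain_reverse
  rw [List.reverse_reverse] at hB1 hB2
  -- If `A` were empty, `u` would be an ancestor of `w` and could not come after it.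
  have hAne : A ≠ [] := by
    rintro rfl
    cases hA
    exact absurd hb.2.1 (hB.pos_le ht).not_gt
  -- For `A = [u]` and empty `B` the vertex `w` would be the parent of `u`.
  have h3 : 3 ≤ A.length + B.length + 1 := by
    obtain ⟨x, A, rfl⟩ := List.exists_cons_of_ne_nil hAne
    by_contra hlt
    simp only [List.length_cons] at hlt
    obtain rfl := List.length_eq_zero_iff.1 (by omega : A.length = 0)
    obtain rfl := List.length_eq_zero_iff.1 (by omega : B.length = 0)
    cases hA with
    | cons h _ =>
      obtain rfl := h.eq_of_nil
      exact hb.2.2 hB.eq_of_nil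
  have hchain : (m :: (A ++ B) ++ [m]).IsChain
      (fun x y => IsTreeEdge r par x y ∨ s(x, y) = s(u, w)) := by
    have : m :: (A ++ B) ++ [m] = (m :: A) ++ (B ++ [m]) := by simp
    rw [this, List.isChain_append]
    refine ⟨hA1.imp fun _ _ => .inl, hB1.imp fun _ _ => .inl, fun x hx y hy => .inr ?_⟩
    rw [hA2] at hx
    rw [hB2] at hy
    simp only [Option.mem_def, Option.some.injEq] at hx hy
    rw [hx, hy]
  set L := m :: (A ++ B) with hL
  have hlen : L.length = A.length + B.length + 1 := by simp [hL]
  have hget : ∀ i (hi : i < A.length + B.length + 1),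
      (L ++ [m]).getD i m = L[i]'(by omega) := fun i hi => by
    rw [List.getD_eq_getElem _ _ (by simp; omega), List.getElem_append_left (by omega)]
  have hgetL : ∀ i, (L ++ [m]).getD i m = L.getD i m := by
    intro i
    rcases Nat.lt_or_ge i L.length with h | h
    · rw [hget i (by omega), List.getD_eq_getElem _ _ h]
    · rw [List.getD_eq_default _ _ h]
      rcases h.eq_or_lt with rfl | h'
      · simp
      · rw [List.getD_eq_default _ _ (by simp; omega)]
  have hE : ∀ i, i < A.length + B.length + 1 →
      IsTreeEdge r par (L.getD i m) (L.getD (i + 1) m) ∨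
        s(L.getD i m, L.getD (i + 1) m) = s(u, w) := by
    intro i hi
    have := hchain.getElem i (by simp; omega)
    rwa [← List.getD_eq_getElem _ m, ← List.getD_eq_getElem _ m, hgetL, hgetL] at this
  have hadj : ∀ x y, (IsTreeEdge r par x y ∨ s(x, y) = s(u, w)) → G.Adj x y := by
    rintro x y (h | h)
    · exact h.adj ht
    · rw [← mem_edgeSet, h]; exact hb.1
  have hcyc : IsCyclic G (fun i : ZMod (A.length + B.length + 1) => L.getD i.val m) := by
    refine .of_nat h3 (fun i => L.getD i m) ?_ ?_ fun i hi => hadj _ _ (hE i hi)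
    · rw [List.getD_eq_default _ _ (by omega)]; simp [hL]
    · intro i hi j hj hij
      rw [List.getD_eq_getElem _ _ (by omega), List.getD_eq_getElem _ _ (by omega)] at hij
      exact (hnd.getElem_inj_iff).1 hij
  have hmem : ∀ x, (∃ i : ZMod (A.length + B.length + 1), L.getD i.val m = x) ↔ x ∈ L := by
    intro x
    constructor
    · rintro ⟨i, rfl⟩
      have : i.val < L.length := by rw [hlen]; exact ZMod.val_lt i
      rw [List.getD_eq_getElem _ _ this]
      exact List.getElem_mem _
    · intro hx
      obtain ⟨i, hi, rfl⟩ := List.getElem_of_mem hx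
      refine ⟨(i : ZMod (A.length + B.length + 1)), ?_⟩
      rw [ZMod.val_natCast_of_lt (by omega), List.getD_eq_getElem _ _ hi]
  refine ⟨hcyc, (hmem u).2 ?_, (hmem w).2 ?_, fun i => ?_, m, fun i hi => ?_⟩
  · have := List.mem_of_getLast? hA2
    rcases List.mem_cons.1 this with h | h <;> simp [hL, h]
  · have := List.mem_of_mem_head? (by rw [hB2]; rfl : w ∈ (B ++ [m]).head?)
    rcases List.mem_append.1 this with h | h
    · simp [hL, h]
    · simp [hL, List.mem_singleton.1 h]
  · have h1 := hE i.val (ZMod.val_lt i)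
    have h2 : L.getD (i + 1).val m = L.getD (i.val + 1) m := by
      have : Fact (1 < A.length + B.length + 1) := ⟨by omega⟩
      rcases Nat.lt_or_ge (i.val + 1) (A.length + B.length + 1) with h | h
      · rw [ZMod.val_add_of_lt] <;> rw [ZMod.val_one]; exact h
      · have h' : i.val + 1 = A.length + B.length + 1 := by
          have := ZMod.val_lt i; omega
        rw [ZMod.val_add, ZMod.val_one, h', Nat.mod_self, List.getD_eq_default L m hlen.le]
        simp [hL]
    rwa [← h2] at h1
  · have key : ∀ x ∈ L, x ≠ m → x ≠ r ∧ par x ∈ L := by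
      intro x hx hxm
      rw [hL, List.mem_cons, List.mem_append] at hx ⊢
      rcases hx with h | h | h
      · exact absurd h hxm
      · obtain ⟨h1, h2⟩ := hA.par_mem _ h
        exact ⟨h1, (List.mem_cons.1 h2).imp_right .inl⟩
      · obtain ⟨h1, h2⟩ := hB.par_mem _ (List.mem_reverse.2 h)
        exact ⟨h1, (List.mem_cons.1 h2).imp_right fun h2 => .inr (List.mem_reverse.1 h2)⟩
    obtain ⟨h1, h2⟩ := key _ ((hmem _).1 ⟨i, rfl⟩) hi
    exact ⟨h1, (hmem _).2 h2⟩

end IsClimb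

namespace IsFundCycle

variable {u w : V} {k : ℕ} {c : ZMod k → V}

/-- In a cactus a cycle `d` with two vertices on `c` has all its edges on `c`, and `uw` is the only
edge of `c` outside the tree. -/
theorem backEdge_unique (h : IsFundCycle G r par u w c) (ht : IsSearchTree G r pos par)
    (hG : G.Connected) (hC : IsCactus G) {u' w' : V}
    (hb' : IsBackEdge G pos par u' w') (hb : IsBackEdge G pos par u w) {l : ℕ} {d : ZMod l → V}
    (hd : IsCyclic G d) (hu : ∃ i, d i = u') (hw : ∃ i, d i = w')
    {x y : V} (hxy : x ≠ y) (hxc : ∃ i, c i = x) (hyc : ∃ i, c i = y) (hxd : ∃ i, d i = x)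
    (hyd : ∃ i, d i = y) : u = u' ∧ w = w' := by
  obtain ⟨t, ht'⟩ : ∃ t, s(d t, d (t + 1)) = s(u', w') := by
    obtain ⟨π, hπ⟩ := hC.exists_isRing hG hd
    obtain ⟨i, rfl⟩ := hu
    obtain ⟨j, rfl⟩ := hw
    rcases (hπ.adj_iff i j).1 hb'.1 with rfl | rfl
    · exact ⟨i, rfl⟩
    · exact ⟨j, Sym2.eq_swap⟩
  obtain ⟨s, hs⟩ := hC.edges_subset h.isCyclic hd hxy hxc hyc hxd hyd t
  rw [hs] at ht'
  rcases h.edge s with h1 | h1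
  · exfalso
    apply hb'.not_isTreeEdge ht
    rcases Sym2.eq_iff.1 ht' with ⟨h2, h3⟩ | ⟨h2, h3⟩
    · rwa [h2, h3] at h1
    · rw [h2, h3] at h1; exact h1.symm
  · rw [ht'] at h1
    rcases Sym2.eq_iff.1 h1 with ⟨h2, h3⟩ | ⟨h2, h3⟩
    · exact ⟨h2.symm, h3.symm⟩
    · have := hb.2.1
      have := hb'.2.1
      rw [h2, h3] at this
      omega

end IsFundCycle

/-- The last vertex of the cycle in the numbering has two earlier neighbours on it, and only one of
them can be its parent. -/
theorem IsCyclic.exists_backEdge (ht : IsSearchTree G r pos par) {k : ℕ} {c : ZMod k → V}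
    (hc : IsCyclic G c) : ∃ u w, IsBackEdge G pos par u w ∧ (∃ i, c i = u) ∧ ∃ i, c i = w := by
  have : NeZero k := ⟨by have := hc.three_le; omega⟩
  obtain ⟨i, hi⟩ := Finite.exists_max (fun i => pos (c i))
  have hlt : ∀ j, c j ≠ c i → pos (c j) < pos (c i) := fun j hj =>
    lt_of_le_of_ne (hi j) fun he => hj (ht.inj he)
  by_cases hp : par (c i) = c (i + 1)
  · exact ⟨c i, c (i - 1), ⟨hc.exists_pred i, hlt _ (hc.exists_pred i).ne.symm, fun he =>
      hc.succ_ne_pred i (hp.symm.trans he)⟩, ⟨i, rfl⟩, ⟨_, rfl⟩⟩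
  · exact ⟨c i, c (i + 1), ⟨hc.adj_succ i, hlt _ (hc.adj_succ i).ne.symm, hp⟩, ⟨i, rfl⟩, ⟨_, rfl⟩⟩

section Sums

variable [Fintype V] {F : V → V → Finset V}

open Classical in
/-- The pairs `(u, w)` such that `uw` is a back edge with `u` after `w`. -/
noncomputable def backEdges (G : SimpleGraph V) (pos : V → ℕ) (par : V → V) : Finset (V × V) :=
  Finset.univ.filter fun p => IsBackEdge G pos par p.1 p.2

variable (ht : IsSearchTree G r pos par) (hG : G.Connected) (hC : IsCactus G)
  (hF : ∀ u w, IsBackEdge G pos par u w → ∃ (k : ℕ) (c : ZMod k → V),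
    IsFundCycle G r par u w c ∧ ∀ x, x ∈ F u w ↔ ∃ i, c i = x)

include ht hG hC hF

/-- Back edges correspond to cycles: each cycle contains one by `IsCyclic.exists_backEdge`, and
different ones close different cycles by `IsFundCycle.backEdge_unique`. -/
theorem sum_cycleSets_eq (g : Finset V → ℕ) :
    ∑ C ∈ cycleSets G, g C = ∑ p ∈ backEdges G pos par, g (F p.1 p.2) := by
  symm
  refine Finset.sum_bij (fun p _ => F p.1 p.2) ?_ ?_ ?_ fun _ _ => rfl
  · rintro ⟨u, w⟩ hp
    obtain ⟨k, c, hc, hm⟩ := hF u w (by simpa [backEdges] using hp)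
    exact mem_cycleSets_iff.2 ⟨k, c, hc.isCyclic, hm⟩
  · rintro ⟨u, w⟩ hp ⟨u', w'⟩ hp' he
    have hb : IsBackEdge G pos par u w := by simpa [backEdges] using hp
    have hb' : IsBackEdge G pos par u' w' := by simpa [backEdges] using hp'
    obtain ⟨k, c, hc, hm⟩ := hF u w hb
    obtain ⟨l, d, hd, hm'⟩ := hF u' w' hb'
    simp only at he
    have h1 : ∀ x, (∃ i, c i = x) → ∃ i, d i = x := fun x hx =>
      (hm' x).1 (he ▸ (hm x).2 hx)
    obtain ⟨e1, e2⟩ := hc.backEdge_unique ht hG hC hb' hb hd.isCyclic hd.left_mem hd.right_mem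
      hb.1.ne hc.left_mem hc.right_mem (h1 _ hc.left_mem) (h1 _ hc.right_mem)
    rw [e1, e2]
  · intro C hCC
    obtain ⟨k, c, hc, hm⟩ := mem_cycleSets_iff.1 hCC
    obtain ⟨u, w, hb, hu, hw⟩ := hc.exists_backEdge ht
    obtain ⟨l, d, hd, hm'⟩ := hF u w hb
    refine ⟨(u, w), by simpa [backEdges] using hb, ?_⟩
    exact hC.cycleSets_eq (mem_cycleSets_iff.2 ⟨l, d, hd.isCyclic, hm'⟩) hCC hb.1.ne
      ((hm' u).2 hd.left_mem) ((hm' w).2 hd.right_mem) ((hm u).2 hu) ((hm w).2 hw)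

/-- Each vertex of a cycle except for the top one is charged together with the tree edge to its
parent. That edge is on only one cycle, so no vertex is charged twice, and `|C| ≤ 2 (|C| - 1)` gives
the factor 2. -/
theorem sum_card_fundCycles_le :
    ∑ p ∈ backEdges G pos par, (F p.1 p.2).card ≤ 2 * Fintype.card V := by
  classical
  have hex : ∀ p ∈ backEdges G pos par, ∃ D : Finset V, (F p.1 p.2).card ≤ 2 * D.card ∧
      ∀ x ∈ D, x ≠ r ∧ x ∈ F p.1 p.2 ∧ par x ∈ F p.1 p.2 := by
    rintro ⟨u, w⟩ hp
    obtain ⟨k, c, hc, hm⟩ := hF u w (by simpa [backEdges] using hp)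
    obtain ⟨m, hpm⟩ := hc.par_mem
    have : NeZero k := ⟨by have := hc.isCyclic.three_le; omega⟩
    have hcard : (F u w).card = k := by
      have : F u w = Finset.univ.image c := by ext x; simp [hm]
      rw [this, Finset.card_image_of_injective _ hc.isCyclic.inj, Finset.card_univ, ZMod.card]
    refine ⟨(F u w).erase m, ?_, fun x hx => ?_⟩
    · have := Finset.pred_card_le_card_erase (s := F u w) (a := m)
      have := hc.isCyclic.three_le
      simp only; omega
    · obtain ⟨hxm, hx⟩ := Finset.mem_erase.1 hx
      obtain ⟨i, rfl⟩ := (hm x).1 hx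
      obtain ⟨h1, h2⟩ := hpm i hxm
      exact ⟨h1, hx, (hm _).2 h2⟩
  choose! D hD hD' using hex
  have hdis : (backEdges G pos par : Set (V × V)).PairwiseDisjoint D := by
    rintro ⟨u, w⟩ hp ⟨u', w'⟩ hp' hne
    rw [Function.onFun, Finset.disjoint_left]
    intro x hx hx'
    have hb : IsBackEdge G pos par u w := by simpa [backEdges] using hp
    have hb' : IsBackEdge G pos par u' w' := by simpa [backEdges] using hp'
    obtain ⟨k, c, hc, hm⟩ := hF u w hb
    obtain ⟨l, d, hd, hm'⟩ := hF u' w' hb'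
    obtain ⟨h1, h2, h3⟩ := hD' _ hp x hx
    obtain ⟨-, h4, h5⟩ := hD' _ hp' x hx'
    obtain ⟨e1, e2⟩ := hc.backEdge_unique ht hG hC hb' hb hd.isCyclic hd.left_mem hd.right_mem
      (ht.adj x h1).ne ((hm _).1 h2) ((hm _).1 h3) ((hm' _).1 h4) ((hm' _).1 h5)
    exact hne (by rw [e1, e2])
  calc ∑ p ∈ backEdges G pos par, (F p.1 p.2).card
      ≤ ∑ p ∈ backEdges G pos par, 2 * (D p).card := Finset.sum_le_sum hD
    _ = 2 * ((backEdges G pos par).biUnion D).card := by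
      rw [Finset.card_biUnion hdis, Finset.mul_sum]
    _ ≤ 2 * Fintype.card V := Nat.mul_le_mul_left _ (Finset.card_le_univ _)

/-- Each back edge closes a cycle with at least two vertices and the lengths sum to at most `2 n`,
so there are at most `n` back edges. With at most `n` tree edges and two directions this gives `4
n`. -/
theorem sum_degree_le : ∑ v, (G.neighborSet v).ncard ≤ 4 * Fintype.card V := by
  classical
  have hback : (backEdges G pos par).card ≤ Fintype.card V := by
    have h1 := sum_card_fundCycles_le ht hG hC hF
    have h2 : (backEdges G pos par).card * 2 ≤
        ∑ p ∈ backEdges G pos par, (F p.1 p.2).card := by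
      rw [← smul_eq_mul]
      refine Finset.card_nsmul_le_sum _ _ _ ?_
      rintro ⟨u, w⟩ hp
      have hb : IsBackEdge G pos par u w := by simpa [backEdges] using hp
      obtain ⟨k, c, hc, hm⟩ := hF u w hb
      exact Finset.one_lt_card.2 ⟨u, (hm u).2 hc.left_mem, w, (hm w).2 hc.right_mem, hb.1.ne⟩
    omega
  let T : Finset (V × V) := Finset.univ.image fun v => (v, par v)
  let A : Finset (V × V) := Finset.univ.filter fun p => G.Adj p.1 p.2
  have hT : T.card ≤ Fintype.card V := Finset.card_image_le
  have hsub : A ⊆ (T ∪ backEdges G pos par) ∪ (T ∪ backEdges G pos par).image Prod.swap := by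
    rintro ⟨u, w⟩ hp
    have ha : G.Adj u w := by simpa [A] using hp
    have key : ∀ u w, G.Adj u w → pos w < pos u → (u, w) ∈ T ∪ backEdges G pos par := by
      intro u w ha hlt
      by_cases hp : par u = w
      · exact Finset.mem_union_left _ (by simp [T, hp])
      · exact Finset.mem_union_right _ (by simpa [backEdges] using ⟨ha, hlt, hp⟩)
    rcases lt_trichotomy (pos w) (pos u) with h | h | h
    · exact Finset.mem_union_left _ (key u w ha h)
    · exact absurd (ht.inj h).symm ha.ne
    · exact Finset.mem_union_right _ (Finset.mem_image.2 ⟨(w, u), key w u ha.symm h, rfl⟩)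
  have hA : A.card = ∑ v, (G.neighborSet v).ncard := by
    have : A = ((Finset.univ : Finset V).sigma (fun v => G.neighborFinset v)).map
        (Equiv.sigmaEquivProd V V).toEmbedding := by
      ext ⟨u, w⟩; simp [A]
    rw [this, Finset.card_map, Finset.card_sigma]
    refine Finset.sum_congr rfl fun v _ => ?_
    rw [← Set.ncard_coe_finset, coe_neighborFinset]
  have h1 := Finset.card_le_card hsub
  have h2 := Finset.card_union_le (T ∪ backEdges G pos par)
    ((T ∪ backEdges G pos par).image Prod.swap)
  have h3 : ((T ∪ backEdges G pos par).image Prod.swap).card ≤ (T ∪ backEdges G pos par).card :=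
    Finset.card_image_le
  have h4 := Finset.card_union_le T (backEdges G pos par)
  omega

end Sums

/-! ### Pendant paths and cut vertices in a search tree -/

def InPendantPath (G : SimpleGraph V) (v : V) : Prop := ∃ P, IsPendantPath G P ∧ v ∈ P

/-- The vertex `x` has a child in a pendant path. -/
def HasPendantChild (G : SimpleGraph V) (r : V) (par : V → V) (x : V) : Prop :=
  ∃ w, w ≠ r ∧ par w = x ∧ InPendantPath G w

/-- As the root is off the tail, parents point towards `v`; otherwise two successive vertices would
be parents of each other. -/
theorem IsTail.par_head (ht : IsSearchTree G r pos par) {v y : V} {l : List V}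
    (h : IsTail G v (y :: l)) (hr : r ∉ y :: l) : par y = v := by
  generalize hL : y :: l = L at h hr
  induction h generalizing y l with
  | @leaf v z h =>
    obtain ⟨rfl, rfl⟩ := List.cons.inj hL
    exact (h _).1 (ht.adj _ fun he => hr (by simp [he]))
  | @cons v z x l' hne h htail ih =>
    obtain ⟨rfl, rfl⟩ := List.cons.inj hL
    have hyr : y ≠ r := fun he => hr (by simp [he])
    have hxr : x ≠ r := fun he => hr (by simp [he])
    rcases (h _).1 (ht.adj y hyr) with h1 | h1
    · exact h1
    · exfalso
      have h2 : par x = y := ih rfl fun hm => hr (List.mem_cons_of_mem _ hm)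
      have h3 := ht.lt y hyr
      have h4 := ht.lt x hxr
      rw [h1] at h3
      rw [h2] at h4
      omega

/-- Membership passes from the leaf of a pendant path upwards through vertices of degree 2. The root
has degree at least 3, so it is in no pendant path, and each of these paths is climbed from child to
parent. -/
theorem inPendantPath_iff [Finite V] (ht : IsSearchTree G r pos par) (hG : G.Connected)
    (hr : 3 ≤ (G.neighborSet r).ncard) (v : V) :
    InPendantPath G v ↔ (G.neighborSet v).ncard = 1 ∨
      (G.neighborSet v).ncard = 2 ∧ HasPendantChild G r par v := by
  have hnp : ¬ IsPathGraph G := fun h => by have := h.ncard_le r; omega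
  constructor
  · rintro ⟨P, hP, hv⟩
    have hrP : r ∉ P := fun h => by have := hP.ncard_le h; omega
    obtain ⟨x, hx⟩ := id hP
    obtain ⟨l, hl, hm⟩ := hx.exists_isTail
    have key : ∀ x l, IsTail G x l → (∀ z ∈ l, z ∈ P) → v ∈ l →
        (G.neighborSet v).ncard = 1 ∨
        (G.neighborSet v).ncard = 2 ∧ HasPendantChild G r par v := by
      intro x l hl
      induction hl with
      | @leaf x y h =>
        intro _ hvl
        rw [List.mem_singleton] at hvl; subst hvl
        left
        rw [show G.neighborSet v = {x} by ext w; simpa using h w, Set.ncard_singleton]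
      | @cons x y z l hne h htail ih =>
        intro hsub hvl
        rcases List.mem_cons.1 hvl with rfl | hvl
        · right
          rw [show G.neighborSet v = {x, z} by ext w; simpa using h w, Set.ncard_pair hne]
          exact ⟨rfl, z, fun he => hrP (he ▸ hsub z (by simp)),
            htail.par_head ht fun hm => hrP (hsub r (by simp [List.mem_cons.1 hm])),
            P, hP, hsub z (by simp)⟩
        · exact ih (fun w hw => hsub w (List.mem_cons_of_mem _ hw)) hvl
    exact key x l hl (fun z hz => (hm z).2 hz) ((hm v).1 hv)
  · rintro (h1 | ⟨h2, w, hwr, hwv, P, hP, hwP⟩)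
    · obtain ⟨x, hx⟩ := Set.ncard_eq_one.1 h1
      have htail : IsTail G x [v] := .leaf fun z => by
        rw [← mem_neighborSet, hx, Set.mem_singleton_iff]
      obtain ⟨P, hP, hm⟩ := (htail.isPathGraph_or hG).resolve_left hnp
      exact ⟨P, hP, hm v (by simp)⟩
    · refine ⟨P, hP, ?_⟩
      obtain ⟨x, hx⟩ := hP
      obtain ⟨l, hl, hm⟩ := hx.exists_isTail
      rcases hl.mem_or_eq w ((hm w).1 hwP) v (hwv ▸ ht.adj w hwr) with h | rfl
      · exact (hm v).2 h
      · have := hx.1; omega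

theorem IsRing.neighborSet_subset {k : ℕ} {c : ZMod k → V} {π : V → ZMod k} (h : IsRing G c π)
    (i : ZMod k) : ({c (i + 1), c (i - 1)} : Set V) ⊆ G.neighborSet (c i) := by
  rintro w (rfl | rfl)
  · exact h.adj_succ i
  · exact h.isCyclic.exists_pred i

/-- A vertex of a branch is connected within the branch to a neighbour of the attachment point. -/
theorem IsRing.exists_adj_of_closed {k : ℕ} {c : ZMod k → V} {π : V → ZMod k}
    (h : IsRing G c π) (hG : G.Connected) {i : ZMod k} {A : Set V}
    (hA : ∀ z ∈ A, π z = i ∧ z ≠ c i)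
    (hcl : ∀ z ∈ A, ∀ w, G.Adj z w → π w = i → w ≠ c i → w ∈ A) (hne : A.Nonempty) :
    ∃ z ∈ A, G.Adj (c i) z := by
  obtain ⟨a, ha⟩ := hne
  obtain ⟨p⟩ := hG.preconnected a (c i)
  have : ∀ (a b : V) (p : G.Walk a b), b = c i → a ∈ A → ∃ z ∈ A, G.Adj (c i) z := by
    intro a b p
    induction p with
    | nil => rintro rfl ha; exact absurd rfl (hA _ ha).2
    | @cons a b _ hab p ih =>
      intro hb ha
      by_cases hbc : b = c i
      · exact ⟨a, ha, hbc ▸ hab.symm⟩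
      · refine ih hb (hcl a ha b hab ?_ hbc)
        obtain ⟨h1, h2⟩ := hA a ha
        exact (h.proj_eq_of_adj hab (h1 ▸ h2)).trans h1
  exact this _ _ p rfl ha

/-- A branch with more than its attachment point contains a neighbour of this point off the cycle,
which shows in the degree. -/
theorem IsRing.isCutVertex_iff_ncard [Finite V] {k : ℕ} {c : ZMod k → V} {π : V → ZMod k}
    (h : IsRing G c π) (hG : G.Connected) (i : ZMod k) :
    IsCutVertex G (c i) ↔ (G.neighborSet (c i)).ncard ≠ 2 := by
  rw [h.isCutVertex_iff hG]
  have h2 : ({c (i + 1), c (i - 1)} : Set V).ncard = 2 := Set.ncard_pair (h.isCyclic.succ_ne_pred i)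
  constructor
  · rintro ⟨v, hv⟩ hd
    have heq := Set.eq_of_subset_of_ncard_le (h.neighborSet_subset i) (by omega) (Set.toFinite _)
    obtain ⟨z, hz, hza⟩ := h.exists_adj_of_closed hG (A := {z | π z = i ∧ z ≠ c i})
      (fun z hz => hz) (fun z _ w _ h1 h2 => ⟨h1, h2⟩) ⟨v, hv⟩
    have : z ∈ ({c (i + 1), c (i - 1)} : Set V) := by rw [heq]; exact hza
    have h3 := hz.1
    rcases this with rfl | rfl <;> rw [h.proj] at h3
    · exact h.proj_ne i h3
    · exact one_ne_zero_zmod h.three_le (by linear_combination -h3)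
  · intro hd
    by_contra! hn
    apply hd
    rw [← h2]
    congr 1
    refine Set.Subset.antisymm (fun z hz => ?_) (h.neighborSet_subset i)
    rcases h.adj _ _ hz with h1 | ⟨-, h1, h3⟩
    · rw [h.proj] at h1
      exact absurd (hn z h1.symm) (Adj.ne' hz)
    · rw [h.proj] at h3
      rcases h3 with h3 | h3
      · left; rw [h1, h3]
      · right; rw [Set.mem_singleton_iff, h1, h3]; congr 1; ring

/-- At degree 3 a single edge leaves the cycle, and the branch is a pendant path exactly if this
edge leads into one. So a program can recognise `R1` on cycles from degrees and one mark per vertex.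
-/
theorem IsRing.mem_R1_iff_ncard [Finite V] {k : ℕ} {c : ZMod k → V} {π : V → ZMod k}
    (h : IsRing G c π) (hG : G.Connected) (ht : IsSearchTree G r pos par)
    (hr : 3 ≤ (G.neighborSet r).ncard) (i : ZMod k) :
    c i ∈ R1 G ↔ (G.neighborSet (c i)).ncard = 3 ∧ HasPendantChild G r par (c i) := by
  classical
  have hcyc := h.isCyclic
  rw [h.mem_R1_iff hG]
  constructor
  · rintro ⟨l, hl, hm⟩
    obtain ⟨y, l, rfl⟩ := List.exists_cons_of_ne_nil hl.ne_nil
    have hdeg := h.three_le_of_isTail hl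
    have hy : ∀ j, c j ≠ y := fun j hj => hl.notMem_cycle hcyc j (by simp [hj])
    have hN : G.neighborSet (c i) = {c (i + 1), c (i - 1), y} := by
      ext z
      simp only [mem_neighborSet, Set.mem_insert_iff, Set.mem_singleton_iff]
      constructor
      · intro hz
        rcases h.adj _ _ hz with h1 | ⟨-, h1, h3⟩
        · rw [h.proj] at h1
          exact .inr (.inr (hl.eq_head ((hm z).2 ⟨h1.symm, hz.ne.symm⟩) hz))
        · rw [h.proj] at h3
          rcases h3 with h3 | h3
          · left; rw [h1, h3]
          · right; left; rw [h1, h3]; congr 1; ring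
      · rintro (rfl | rfl | rfl)
        · exact h.adj_succ i
        · exact hcyc.exists_pred i
        · exact hl.adj_head
    refine ⟨?_, y, ?_, hl.par_head ht ?_, (y :: l).toFinset, ⟨c i, ?_⟩, by simp⟩
    · rw [hN]
      exact Set.ncard_eq_three.2 ⟨_, _, _, hcyc.succ_ne_pred i, hy _, hy _, rfl⟩
    · rintro rfl
      have := hl.ncard_le y (by simp); omega
    · intro hm
      have := hl.ncard_le r hm; omega
    · exact hl.isPendantPathAt hdeg (by simp)
  · rintro ⟨h3, w, hwr, hwi, P, ⟨x, hx⟩, hwP⟩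
    obtain ⟨l, hl, hm⟩ := hx.exists_isTail
    have hiw : G.Adj (c i) w := hwi ▸ (ht.adj w hwr).symm
    obtain rfl : c i = x := (hl.mem_or_eq w ((hm w).1 hwP) (c i) hiw.symm).resolve_left
      (hl.notMem_cycle hcyc i)
    have hw : ∀ j, c j ≠ w := fun j hj => hl.notMem_cycle hcyc j (hj ▸ (hm w).1 hwP)
    have hN : ({c (i + 1), c (i - 1), w} : Set V) = G.neighborSet (c i) := by
      refine Set.eq_of_subset_of_ncard_le ?_ ?_ (Set.toFinite _)
      · rintro z (rfl | rfl | rfl)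
        · exact h.adj_succ i
        · exact hcyc.exists_pred i
        · exact hiw
      · rw [Set.ncard_eq_three.2 ⟨_, _, _, hcyc.succ_ne_pred i, hw _, hw _, rfl⟩, h3]
    have hbr : ∀ z, π z = i → z ≠ c i → G.Adj (c i) z → z = w := by
      intro z hz hzc hza
      have : z ∈ ({c (i + 1), c (i - 1), w} : Set V) := by rw [hN]; exact hza
      rcases this with rfl | rfl | h1
      · rw [h.proj] at hz; exact absurd hz (h.proj_ne i)
      · rw [h.proj] at hz
        exact absurd (by linear_combination -hz) (one_ne_zero_zmod h.three_le)
      · exact h1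
    have hsub : ∀ z ∈ l, π z = i ∧ z ≠ c i := by
      intro z hz
      have hne : ∀ z ∈ l, z ≠ c i := fun z hz he => hl.notMem (he ▸ hz)
      refine ⟨?_, hne z hz⟩
      by_contra hzi
      have := mem_of_reachable_induce (A := {z | z ∈ l}) (fun z hz w hw hadj =>
        (hl.mem_or_eq z hz w hadj).resolve_right hw) (h.reachable_succ hG hzi) hz
      exact hl.notMem_cycle hcyc _ this
    refine ⟨l, hl, fun z => ⟨hsub z, fun hz => ?_⟩⟩
    by_contra hzl
    obtain ⟨y, hy, hya⟩ := h.exists_adj_of_closed hG (A := {z | (π z = i ∧ z ≠ c i) ∧ z ∉ l})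
      (fun z hz => hz.1) (fun z hz w hzw h1 h2 => ⟨⟨h1, h2⟩, fun hwl => by
        rcases hl.mem_or_eq w hwl z hzw.symm with h4 | h4
        · exact hz.2 h4
        · exact hz.1.2 h4⟩) ⟨z, hz, hzl⟩
    have := hbr y hy.1.1 hy.1.2 hya
    exact hy.2 (this ▸ (hm w).1 hwP)

end SearchTrees

/-! ### Longest windows by a linear scan -/

section Scanning

/-- The entries of `q` from `s` up to `t - 1` are `0` or `1`, and the ones lie among `e` consecutive
positions. -/
def IsWindow (q : ℕ → ℕ) (e s t : ℕ) : Prop :=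
  (∀ i, s ≤ i → i < t → q i = 0 ∨ (q i = 1 ∧ 0 < e)) ∧
  ∃ j, ∀ i, s ≤ i → i < t → q i = 1 → j ≤ i ∧ i < j + e

/-- The state of a scan for the longest window: the lengths `f0`, `f1`, `f2` of the longest windows
without ones, with at most a single one, and with at most two consecutive ones, that end at the current
position; `p = 1` if the last entry was a one; `best` is the maximal length so far. -/
structure Scan where
  f0 : ℕ
  f1 : ℕ
  f2 : ℕ
  p : ℕ
  best : ℕ

/-- Process the entry `q`; lengths are capped at `cap`. -/
def Scan.step (cap q : ℕ) (S : Scan) : Scan :=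
  let f0 := if q = 0 then S.f0 + 1 else 0
  let f1 := if q = 0 then S.f1 + 1 else if q = 1 then S.f0 + 1 else 0
  let f2 := if q = 0 then S.f2 + 1 else
    if q = 1 then (if S.p = 1 then S.f1 + 1 else S.f0 + 1) else 0
  let p := if q = 1 then 1 else 0
  ⟨f0, f1, f2, p, if S.best < f2 ∧ S.best < cap then S.best + 1 else S.best⟩

def Scan.run (cap : ℕ) (q : ℕ → ℕ) : ℕ → Scan
  | 0 => ⟨0, 0, 0, 0, 0⟩
  | t + 1 => (Scan.run cap q t).step cap (q t)

variable {q : ℕ → ℕ} {e s t cap : ℕ}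

theorem isWindow_self : IsWindow q e s s :=
  ⟨fun i h1 h2 => by omega, 0, fun i h1 h2 => by omega⟩

theorem isWindow_succ_zero (h : q t = 0) (hs : s ≤ t) :
    IsWindow q e s (t + 1) ↔ IsWindow q e s t := by
  constructor
  · rintro ⟨h1, j, h2⟩
    exact ⟨fun i hi hit => h1 i hi (by omega), j, fun i hi hit => h2 i hi (by omega)⟩
  · rintro ⟨h1, j, h2⟩
    refine ⟨fun i hi hit => ?_, j, fun i hi hit hq => ?_⟩
    · rcases Nat.lt_succ_iff_lt_or_eq.1 hit with hlt | rfl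
      · exact h1 i hi hlt
      · exact .inl h
    · rcases Nat.lt_succ_iff_lt_or_eq.1 hit with hlt | rfl
      · exact h2 i hi hlt hq
      · omega

theorem not_isWindow_succ (h0 : q t ≠ 0) (h1 : q t ≠ 1) (hs : s ≤ t) : ¬ IsWindow q e s (t + 1) := by
  rintro ⟨h, -⟩
  rcases h t hs (by omega) with h | h <;> omega

theorem isWindow_zero_succ_one (h : q t = 1) (hs : s ≤ t) : ¬ IsWindow q 0 s (t + 1) := by
  rintro ⟨h', -⟩
  rcases h' t hs (by omega) with h' | h' <;> omega

theorem isWindow_one_succ_one (h : q t = 1) (hs : s ≤ t) :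
    IsWindow q 1 s (t + 1) ↔ IsWindow q 0 s t := by
  constructor
  · rintro ⟨h1, j, h2⟩
    have hj := h2 t hs (by omega) h
    have key : ∀ i, s ≤ i → i < t → q i = 0 := by
      intro i hi hit
      rcases h1 i hi (by omega) with h3 | ⟨h3, -⟩
      · exact h3
      · have := h2 i hi (by omega) h3; omega
    exact ⟨fun i hi hit => .inl (key i hi hit), 0, fun i hi hit hq => by
      have := key i hi hit; omega⟩
  · rintro ⟨h1, -⟩
    refine ⟨fun i hi hit => ?_, t, fun i hi hit hq => ?_⟩
    · rcases Nat.lt_succ_iff_lt_or_eq.1 hit with hlt | rfl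
      · exact (h1 i hi hlt).imp_right fun h => absurd h.2 (lt_irrefl 0)
      · exact .inr ⟨h, one_pos⟩
    · rcases Nat.lt_succ_iff_lt_or_eq.1 hit with hlt | rfl
      · have := h1 i hi hlt; omega
      · omega

/-- Two ones in a row use up both places, so before the last entry the window may contain no other
one than its final entry. -/
theorem isWindow_two_succ_one_of_one (h : q (t + 1) = 1) (hp : q t = 1) (hs : s ≤ t + 1) :
    IsWindow q 2 s (t + 2) ↔ IsWindow q 1 s (t + 1) := by
  rcases hs.lt_or_eq with hs' | rfl
  swap
  · refine iff_of_true ⟨fun i hi hit => ?_, t, fun i hi hit hq => by omega⟩ isWindow_self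
    obtain rfl : i = t + 1 := by omega
    exact .inr ⟨h, two_pos⟩
  constructor
  · rintro ⟨h1, j, h2⟩
    have h3 := h2 (t + 1) hs (by omega) h
    have h4 := h2 t (by omega) (by omega) hp
    refine ⟨fun i hi hit => (h1 i hi (by omega)).imp_right fun h => ⟨h.1, one_pos⟩, t,
      fun i hi hit hq => ?_⟩
    have := h2 i hi (by omega) hq
    omega
  · rintro ⟨h1, j, h2⟩
    have h4 := h2 t (by omega) (by omega) hp
    refine ⟨fun i hi hit => ?_, t, fun i hi hit hq => ?_⟩
    · rcases Nat.lt_succ_iff_lt_or_eq.1 hit with hlt | rfl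
      · exact (h1 i hi hlt).imp_right fun h => ⟨h.1, two_pos⟩
      · exact .inr ⟨h, two_pos⟩
    · rcases Nat.lt_succ_iff_lt_or_eq.1 hit with hlt | rfl
      · have := h2 i hi hlt hq; omega
      · omega

/-- Only the entry just before could form a pair with the last one, and it is no one; all earlier
entries of the window are zeros. -/
theorem isWindow_two_succ_one (h : q t = 1) (hp : ∀ i, t = i + 1 → q i ≠ 1) (hs : s ≤ t) :
    IsWindow q 2 s (t + 1) ↔ IsWindow q 0 s t := by
  constructor
  · rintro ⟨h1, j, h2⟩
    have hj := h2 t hs (by omega) h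
    have key : ∀ i, s ≤ i → i < t → q i = 0 := by
      intro i hi hit
      rcases h1 i hi (by omega) with h3 | ⟨h3, -⟩
      · exact h3
      · have := h2 i hi (by omega) h3
        exact absurd h3 (hp i (by omega))
    exact ⟨fun i hi hit => .inl (key i hi hit), 0, fun i hi hit hq => by
      have := key i hi hit; omega⟩
  · rintro ⟨h1, -⟩
    refine ⟨fun i hi hit => ?_, t, fun i hi hit hq => ?_⟩
    · rcases Nat.lt_succ_iff_lt_or_eq.1 hit with hlt | rfl
      · exact (h1 i hi hlt).imp_right fun h => absurd h.2 (lt_irrefl 0)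
      · exact .inr ⟨h, two_pos⟩
    · rcases Nat.lt_succ_iff_lt_or_eq.1 hit with hlt | rfl
      · have := h1 i hi hlt; omega
      · omega

/-- The values of `f0`, `f1`, `f2`, `p` after `t` entries. -/
structure Scan.IsCorrect (q : ℕ → ℕ) (t : ℕ) (S : Scan) : Prop where
  f0 : S.f0 ≤ t ∧ ∀ s ≤ t, IsWindow q 0 s t ↔ t ≤ s + S.f0
  f1 : S.f1 ≤ t ∧ ∀ s ≤ t, IsWindow q 1 s t ↔ t ≤ s + S.f1
  f2 : S.f2 ≤ t ∧ ∀ s ≤ t, IsWindow q 2 s t ↔ t ≤ s + S.f2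
  p : S.p = 1 ↔ ∃ i, t = i + 1 ∧ q i = 1
  le : S.f0 ≤ S.f1 ∧ S.f1 ≤ S.f2

/-- The admissible starting points form a final interval, so one number describes them. A new entry
either prolongs windows of a previous kind by one or leaves only the empty window. -/
theorem Scan.length_step {e e' f f' : ℕ} (hf : f ≤ t ∧ ∀ s ≤ t, IsWindow q e s t ↔ t ≤ s + f)
    (h : (f' = f + 1 ∧ ∀ s ≤ t, IsWindow q e' s (t + 1) ↔ IsWindow q e s t) ∨
      (f' = 0 ∧ ∀ s ≤ t, ¬ IsWindow q e' s (t + 1))) :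
    f' ≤ t + 1 ∧ ∀ s ≤ t + 1, IsWindow q e' s (t + 1) ↔ t + 1 ≤ s + f' := by
  refine ⟨by omega, fun s hs => ?_⟩
  rcases Nat.le_succ_iff.1 hs with hs | rfl
  · rcases h with ⟨rfl, h⟩ | ⟨rfl, h⟩
    · rw [h s hs, hf.2 s hs]; omega
    · exact iff_of_false (h s hs) (by omega)
  · exact iff_of_true isWindow_self (by omega)

theorem Scan.IsCorrect.step {S : Scan} (h : S.IsCorrect q t) :
    (S.step cap (q t)).IsCorrect q (t + 1) ∧ (S.step cap (q t)).f2 ≤ S.f2 + 1 := by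
  have hle := h.le
  have hp : (S.step cap (q t)).p = 1 ↔ ∃ i, t + 1 = i + 1 ∧ q i = 1 := by
    have : (∃ i, t + 1 = i + 1 ∧ q i = 1) ↔ q t = 1 :=
      ⟨fun ⟨i, hi, hq⟩ => by obtain rfl : t = i := by omega
                             exact hq, fun hq => ⟨t, rfl, hq⟩⟩
    rw [this, Scan.step]
    dsimp only
    split_ifs with h1 <;> simp [h1]
  by_cases h0 : q t = 0
  · have hs : ∀ e, ∀ s ≤ t, IsWindow q e s (t + 1) ↔ IsWindow q e s t :=
      fun e s hs => isWindow_succ_zero h0 hs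
    exact ⟨⟨length_step h.f0 (.inl ⟨by simp [Scan.step, h0], hs 0⟩),
      length_step h.f1 (.inl ⟨by simp [Scan.step, h0], hs 1⟩),
      length_step h.f2 (.inl ⟨by simp [Scan.step, h0], hs 2⟩), hp,
      by simp [Scan.step, h0, hle]⟩, by simp [Scan.step, h0]⟩
  by_cases h1 : q t = 1
  swap
  · have hs : ∀ e, ∀ s ≤ t, ¬ IsWindow q e s (t + 1) := fun e s hs => not_isWindow_succ h0 h1 hs
    exact ⟨⟨length_step h.f0 (.inr ⟨by simp [Scan.step, h0], hs 0⟩),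
      length_step h.f1 (.inr ⟨by simp [Scan.step, h0, h1], hs 1⟩),
      length_step h.f2 (.inr ⟨by simp [Scan.step, h0, h1], hs 2⟩), hp,
      by simp [Scan.step, h0, h1]⟩, by simp [Scan.step, h0, h1]⟩
  have hf0 := length_step (f' := (S.step cap (q t)).f0) (e' := 0) h.f0
    (.inr ⟨by simp [Scan.step, h0], fun s hs => isWindow_zero_succ_one h1 hs⟩)
  have hf1 := length_step (f' := (S.step cap (q t)).f1) (e' := 1) h.f0
    (.inl ⟨by simp [Scan.step, h1], fun s hs => isWindow_one_succ_one h1 hs⟩)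
  by_cases hpp : S.p = 1
  · obtain ⟨i, rfl, hq⟩ := h.p.1 hpp
    exact ⟨⟨hf0, hf1, length_step h.f1 (.inl ⟨by simp [Scan.step, h1, hpp],
      fun s hs => isWindow_two_succ_one_of_one h1 hq hs⟩), hp,
      by simp [Scan.step, h1, hpp, hle]⟩, by simp [Scan.step, h1, hpp]; omega⟩
  · exact ⟨⟨hf0, hf1, length_step h.f0 (.inl ⟨by simp [Scan.step, h1, hpp],
      fun s hs => isWindow_two_succ_one h1 (fun i hi hq => hpp (h.p.2 ⟨i, hi, hq⟩)) hs⟩), hp,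
      by simp [Scan.step, h1, hpp]⟩, by simp [Scan.step, h1, hpp]; omega⟩

theorem Scan.isCorrect_run (t : ℕ) : (Scan.run cap q t).IsCorrect q t := by
  induction t with
  | zero =>
    refine ⟨?_, ?_, ?_, by simp [run], by simp [run]⟩ <;>
    · refine ⟨le_rfl, fun s hs => ?_⟩
      obtain rfl := Nat.le_zero.1 hs
      exact iff_of_true isWindow_self (by omega)
  | succ t ih => exact ih.step.1

/-- `f2` grows by at most one per entry and does not exceed `best` until the cap is reached, so it
is enough to raise `best` by one at a time. -/
theorem Scan.best_run (t : ℕ) :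
    (∃ s t', t' ≤ t ∧ IsWindow q 2 s t' ∧ s + (Scan.run cap q t).best = t') ∧
    (Scan.run cap q t).best ≤ cap ∧
    ∀ s t', t' ≤ t → IsWindow q 2 s t' → t' ≤ s + cap → t' ≤ s + (Scan.run cap q t).best := by
  induction t with
  | zero => exact ⟨⟨0, 0, le_rfl, isWindow_self, rfl⟩, Nat.zero_le _, fun s t' h _ _ => by omega⟩
  | succ t ih =>
    obtain ⟨⟨s₀, t₀, h1, h2, h3⟩, h4, h5⟩ := ih
    obtain ⟨hc, hf⟩ := (Scan.isCorrect_run (cap := cap) (q := q) t).step (cap := cap)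
    have hf2 : (run cap q t).f2 ≤ (run cap q t).best ∨ (run cap q t).best = cap := by
      have h6 := (Scan.isCorrect_run (cap := cap) (q := q) t).f2
      have hw := (h6.2 (t - (run cap q t).f2) (by omega)).2 (by omega)
      by_contra! hlt
      have := h5 (t - ((run cap q t).best + 1)) t le_rfl ((h6.2 _ (by omega)).2 (by omega))
        (by omega)
      omega
    change (∃ s t', t' ≤ t + 1 ∧ IsWindow q 2 s t' ∧
      s + ((run cap q t).step cap (q t)).best = t') ∧ ((run cap q t).step cap (q t)).best ≤ cap ∧
      ∀ s t', t' ≤ t + 1 → IsWindow q 2 s t' → t' ≤ s + cap →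
        t' ≤ s + ((run cap q t).step cap (q t)).best
    have hb : ((run cap q t).step cap (q t)).best =
        if (run cap q t).best < ((run cap q t).step cap (q t)).f2 ∧ (run cap q t).best < cap then
          (run cap q t).best + 1 else (run cap q t).best := rfl
    have hmax : ∀ s t', t' ≤ t + 1 → IsWindow q 2 s t' → t' ≤ s + cap →
        t' ≤ s + (run cap q t).best ∨ t' ≤ s + ((run cap q t).step cap (q t)).f2 := by
      intro s t' ht' hw hcap
      rcases Nat.le_succ_iff.1 ht' with h | rfl
      · exact .inl (h5 s t' h hw hcap)
      · rcases Nat.lt_or_ge (t + 1) s with h | h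
        · left; omega
        · exact .inr ((hc.f2.2 s h).1 hw)
    split_ifs at hb with hif
    · refine ⟨⟨t + 1 - ((run cap q t).best + 1), t + 1, le_rfl, (hc.f2.2 _ (by omega)).2 (by omega),
        ?_⟩, by omega, fun s t' ht' hw hcap => ?_⟩
      · have := hc.f2.1; omega
      · have := hmax s t' ht' hw hcap; omega
    · refine ⟨⟨s₀, t₀, by omega, h2, by omega⟩, by omega, fun s t' ht' hw hcap => ?_⟩
      have := hmax s t' ht' hw hcap; omega

end Scanning

/-! ### Cycle vertices as entries of a scan -/

section Classes

variable {V : Type u} {G : SimpleGraph V} {r : V} {pos : V → ℕ} {par : V → V}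

open Classical in
/-- On a cycle: `0` if `x` is no cut vertex, `1` if `x ∈ R₁(G)`, and `2` otherwise. -/
noncomputable def vertexClass (G : SimpleGraph V) (r : V) (par : V → V) (x : V) : ℕ :=
  if (G.neighborSet x).ncard = 2 then 0
  else if (G.neighborSet x).ncard = 3 ∧ HasPendantChild G r par x then 1 else 2

variable [Fintype V] {k : ℕ} {c : ZMod k → V} {π : V → ZMod k}

theorem IsRing.isWindow_iff (h : IsRing G c π) (hG : G.Connected) (ht : IsSearchTree G r pos par)
    (hr : 3 ≤ (G.neighborSet r).ncard) (a : ZMod k) (s m : ℕ) :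
    IsWindow (fun i => vertexClass G r par (c (a + 1 + i))) 2 s (s + m) ↔
      ArcCondition G c (a + s) m := by
  have h0 : ∀ i, vertexClass G r par (c i) = 0 ↔ ¬ IsCutVertex G (c i) := by
    intro i
    rw [h.isCutVertex_iff_ncard hG, vertexClass]
    split_ifs with h1 <;> simp [h1]
  have h1 : ∀ i, vertexClass G r par (c i) = 1 ↔ c i ∈ R1 G := by
    intro i
    rw [h.mem_R1_iff_ncard hG ht hr, vertexClass]
    split_ifs with h1 h2
    · simp [h1]
    · simp [h2]
    · simp [h2]
  have hcast : ∀ i : ℕ, 0 < i → a + s + i = a + 1 + (s + (i - 1) : ℕ) := by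
    intro i hi
    obtain ⟨i, rfl⟩ := Nat.exists_eq_succ_of_ne_zero hi.ne'
    push_cast [Nat.succ_sub_one]; ring
  constructor
  · rintro ⟨h2, j, h3⟩
    have key : ∀ i : ℕ, 0 < i → i ≤ m → IsCutVertex G (c (a + s + i)) →
        vertexClass G r par (c (a + s + i)) = 1 := by
      intro i hi him hcut
      rw [hcast i hi] at hcut ⊢
      rcases h2 (s + (i - 1)) (by omega) (by omega) with h | h
      · exact absurd hcut ((h0 _).1 h)
      · exact h.1
    -- Entry `s + (i - 1)` of the scan is vertex `i` of the arc, so the pair starts at `j + 1 - s`;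
    -- if the subtraction is truncated, the pair lies before the arc.
    refine ⟨fun i hi him hcut => (h1 _).1 (key i hi him hcut), j + 1 - s, fun i hi him hcut => ?_⟩
    have h4 := key i hi him hcut
    rw [hcast i hi] at h4
    have := h3 _ (by omega) (by omega) h4
    omega
  · rintro ⟨h2, j, h3⟩
    have hcast' : ∀ i, s ≤ i → a + 1 + (i : ZMod k) = a + s + ((i - s + 1 : ℕ) : ZMod k) := by
      intro i hi
      rw [hcast _ (by omega)]; congr 2; omega
    refine ⟨fun i hi him => ?_, s + j - 1, fun i hi him hq => ?_⟩
    · by_cases hcut : IsCutVertex G (c (a + 1 + i))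
      · right
        rw [h1]
        rw [hcast' i hi] at hcut ⊢
        exact ⟨h2 _ (by omega) (by omega) hcut, two_pos⟩
      · exact .inl ((h0 _).2 hcut)
    · have hcut : IsCutVertex G (c (a + 1 + i)) := by
        by_contra hn
        exact one_ne_zero (hq.symm.trans ((h0 _).2 hn))
      rw [hcast' i hi] at hcut
      have := h3 _ (by omega) (by omega) hcut
      omega

omit [Fintype V] in
theorem IsRing.card_arc (h : IsRing G c π) {a : ZMod k} {m : ℕ} (hm : m < k) {S : Finset V}
    (hS : IsArc c a m S) : S.card = m := by
  classical
  have : S = (Finset.Icc 1 m).image fun i : ℕ => c (a + i) := by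
    ext w
    rw [hS, Finset.mem_image]
    simp only [Finset.mem_Icc, Nat.succ_le_iff, and_assoc]
  rw [this, Finset.card_image_of_injOn, Nat.card_Icc, Nat.add_sub_cancel]
  intro i hi j hj hij
  rw [Finset.mem_coe, Finset.mem_Icc] at hi hj
  exact h.arc_inj (by omega) (by omega) hij

/-- Twice around the cycle every arc with at most `k - 1` vertices occurs as a window, wherever the
scan starts, and the cap `k - 1` is the size of the largest segments. -/
theorem IsRing.best_run_eq (h : IsRing G c π) (hG : G.Connected) (hC : IsCactus G)
    (ht : IsSearchTree G r pos par) (hr : 3 ≤ (G.neighborSet r).ncard) {C : Finset V}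
    (hc : ∀ w, w ∈ C ↔ ∃ i, c i = w) (a : ZMod k) :
    (Scan.run (k - 1) (fun i => vertexClass G r par (c (a + 1 + i))) (2 * k)).best =
      maxFeasible G C := by
  classical
  have h3 := h.three_le
  have hCC : C ∈ cycleSets G := mem_cycleSets_iff.2 ⟨k, c, h.isCyclic, hc⟩
  obtain ⟨⟨s, t, h1, h2, h4⟩, h5, h6⟩ := Scan.best_run (cap := k - 1)
    (q := fun i => vertexClass G r par (c (a + 1 + i))) (2 * k)
  refine le_antisymm ?_ ?_
  · set m := (Scan.run (k - 1) (fun i => vertexClass G r par (c (a + 1 + i))) (2 * k)).best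
    rw [← h4, h.isWindow_iff hG ht hr] at h2
    let S : Finset V := (Finset.Icc 1 m).image fun i : ℕ => c (a + s + i)
    have hS : IsArc c (a + s) m S := by
      intro w
      simp only [S, Finset.mem_image, Finset.mem_Icc, Nat.succ_le_iff, and_assoc]
    have hseg : IsSegment G C S := (h.isSegment_iff hc).2 ⟨_, m, by omega, hS⟩
    rw [← h.card_arc (by omega) hS, maxFeasible]
    exact Finset.le_sup (f := Finset.card) (Finset.mem_filter.2 ⟨Finset.mem_univ _, hseg,
      (isFeasible_iff hG hC hCC hseg).2 ((h.cutVertexCondition_iff (by omega) hS).2 h2)⟩)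
  · obtain ⟨S, hseg, hcv, hcard⟩ := exists_maxFeasible hG hC hCC
    obtain ⟨b, m, hm, hS⟩ := (h.isSegment_iff hc).1 hseg
    rw [← hcard, h.card_arc hm hS]
    obtain ⟨s', hs', rfl⟩ := exists_natCast_zmod h.three_le a b
    have := h6 s' (s' + m) (by omega)
      ((h.isWindow_iff hG ht hr _ _ _).2 ((h.cutVertexCondition_iff hm hS).1 hcv)) (by omega)
    omega

end Classes

/-! ### Search for a vertex of degree at least three -/

section FindRoot

attribute [simp] Halts.skip_iff Halts.assign_iff Halts.write_iff Halts.seq_iff Halts.ite_iff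
  Store.setReg_reg Store.setReg_arr Store.setArr_reg Store.setArr_arr
  Expr.eval Expr.cost Test.holds Test.cost

variable {n : ℕ} {G : SimpleGraph (Fin n)} {adj : Fin n → List (Fin n)}

theorem HoldsInput.read_succ {σ : Store} (h : HoldsInput adj σ) (v : Fin n) :
    σ.arr 0 (v + 1) = σ.arr 0 v + (adj v).length := by
  rw [h.arr0, listStart_succ]

theorem HoldsInput.read_entry {σ : Store} (h : HoldsInput adj σ) (v : Fin n) (i : ℕ)
    (hi : i < (adj v).length) : σ.arr 1 (σ.arr 0 v + i) = ((adj v)[i] : Fin n) := by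
  rw [h.arr0, h.arr1, listEntry_start v i hi]

/-- Register `1` gets a vertex of degree at least `3`, and register `2` tells whether there is one. -/
def findRoot : Prog :=
  .while (.lt (.reg 3) (.reg 0))
    (.seq
      -- The machine cannot subtract two registers, so degrees are tested by comparing the starting
      -- positions of consecutive lists.
      (.ite (.lt (.succ (.succ (.read 0 (.reg 3)))) (.read 0 (.succ (.reg 3))))
        (.seq (.assign 1 (.reg 3)) (.assign 2 (.const 1)))
        .skip)
      (.assign 3 (.succ (.reg 3))))

theorem halts_findRoot (adj : Fin n → List (Fin n)) :
    Halts findRoot (inputStore adj) fun τ t =>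
      τ.arr = (inputStore adj).arr ∧ τ.reg 0 = n ∧
      ((τ.reg 2 = 0 ∧ ∀ v, (adj v).length ≤ 2) ∨
        (τ.reg 2 = 1 ∧ ∃ r : Fin n, τ.reg 1 = r ∧ 3 ≤ (adj r).length)) ∧ t ≤ 30 * n + 30 := by
  refine (Halts.for_rule n (fun i τ => τ.arr = (inputStore adj).arr ∧ τ.reg 0 = n ∧ τ.reg 3 = i ∧
      ((τ.reg 2 = 0 ∧ ∀ v : Fin n, v.val < i → (adj v).length ≤ 2) ∨
        (τ.reg 2 = 1 ∧ ∃ r : Fin n, τ.reg 1 = r ∧ 3 ≤ (adj r).length))) (fun _ => 30)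
    ?_ ?_ ?_).mono ?_
  · rintro i τ - ⟨-, h0, h3, -⟩
    simp [h0, h3]
  · rintro i τ hi ⟨ha, h0, h3, h⟩
    have hin : HoldsInput adj τ := ⟨h0, by rw [ha]; rfl, by rw [ha]; rfl⟩
    have hs := hin.read_succ ⟨i, hi⟩
    simp only at hs
    simp only [Halts.seq_iff, Halts.ite_iff, Halts.assign_iff, Halts.skip_iff]
    constructor
    · intro hb
      simp only [Test.holds, Expr.eval, h3, hs] at hb
      refine ⟨⟨by simpa using ha, by simpa using h0, by simp [h3], .inr ⟨by simp, ⟨i, hi⟩, by simp [h3], ?_⟩⟩,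
        by simp⟩
      omega
    · intro hb
      simp only [Test.holds, Expr.eval, h3, hs] at hb
      refine ⟨⟨by simpa using ha, by simpa using h0, by simp [h3], ?_⟩, by simp⟩
      refine h.imp (fun h => ⟨by simpa using h.1, fun v hv => ?_⟩) fun h => by simpa using h
      rcases Nat.lt_succ_iff_lt_or_eq.1 hv with hv | rfl
      · exact h.2 v hv
      · simp only [Fin.eta] at hb; omega
  · refine ⟨rfl, rfl, rfl, .inl ⟨rfl, fun v hv => ?_⟩⟩
    exact absurd hv (Nat.not_lt_zero _)
  · rintro τ t ⟨⟨ha, h0, h3, h⟩, ht⟩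
    refine ⟨ha, h0, h.imp (fun h => ⟨h.1, fun v => h.2 v v.isLt⟩) id, ?_⟩
    simp at ht
    omega

end FindRoot

/-! ### Breadth first search: program and invariant -/

section Search

variable {n : ℕ} {G : SimpleGraph (Fin n)} {adj : Fin n → List (Fin n)} {r : Fin n}

theorem HoldsInput.congr {σ τ : Store} (h : HoldsInput adj σ) (h0 : τ.reg 0 = σ.reg 0)
    (ha : τ.arr 0 = σ.arr 0) (hb : τ.arr 1 = σ.arr 1) : HoldsInput adj τ :=
  ⟨h0.trans h.reg0, ha.trans h.arr0, hb.trans h.arr1⟩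

/-- Scan the list of the vertex in register `7`, and append the new vertices to the queue. -/
def visitNeighbors : Prog :=
  .while (.lt (.reg 6) (.read 0 (.succ (.reg 7))))
    (.seq (.assign 8 (.read 1 (.reg 6)))
    (.seq
      (.ite (.eq (.read 2 (.reg 8)) (.const 0))
        (.seq (.write 4 (.reg 5) (.reg 8))
        (.seq (.assign 5 (.succ (.reg 5)))
        (.seq (.write 2 (.reg 8) (.reg 5))
          (.write 3 (.reg 8) (.reg 7)))))
        .skip)
      (.assign 6 (.succ (.reg 6)))))

/-- Breadth first search from the vertex in register `1`. Array `4` is the queue, array `2` holds the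
positions in the queue (starting with `1`), and array `3` holds the parents. -/
def search : Prog :=
  .seq (.write 4 (.const 0) (.reg 1))
  (.seq (.write 2 (.reg 1) (.const 1))
  (.seq (.assign 4 (.const 0))
  (.seq (.assign 5 (.const 1))
    (.while (.lt (.reg 4) (.reg 5))
      (.seq (.assign 7 (.read 4 (.reg 4)))
      (.seq (.assign 6 (.read 0 (.reg 7)))
      (.seq visitNeighbors
        (.assign 4 (.succ (.reg 4))))))))))

/-- The loop invariant. The value `0` in array `2` means not yet visited, which is why positions
start with `1`; `mark` keeps array `6` clean for the marking of pendant paths. -/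
structure HoldsQueue (G : SimpleGraph (Fin n)) (adj : Fin n → List (Fin n)) (r : Fin n)
    (σ : Store) : Prop where
  input : HoldsInput adj σ
  root : σ.arr 2 r = 1
  queue : ∀ i < σ.reg 5, ∃ v : Fin n, σ.arr 4 i = v ∧ σ.arr 2 v = i + 1
  pos : ∀ v : Fin n, σ.arr 2 v ≤ σ.reg 5
  inv : ∀ v : Fin n, σ.arr 2 v ≠ 0 → σ.arr 4 (σ.arr 2 v - 1) = v
  par : ∀ v : Fin n, v ≠ r → σ.arr 2 v ≠ 0 → ∃ u : Fin n, σ.arr 3 v = u ∧ G.Adj v u ∧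
    σ.arr 2 u ≠ 0 ∧ σ.arr 2 u < σ.arr 2 v
  mark : ∀ i, σ.arr 6 i = 0

theorem HoldsQueue.congr {σ τ : Store} (h : HoldsQueue G adj r σ) (h0 : τ.reg 0 = σ.reg 0)
    (h5 : τ.reg 5 = σ.reg 5) (ha : τ.arr = σ.arr) : HoldsQueue G adj r τ :=
  ⟨h.input.congr h0 (by rw [ha]) (by rw [ha]), by rw [ha, h.root], by rw [ha, h5]; exact h.queue,
    by rw [ha, h5]; exact h.pos, by rw [ha]; exact h.inv, by rw [ha]; exact h.par,
    by rw [ha]; exact h.mark⟩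

theorem HoldsQueue.push {σ τ : Store} (h : HoldsQueue G adj r σ) {v w : Fin n} (hvw : G.Adj v w)
    (hv : σ.arr 2 v ≠ 0) (hw : σ.arr 2 w = 0) (h0 : τ.reg 0 = σ.reg 0) (h5 : τ.reg 5 = σ.reg 5 + 1)
    (ha0 : τ.arr 0 = σ.arr 0) (ha1 : τ.arr 1 = σ.arr 1)
    (ha2 : τ.arr 2 = Function.update (σ.arr 2) w (σ.reg 5 + 1))
    (ha3 : τ.arr 3 = Function.update (σ.arr 3) w v)
    (ha4 : τ.arr 4 = Function.update (σ.arr 4) (σ.reg 5) w) (ha6 : τ.arr 6 = σ.arr 6) :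
    HoldsQueue G adj r τ := by
  have hne : ∀ x : Fin n, x ≠ w → τ.arr 2 x = σ.arr 2 x ∧ τ.arr 3 x = σ.arr 3 x := fun x hx => by
    have : x.val ≠ w.val := fun h => hx (Fin.ext h)
    rw [ha2, ha3, Function.update_of_ne this, Function.update_of_ne this]
    exact ⟨rfl, rfl⟩
  have hw2 : τ.arr 2 w = σ.reg 5 + 1 := by rw [ha2, Function.update_self]
  have h4 : ∀ i, i ≠ σ.reg 5 → τ.arr 4 i = σ.arr 4 i := fun i hi => by
    rw [ha4, Function.update_of_ne hi]
  have h45 : τ.arr 4 (σ.reg 5) = w := by rw [ha4, Function.update_self]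
  have hvw' : v ≠ w := hvw.ne
  have hv' := h.pos v
  refine ⟨h.input.congr h0 ha0 ha1, ?_, fun i hi => ?_, fun x => ?_, fun x hx => ?_,
    fun x hxr hx => ?_, by rw [ha6]; exact h.mark⟩
  · rw [(hne r ?_).1, h.root]
    rintro rfl
    rw [h.root] at hw; exact one_ne_zero hw
  · rcases Nat.lt_succ_iff_lt_or_eq.1 (h5 ▸ hi) with hi | rfl
    · obtain ⟨x, h1, h2⟩ := h.queue i hi
      refine ⟨x, by rw [h4 i hi.ne, h1], ?_⟩
      rw [(hne x ?_).1, h2]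
      rintro rfl
      omega
    · exact ⟨w, h45, hw2⟩
  · by_cases hxw : x = w
    · rw [hxw, hw2, h5]
    · rw [(hne x hxw).1, h5]; exact (h.pos x).trans (Nat.le_succ _)
  · by_cases hxw : x = w
    · rw [hxw, hw2, Nat.add_sub_cancel, h45]
    · rw [(hne x hxw).1] at hx ⊢
      rw [h4, h.inv x hx]
      have := h.pos x; omega
  · by_cases hxw : x = w
    · subst hxw
      refine ⟨v, by rw [ha3, Function.update_self], hvw.symm, ?_, ?_⟩
      · rwa [(hne v hvw').1]
      · rw [(hne v hvw').1, hw2]; omega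
    · rw [(hne x hxw).1] at hx
      obtain ⟨u, h1, h2, h3, h6⟩ := h.par x hxr hx
      have hu : u ≠ w := by rintro rfl; exact h3 hw
      exact ⟨u, by rw [(hne x hxw).2, h1], h2, by rwa [(hne u hu).1], by
        rwa [(hne u hu).1, (hne x hxw).1]⟩

/-- New vertices go behind the current one, at positions above `σ.reg 4 + 1`, and old positions do
not change; so a round of the search adds just `v` to the processed vertices. -/
theorem halts_visitNeighbors {σ : Store} (h : HoldsQueue G adj r σ) (hadj : IsAdjacencyList G adj)
    {v : Fin n} (h7 : σ.reg 7 = v) (h6 : σ.reg 6 = σ.arr 0 v) (hv : σ.arr 2 v = σ.reg 4 + 1) :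
    Halts visitNeighbors σ fun τ t => HoldsQueue G adj r τ ∧ τ.reg 4 = σ.reg 4 ∧
      (∀ x : Fin n, σ.arr 2 x ≠ 0 → τ.arr 2 x = σ.arr 2 x) ∧
      (∀ x : Fin n, σ.arr 2 x = 0 → τ.arr 2 x = 0 ∨ σ.reg 4 + 1 < τ.arr 2 x) ∧
      (∀ w, G.Adj v w → τ.arr 2 w ≠ 0) ∧ t ≤ 40 * (adj v).length + 10 := by
  have hin := h.input
  refine (Halts.for_rule (adj v).length (fun i τ => HoldsQueue G adj r τ ∧ τ.reg 4 = σ.reg 4 ∧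
      σ.reg 5 ≤ τ.reg 5 ∧ τ.reg 7 = v ∧ τ.reg 6 = σ.arr 0 v + i ∧
      (∀ x : Fin n, σ.arr 2 x ≠ 0 → τ.arr 2 x = σ.arr 2 x) ∧
      (∀ x : Fin n, σ.arr 2 x = 0 → τ.arr 2 x = 0 ∨ σ.reg 4 + 1 < τ.arr 2 x) ∧
      (∀ j (hj : j < (adj v).length), j < i → τ.arr 2 ((adj v)[j] : Fin n) ≠ 0))
    (fun _ => 40) ?_ ?_ ?_).mono ?_
  · rintro i τ hi ⟨hq, -, -, h7', h6', -⟩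
    have hs := hq.input.read_succ v
    rw [hq.input.arr0, ← hin.arr0] at hs
    simp only [Test.holds, Expr.eval, h7', h6']
    rw [hq.input.arr0, ← hin.arr0]
    omega
  · rintro i τ hi ⟨hq, h4', h5', h7', h6', hold, hnew, hdone⟩
    have he : τ.arr 1 (σ.arr 0 v + i) = ((adj v)[i] : Fin n) := by
      rw [hin.arr0, ← hq.input.arr0, hq.input.read_entry v i hi]
    obtain ⟨w, hw⟩ : ∃ w, w = (adj v)[i] := ⟨_, rfl⟩
    have hvw : G.Adj v w := ((hadj v).2 w).1 (hw ▸ List.getElem_mem hi)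
    rw [← hw] at he
    have hvτ : τ.arr 2 v ≠ 0 := by rw [hold v (by omega)]; omega
    have h5v : σ.arr 2 v ≤ σ.reg 5 := h.pos v
    simp only [Halts.seq_iff, Halts.ite_iff, Halts.assign_iff, Halts.skip_iff,
      Halts.write_iff]
    constructor
    · intro hb
      have hw0 : τ.arr 2 w = 0 := by simpa [h6', he] using hb
      refine ⟨⟨hq.push hvw hvτ hw0 ?_ ?_ ?_ ?_ ?_ ?_ ?_ ?_, ?_⟩, by simp⟩
      any_goals simp [h6', he, h7']; done
      · simp only [Store.setReg_reg, Store.setReg_arr, Store.setArr_reg, Store.setArr_arr,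
          Expr.eval, h6', he, h7', Nat.reduceEqDiff, if_true, if_false, h4']
        refine ⟨trivial, by omega, trivial, by omega, fun x hx => ?_, fun x hx => ?_,
          fun j hj hji => ?_⟩
        · rw [Function.update_of_ne, hold x hx]
          intro hxw
          rw [← hold x hx, hxw] at hx
          exact hx hw0
        · by_cases hxw : x.val = w.val
          · rw [hxw, Function.update_self]; right; omega
          · rw [Function.update_of_ne hxw]; exact hnew x hx
        · by_cases hxw : ((adj v)[j] : Fin n).val = w.val
          · rw [hxw, Function.update_self]; omega
          · rw [Function.update_of_ne hxw]
            refine hdone j hj ?_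
            rcases Nat.lt_succ_iff_lt_or_eq.1 hji with h | rfl
            · exact h
            · exact absurd (by rw [hw]) hxw
    · intro hb
      have hw0 : τ.arr 2 w ≠ 0 := by simpa [h6', he] using hb
      refine ⟨⟨hq.congr (by simp) (by simp) (by simp), ?_⟩, by simp⟩
      simp only [Store.setReg_reg, Store.setReg_arr, Expr.eval, h6', he, h7', Nat.reduceEqDiff,
        if_true, if_false, h4']
      refine ⟨trivial, h5', trivial, by omega, hold, hnew, fun j hj hji => ?_⟩
      rcases Nat.lt_succ_iff_lt_or_eq.1 hji with h | rfl
      · exact hdone j hj h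
      · rwa [← hw]
  · exact ⟨h, rfl, le_rfl, h7, h6, fun _ _ => rfl, fun _ h => .inl h,
      fun j _ hj => absurd hj (Nat.not_lt_zero _)⟩
  · rintro τ t ⟨⟨hq, h4', -, -, -, hold, hnew, hdone⟩, ht⟩
    refine ⟨hq, h4', hold, hnew, fun w hw => ?_, ?_⟩
    · obtain ⟨j, hj, rfl⟩ := List.getElem_of_mem (((hadj v).2 w).2 hw)
      exact hdone j hj hj
    · simp at ht
      omega

end Search

/-! ### The tree that the search leaves in the store -/

section SearchResult

variable {n : ℕ} {G : SimpleGraph (Fin n)} {adj : Fin n → List (Fin n)} {r : Fin n}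
  {pos : Fin n → ℕ} {par : Fin n → Fin n}

/-- The store holds the input and a search tree. -/
structure HoldsTree (adj : Fin n → List (Fin n)) (r : Fin n) (pos : Fin n → ℕ)
    (par : Fin n → Fin n) (σ : Store) : Prop where
  input : HoldsInput adj σ
  arr2 : ∀ v : Fin n, σ.arr 2 v = pos v
  arr3 : ∀ v : Fin n, v ≠ r → σ.arr 3 v = par v
  arr4 : ∀ i < n, ∃ v : Fin n, σ.arr 4 i = v ∧ pos v = i + 1

theorem HoldsTree.congr {σ τ : Store} (h : HoldsTree adj r pos par σ) (h0 : τ.reg 0 = σ.reg 0)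
    (ha : ∀ a < 5, τ.arr a = σ.arr a) : HoldsTree adj r pos par τ :=
  ⟨h.input.congr h0 (ha 0 (by omega)) (ha 1 (by omega)), by rw [ha 2 (by omega)]; exact h.arr2,
    by rw [ha 3 (by omega)]; exact h.arr3, by rw [ha 4 (by omega)]; exact h.arr4⟩

theorem HoldsTree.le {σ : Store} (h : HoldsTree adj r pos par σ) (v : Fin n) :
    0 < pos v ∧ pos v ≤ n := by
  have hsurj : ∀ i : Fin n, ∃ v : Fin n, pos v = i + 1 := fun i => by
    obtain ⟨v, -, hv⟩ := h.arr4 i i.isLt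
    exact ⟨v, hv⟩
  choose f hf using hsurj
  have hinj : Function.Injective f := fun i j hij => by
    have := hf i
    rw [hij, hf j] at this
    exact Fin.ext (by omega)
  obtain ⟨i, rfl⟩ := (Finite.injective_iff_surjective.1 hinj) v
  rw [hf]
  omega

/-- The vertices whose neighbours have been visited. -/
def processed (n : ℕ) (σ : Store) : Finset (Fin n) :=
  Finset.univ.filter fun v => σ.arr 2 v ≠ 0 ∧ σ.arr 2 v ≤ σ.reg 4

/-- With the queue exhausted, the visited vertices are closed under adjacency and hence all
vertices, so the positions are a bijection with `1, …, n`. -/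
theorem HoldsQueue.exists_tree {σ : Store} (h : HoldsQueue G adj r σ) (hG : G.Connected)
    (hle : σ.reg 5 ≤ σ.reg 4)
    (hcl : ∀ v ∈ processed n σ, ∀ w, G.Adj v w → σ.arr 2 w ≠ 0) :
    ∃ pos par, IsSearchTree G r pos par ∧ HoldsTree adj r pos par σ := by
  have hall : ∀ v : Fin n, σ.arr 2 v ≠ 0 := by
    intro v
    obtain ⟨p⟩ := hG.preconnected v r
    induction p with
    | nil => rw [h.root]; exact one_ne_zero
    | cons ha _ ih =>
      refine hcl _ ?_ _ ha.symm
      exact Finset.mem_filter.2 ⟨Finset.mem_univ _, ih h, (h.pos _).trans hle⟩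
  have hn : σ.reg 5 = n := by
    suffices h : (Finset.univ : Finset (Fin n)).card = (Finset.range (σ.reg 5)).card by
      simpa using h.symm
    refine Finset.card_bij (fun v _ => σ.arr 2 v - 1) ?_ ?_ ?_
    · intro v _
      have := h.pos v
      have := hall v
      rw [Finset.mem_range]; omega
    · intro v _ w _ hvw
      have h1 := h.inv v (hall v)
      rw [hvw, h.inv w (hall w)] at h1
      exact (Fin.ext h1).symm
    · intro i hi
      obtain ⟨v, -, hv⟩ := h.queue i (Finset.mem_range.1 hi)
      exact ⟨v, Finset.mem_univ _, by omega⟩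
  choose f hf1 hf2 _ hf4 using fun v hv => h.par v hv (hall v)
  refine ⟨fun v => σ.arr 2 v, fun v => if hv : v = r then r else f v hv, ⟨?_, ?_, ?_⟩,
    ⟨h.input, fun _ => rfl, ?_, fun i hi => h.queue i (hn ▸ hi)⟩⟩
  · intro v w hvw
    have h1 := h.inv v (hall v)
    dsimp only at hvw
    rw [hvw, h.inv w (hall w)] at h1
    exact (Fin.ext h1).symm
  · intro v hv
    rw [dif_neg hv]; exact hf2 v hv
  · intro v hv
    rw [dif_neg hv]; exact hf4 v hv
  · intro v hv
    rw [dif_neg hv]; exact hf1 v hv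

theorem halts_search {σ : Store} (h : HoldsInput adj σ) (hadj : IsAdjacencyList G adj)
    (hG : G.Connected) (h1 : σ.reg 1 = r) (hz : ∀ a j, 2 ≤ a → σ.arr a j = 0) :
    Halts search σ fun τ t => (∃ pos par, IsSearchTree G r pos par ∧ HoldsTree adj r pos par τ) ∧
      (∀ i, τ.arr 6 i = 0) ∧ t ≤ 60 * n + 60 * ∑ v, (adj v).length + 60 := by
  simp only [search, Halts.seq_iff, Halts.assign_iff, Halts.write_iff]
  -- The elapsed time is charged to the processed vertices, a constant for each of them and for each
  -- entry of their lists.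
  refine (Halts.while_rule (fun τ t => HoldsQueue G adj r τ ∧ τ.reg 4 ≤ τ.reg 5 ∧
    (∀ v ∈ processed n τ, ∀ w, G.Adj v w → τ.arr 2 w ≠ 0) ∧
    t ≤ ∑ v ∈ processed n τ, (60 + 60 * (adj v).length))
    (fun τ => n - (processed n τ).card) ?_ ?_ ?_).mono ?_ (Q := fun τ t =>
      (∃ pos par, IsSearchTree G r pos par ∧ HoldsTree adj r pos par τ) ∧
      (∀ i, τ.arr 6 i = 0) ∧ t ≤ 60 * n + 60 * ∑ v, (adj v).length + 3)
  · rintro τ t ⟨hq, hle, hcl, ht⟩ hb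
    have hb' : τ.reg 4 < τ.reg 5 := by simpa using hb
    obtain ⟨v, h4, h2⟩ := hq.queue _ hb'
    simp only [Halts.seq_iff, Halts.assign_iff]
    refine (halts_visitNeighbors (v := v) (hq.congr (by simp) (by simp) (by simp)) hadj
      (by simp [h4]) (by simp [h4]) (by simp [h2])).mono ?_
    rintro ρ s ⟨hq', h4', hold, hnew, hdone, hs⟩
    simp only [Store.setReg_reg, Store.setReg_arr, Nat.reduceEqDiff, if_false] at h4' hold hnew
    have hv : v ∉ processed n τ := by simp [processed, h2]
    have hρ : processed n (ρ.setReg 4 ((Expr.succ (.reg 4)).eval ρ)) = insert v (processed n τ) := by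
      ext x
      simp only [processed, Finset.mem_filter, Finset.mem_univ, true_and, Finset.mem_insert,
        Store.setReg_arr, Store.setReg_reg, if_true, Expr.eval, h4']
      by_cases hx : τ.arr 2 x = 0
      · have : x ≠ v := by rintro rfl; omega
        rcases hnew x hx with h | h
        · simp [h, hx, this]
        · refine iff_of_false (fun h' => by omega) ?_
          rintro (h' | h')
          · exact this h'
          · exact h'.1 hx
      · rw [hold x hx]
        constructor
        · rintro ⟨h1, h2'⟩
          rcases Nat.le_succ_iff.1 h2' with h | h
          · exact .inr ⟨hx, h⟩
          · left
            have h3 := hq.inv x hx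
            rw [h, Nat.succ_eq_add_one, Nat.add_sub_cancel, h4] at h3
            exact (Fin.ext h3).symm
        · rintro (rfl | h)
          · exact ⟨hx, by omega⟩
          · exact ⟨hx, by omega⟩
    have h5 : τ.reg 4 + 1 ≤ ρ.reg 5 := by
      have := hq'.pos v
      rw [hold v (by omega)] at this
      omega
    have hcard := Finset.card_insert_of_notMem hv
    have hcard' := Finset.card_le_univ (insert v (processed n τ))
    rw [Fintype.card_fin] at hcard'
    refine ⟨⟨?_, by simpa [h4'] using h5, ?_, ?_⟩, ?_⟩
    · have := hq'.pos
      exact hq'.congr (by simp) (by simp) (by simp)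
    · rw [hρ]
      intro x hx w hxw
      rcases Finset.mem_insert.1 hx with rfl | hx
      · simpa using hdone w hxw
      · have h0 := hcl x hx w hxw
        simpa [hold w h0] using h0
    · rw [hρ, Finset.sum_insert hv]
      simp only [Test.cost, Expr.cost]
      omega
    · rw [hρ, hcard]; omega
  · refine ⟨⟨h.congr (by simp) (by simp) (by simp), by simp [h1], ?_, ?_, ?_, ?_, ?_⟩, by simp, ?_, ?_⟩
    · intro i hi
      obtain rfl : i = 0 := by simpa using hi
      exact ⟨r, by simp [h1], by simp [h1]⟩
    · intro v
      by_cases hv : v.val = r.val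
      · simp [h1, hv]
      · simp [h1, hv, hz]
    · intro v
      by_cases hv : v.val = r.val
      · simp [h1, hv]
      · simp [h1, hv, hz]
    · intro v hv
      have hv' : v.val ≠ r.val := fun he => hv (Fin.ext he)
      simp [h1, hv', hz]
    · intro i; simp [hz]
    · intro v hv
      exfalso
      simp [processed] at hv
    · exact Nat.zero_le _
  · rintro τ t ⟨hq, hle, hcl, ht⟩ hb
    refine ⟨hq.exists_tree hG (by simpa using hb) hcl, hq.mark, ?_⟩
    have : ∑ v ∈ processed n τ, (60 + 60 * (adj v).length) ≤ ∑ v, (60 + 60 * (adj v).length) :=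
      Finset.sum_le_sum_of_subset (Finset.subset_univ _)
    simp only [Finset.sum_add_distrib, ← Finset.mul_sum, Finset.sum_const, Finset.card_univ,
      Fintype.card_fin, smul_eq_mul] at this
    simp only [Test.cost, Expr.cost]
    simp only [Finset.sum_add_distrib, ← Finset.mul_sum, Finset.sum_const, smul_eq_mul] at ht
    omega
  · rintro τ t ⟨ht, hm, hc⟩
    refine ⟨ht, hm, ?_⟩
    simp only [Expr.cost]
    omega

end SearchResult

/-! ### Pendant vertices in reverse search order -/

section PendantMarks

variable {n : ℕ} {G : SimpleGraph (Fin n)} {adj : Fin n → List (Fin n)} {r : Fin n}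
  {pos : Fin n → ℕ} {par : Fin n → Fin n}

/-- Remove the vertex in register `7` from the count in register `9`, and mark its parent. -/
def removePendant : Prog :=
  .seq (.assign 9 (.pred (.reg 9))) (.write 6 (.read 3 (.reg 7)) (.const 1))

/-- Register `9` gets the number of the vertices outside the pendant paths, and array `6` marks
the vertices with a child in a pendant path. -/
def markPendant : Prog :=
  .seq (.assign 3 (.reg 0))
  (.seq (.assign 9 (.reg 0))
    (.while (.lt (.const 0) (.reg 3))
      (.seq (.assign 3 (.pred (.reg 3)))
      (.seq (.assign 7 (.read 4 (.reg 3)))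
        (.ite (.eq (.read 0 (.succ (.reg 7))) (.succ (.read 0 (.reg 7))))
          removePendant
          (.ite (.eq (.read 0 (.succ (.reg 7))) (.succ (.succ (.read 0 (.reg 7)))))
            (.ite (.eq (.read 6 (.reg 7)) (.const 1)) removePendant .skip)
            .skip))))))

structure HoldsMarks (G : SimpleGraph (Fin n)) (adj : Fin n → List (Fin n)) (r : Fin n)
    (pos : Fin n → ℕ) (par : Fin n → Fin n) (σ : Store) : Prop where
  tree : HoldsTree adj r pos par σ
  arr6 : ∀ x : Fin n, σ.arr 6 x = 1 ↔ HasPendantChild G r par x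

/-- Array `5` may change, as it is the buffer of the later phases. -/
theorem HoldsMarks.congr {σ τ : Store} (h : HoldsMarks G adj r pos par σ) (h0 : τ.reg 0 = σ.reg 0)
    (ha : ∀ a, a ≠ 5 → τ.arr a = σ.arr a) : HoldsMarks G adj r pos par τ :=
  ⟨h.tree.congr h0 fun a h => ha a (by omega), by rw [ha 6 (by omega)]; exact h.arr6⟩

open Classical in
/-- The vertices of the pendant paths. -/
noncomputable def pendantVertices {V : Type*} [Fintype V] (G : SimpleGraph V) : Finset V :=
  Finset.univ.filter (InPendantPath G)

/-- The queue is read from its end, so all children of a vertex are decided before it, and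
`inPendantPath_iff` can be evaluated from its degree and its mark. -/
theorem halts_markPendant {σ : Store} (h : HoldsTree adj r pos par σ) (ht : IsSearchTree G r pos par)
    (hG : G.Connected) (hadj : IsAdjacencyList G adj) (hr : 3 ≤ (G.neighborSet r).ncard)
    (h6 : ∀ i, σ.arr 6 i = 0) :
    Halts markPendant σ fun τ t => HoldsMarks G adj r pos par τ ∧
      τ.reg 9 = n - (pendantVertices G).card ∧ t ≤ 60 * n + 60 := by
  classical
  simp only [markPendant, Halts.seq_iff, Halts.assign_iff]
  -- The pendant vertices among the last `m` vertices of the queue.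
  let S : ℕ → Finset (Fin n) := fun m =>
    Finset.univ.filter fun v => n - m < pos v ∧ InPendantPath G v
  have hS : ∀ m x, x ∈ S m ↔ n - m < pos x ∧ InPendantPath G x := fun m x => by simp [S]
  refine (Halts.for_rule n (fun m τ => HoldsTree adj r pos par τ ∧ τ.reg 3 = n - m ∧
    τ.reg 9 = n - (S m).card ∧ ∀ x : Fin n, τ.arr 6 x = 1 ↔ ∃ w ∈ S m, w ≠ r ∧ par w = x)
    (fun _ => 60) ?_ ?_ ?_).mono ?_
  · rintro m τ hm ⟨-, h3, -⟩
    simp only [Test.holds, Expr.eval, h3]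
    omega
  · rintro m τ hm ⟨hT, h3, h9, hm6⟩
    obtain ⟨v, hv4, hvp⟩ := hT.arr4 (n - m - 1) (by omega)
    have hlen := hT.input.read_succ v
    have hpos : ∀ x, n - (m + 1) < pos x ↔ x = v ∨ n - m < pos x := by
      intro x
      constructor
      · intro hx
        by_cases he : pos x = pos v
        · exact .inl (ht.inj he)
        · right; omega
      · rintro (rfl | hx) <;> omega
    have hpend : InPendantPath G v ↔
        (adj v).length = 1 ∨ (adj v).length = 2 ∧ τ.arr 6 v = 1 := by
      rw [inPendantPath_iff ht hG hr, hadj.length_eq, hm6]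
      refine or_congr_right (and_congr_right fun _ => exists_congr fun w => ?_)
      rw [hS]
      constructor
      · rintro ⟨hw, rfl, hp⟩
        have := ht.lt w hw
        exact ⟨⟨by omega, hp⟩, hw, rfl⟩
      · rintro ⟨⟨-, hp⟩, hw, h⟩
        exact ⟨hw, h, hp⟩
    have hin : InPendantPath G v → v ∉ S m ∧ S (m + 1) = insert v (S m) ∧ v ≠ r := by
      intro hp
      refine ⟨fun hvS => ?_, ?_, ?_⟩
      · have := ((hS _ _).1 hvS).1; omega
      · ext x
        rw [Finset.mem_insert, hS, hS, hpos]
        constructor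
        · rintro ⟨h | h, h'⟩
          · exact .inl h
          · exact .inr ⟨h, h'⟩
        · rintro (rfl | ⟨h, h'⟩)
          · exact ⟨.inl rfl, hp⟩
          · exact ⟨.inr h, h'⟩
      · rintro rfl
        have h1 := hpend.1 hp
        rw [hadj.length_eq] at h1
        omega
    have hout : ¬ InPendantPath G v → S (m + 1) = S m := by
      intro hp
      ext x
      rw [hS, hS, hpos]
      constructor
      · rintro ⟨h | h, h'⟩
        · exact absurd (h ▸ h') hp
        · exact ⟨h, h'⟩
      · rintro ⟨h, h'⟩
        exact ⟨.inr h, h'⟩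
    obtain ⟨τ', hτ'⟩ : ∃ τ', τ' = (τ.setReg 3 (n - m - 1)).setReg 7 v := ⟨_, rfl⟩
    -- `b` stands for the cost of the tests on the way to the removal.
    have hremove : InPendantPath G v → ∀ b, b ≤ 40 → Halts removePendant τ' fun ρ t =>
        (HoldsTree adj r pos par ρ ∧ ρ.reg 3 = n - (m + 1) ∧
        ρ.reg 9 = n - (S (m + 1)).card ∧ ∀ x : Fin n, ρ.arr 6 x = 1 ↔
          ∃ w ∈ S (m + 1), w ≠ r ∧ par w = x) ∧ b + t ≤ 60 := by
      intro hp b hb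
      obtain ⟨h1, h2, h3'⟩ := hin hp
      have hpar := hT.arr3 v h3'
      simp only [removePendant, Halts.seq_iff, Halts.assign_iff, Halts.write_iff]
      subst hτ'
      refine ⟨⟨hT.congr (by simp) fun a ha => ?_, by simp; omega, ?_, fun x => ?_⟩, by
        simp only [Expr.cost]; omega⟩
      · have : a ≠ 6 := by omega
        simp [this]
      · rw [h2, Finset.card_insert_of_notMem h1]
        simp [h9]; omega
      · rw [h2]
        simp only [Store.setReg_arr, Store.setArr_arr, Expr.eval, Store.setReg_reg, Nat.reduceEqDiff,
          if_true, if_false, hpar, Finset.mem_insert, exists_eq_or_imp]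
        by_cases hx : par v = x
        · subst hx
          simp [h3']
        · have : x.val ≠ (par v).val := fun h => hx (Fin.ext h).symm
          rw [Function.update_of_ne this, hm6]
          simp [hx]
    have hkeep : ¬ InPendantPath G v →
        HoldsTree adj r pos par τ' ∧ τ'.reg 3 = n - (m + 1) ∧
        τ'.reg 9 = n - (S (m + 1)).card ∧ ∀ x : Fin n, τ'.arr 6 x = 1 ↔
          ∃ w ∈ S (m + 1), w ≠ r ∧ par w = x := by
      intro hp
      subst hτ'
      rw [hout hp]
      exact ⟨hT.congr (by simp) fun a ha => by simp, by simp; omega, by simpa using h9,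
        by simpa using hm6⟩
    simp only [Halts.seq_iff, Halts.assign_iff, Expr.eval, h3, Store.setReg_arr, Store.setReg_reg,
      if_true, hv4, ← hτ', Halts.ite_iff, Halts.skip_iff, Test.holds]
    simp only [hlen]
    refine ⟨fun h1 => ?_, fun h1 => ⟨fun h2 => ⟨fun h3 => ?_, fun h3 => ?_⟩, fun h2 => ?_⟩⟩
    · refine (hremove (hpend.2 (.inl (by omega))) 30 (by omega)).mono fun ρ t h => ?_
      refine ⟨h.1, ?_⟩
      have := h.2
      simp only [Test.cost, Expr.cost]; omega
    · refine (hremove (hpend.2 (.inr ⟨by omega, h3⟩)) 40 (by omega)).mono fun ρ t h => ?_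
      refine ⟨h.1, ?_⟩
      have := h.2
      simp only [Test.cost, Expr.cost]; omega
    · have hp : ¬ InPendantPath G v := fun hp => by
        rcases hpend.1 hp with h | h
        · omega
        · exact h3 h.2
      subst hτ'
      exact ⟨hkeep hp, by simp⟩
    · have hp : ¬ InPendantPath G v := fun hp => by
        rcases hpend.1 hp with h | h <;> omega
      subst hτ'
      exact ⟨hkeep hp, by simp⟩
  · have h0 : S 0 = ∅ := by
      ext x
      have := h.le x
      simp only [hS, Finset.notMem_empty, iff_false]
      omega
    rw [h0]
    exact ⟨h.congr (by simp) fun a ha => by simp, by simp [h.input.reg0], by simp [h.input.reg0],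
      by simp [h6]⟩
  · rintro τ t ⟨⟨hT, -, h9, hm6⟩, ht'⟩
    have hn : ∀ x, x ∈ S n ↔ InPendantPath G x := fun x => by
      have := h.le x
      rw [hS, Nat.sub_self]
      exact and_iff_right this.1
    refine ⟨⟨hT, fun x => ?_⟩, ?_, ?_⟩
    · rw [hm6]
      simp only [HasPendantChild, hn]
      exact exists_congr fun w => by tauto
    · rw [h9]
      congr 2
      ext x
      simp [hn, pendantVertices]
    · simp only [Finset.sum_const, Finset.card_range, smul_eq_mul, Test.cost, Expr.cost] at ht' ⊢
      omega

end PendantMarks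

/-! ### Climbing to the common ancestor -/

section Climbing

variable {V : Type u} {G : SimpleGraph V} {r : V} {pos : V → ℕ} {par : V → V}

namespace IsClimb

/-- The constructor of `IsClimb` extends a climb at its top, whereas the program moves the lower
end; this lemma and `snoc` work at the lower end. -/
theorem snoc_cases {u a : V} {l : List V} (h : IsClimb r par u a l) :
    (l = [] ∧ u = a) ∨ ∃ l', l = l' ++ [u] ∧ u ≠ r ∧ IsClimb r par (par u) a l' := by
  induction h with
  | nil => exact .inl ⟨rfl, rfl⟩
  | @cons x l _ hx ih =>
    right
    rcases ih with ⟨rfl, rfl⟩ | ⟨l', rfl, h1, h2⟩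
    · exact ⟨[], rfl, hx, .nil⟩
    · exact ⟨x :: l', rfl, h1, h2.cons hx⟩

theorem snoc {u a : V} {l : List V} (h : IsClimb r par (par u) a l) (hu : u ≠ r) :
    IsClimb r par u a (l ++ [u]) := by
  generalize hv : par u = v at h
  induction h with
  | nil => exact hv ▸ .cons .nil hu
  | cons _ hx ih => exact ih.cons hx

theorem pos_le_of_mem {u a : V} {l : List V} (h : IsClimb r par u a l)
    (ht : IsSearchTree G r pos par) : ∀ x ∈ a :: l, pos x ≤ pos u := by
  induction h with
  | nil => simp
  | cons h hx ih =>
    intro y hy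
    rcases List.mem_cons.1 hy with rfl | hy
    · exact (h.cons hx).pos_le ht
    · exact ih y hy

/-- A nonempty climb ends with `u`, which would then also be in the other climb or equal to `m`,
against the absence of repetitions. -/
theorem eq_nil_of_eq {u m : V} {A B : List V} (hA : IsClimb r par u m A)
    (hB : IsClimb r par u m B.reverse) (hnd : (m :: (A ++ B)).Nodup) : A = [] ∧ B = [] := by
  rcases hA.snoc_cases with ⟨rfl, rfl⟩ | ⟨A', rfl, -, -⟩ <;>
    rcases hB.snoc_cases with ⟨h1, h2⟩ | ⟨B', h1, -, -⟩
  · exact ⟨rfl, List.reverse_eq_nil_iff.1 h1⟩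
  · rw [List.reverse_eq_iff] at h1
    subst h1
    simp at hnd
  · subst h2
    simp at hnd
  · rw [List.reverse_eq_iff] at h1
    subst h1
    simp [List.nodup_append] at hnd

end IsClimb

/-- As in the program, the later of the two vertices is replaced by its parent. It is not on the
paths of the smaller instance, where all vertices come before it. -/
theorem IsSearchTree.exists_climbs (ht : IsSearchTree G r pos par) (u w : V) :
    ∃ m A B, IsClimb r par u m A ∧ IsClimb r par w m B.reverse ∧ (m :: (A ++ B)).Nodup := by
  obtain ⟨N, hN⟩ : ∃ N, pos u + pos w = N := ⟨_, rfl⟩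
  induction N using Nat.strong_induction_on generalizing u w with
  | _ N ih =>
    have hne : ∀ {x y : V}, pos x < pos y → y ≠ r := fun {x y} hxy hy => by
      have := ht.root_le x
      rw [hy] at hxy
      omega
    rcases lt_trichotomy (pos w) (pos u) with h | h | h
    · have hu := hne h
      have hlt := ht.lt u hu
      obtain ⟨m, A, B, hA, hB, hnd⟩ := ih _ (by omega) (par u) w rfl
      refine ⟨m, A ++ [u], B, hA.snoc hu, hB, ?_⟩
      have h1 : u ∉ m :: (A ++ B) := by
        intro hm
        rcases List.mem_cons.1 hm with rfl | hm
        · have := hA.pos_le ht; omega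
        · rcases List.mem_append.1 hm with hm | hm
          · have := hA.pos_le_of_mem ht u (by simp [hm]); omega
          · have := hB.pos_le_of_mem ht u (by simp [hm]); omega
      have : (m :: (A ++ [u] ++ B)).Perm (u :: m :: (A ++ B)) := by
        rw [List.append_assoc]
        exact (List.perm_middle.cons m).trans (List.Perm.swap _ _ _)
      exact this.nodup_iff.2 (List.nodup_cons.2 ⟨h1, hnd⟩)
    · obtain rfl := ht.inj h
      exact ⟨w, [], [], .nil, .nil, by simp⟩
    · have hw := hne h
      have hlt := ht.lt w hw
      obtain ⟨m, A, B, hA, hB, hnd⟩ := ih _ (by omega) u (par w) rfl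
      refine ⟨m, A, w :: B, hA, by rw [List.reverse_cons]; exact hB.snoc hw, ?_⟩
      have h1 : w ∉ m :: (A ++ B) := by
        intro hm
        rcases List.mem_cons.1 hm with rfl | hm
        · have := hB.pos_le ht; omega
        · rcases List.mem_append.1 hm with hm | hm
          · have := hA.pos_le_of_mem ht w (by simp [hm]); omega
          · have := hB.pos_le_of_mem ht w (by simp [hm]); omega
      have : (m :: (A ++ w :: B)).Perm (w :: m :: (A ++ B)) :=
        (List.perm_middle.cons m).trans (List.Perm.swap _ _ _)
      exact this.nodup_iff.2 (List.nodup_cons.2 ⟨h1, hnd⟩)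

end Climbing

/-! ### The walk around a fundamental cycle -/

section Walks

variable {n : ℕ} {G : SimpleGraph (Fin n)} {adj : Fin n → List (Fin n)} {r : Fin n}
  {pos : Fin n → ℕ} {par : Fin n → Fin n}

/-- The array `f` holds the list `L` from the position `lo` on. -/
def HoldsList (f : ℕ → ℕ) (lo : ℕ) (L : List (Fin n)) : Prop :=
  ∀ i (hi : i < L.length), f (lo + i) = (L[i] : Fin n)

theorem HoldsList.cons {f : ℕ → ℕ} {lo : ℕ} {L : List (Fin n)} (h : HoldsList f (lo + 1) L)
    (x : Fin n) : HoldsList (Function.update f lo x) lo (x :: L) := by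
  intro i hi
  cases i with
  | zero => simp
  | succ i =>
    rw [Function.update_of_ne (by omega), List.getElem_cons_succ, ← h i (by simpa using hi)]
    congr 1; ring

theorem HoldsList.snoc {f : ℕ → ℕ} {lo : ℕ} {L : List (Fin n)} (h : HoldsList f lo L)
    (x : Fin n) : HoldsList (Function.update f (lo + L.length) x) lo (L ++ [x]) := by
  intro i hi
  rw [List.length_append, List.length_singleton] at hi
  rcases Nat.lt_succ_iff_lt_or_eq.1 hi with hi | rfl
  · rw [Function.update_of_ne (by omega), List.getElem_append_left hi, h i hi]
  · simp

/-- Walk from the vertices in the registers `7` and `8` to their lowest common ancestor. The vertices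
on the way are put into array `5`, at the positions from register `12` to register `13`; their number
without the common ancestor is in register `14`. -/
def walk : Prog :=
  .seq (.assign 10 (.reg 7))
  (.seq (.assign 11 (.reg 8))
  (.seq (.assign 12 (.reg 0))
  (.seq (.assign 13 (.reg 0))
  (.seq (.assign 14 (.const 0))
  (.seq (.assign 15 (.const 0))
  (.seq
    (.while (.eq (.reg 15) (.const 0))
      (.ite (.eq (.reg 10) (.reg 11))
        (.assign 15 (.const 1))
        (.ite (.lt (.read 2 (.reg 11)) (.read 2 (.reg 10)))
          (.seq (.assign 12 (.pred (.reg 12)))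
          (.seq (.write 5 (.reg 12) (.reg 10))
          (.seq (.assign 10 (.read 3 (.reg 10)))
            (.assign 14 (.succ (.reg 14))))))
          (.seq (.write 5 (.reg 13) (.reg 11))
          (.seq (.assign 13 (.succ (.reg 13)))
          (.seq (.assign 11 (.read 3 (.reg 11)))
            (.assign 14 (.succ (.reg 14)))))))))
  (.seq (.write 5 (.reg 13) (.reg 10))
    (.assign 13 (.succ (.reg 13))))))))))

/-- The state of the walk: `A` and `B` are the paths to the common ancestor `m`, the vertices in `A₁`
and `B₁` have been visited, and the walk is in `a` and `b`. -/
structure IsWalkState (G : SimpleGraph (Fin n)) (adj : Fin n → List (Fin n)) (r : Fin n)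
    (pos : Fin n → ℕ) (par : Fin n → Fin n) (m : Fin n) (A B : List (Fin n))
    (a b : Fin n) (A₁ A₂ B₁ B₂ : List (Fin n)) (τ : Store) : Prop where
  eqA : A = A₂ ++ A₁
  eqB : B = B₁ ++ B₂
  climbA : IsClimb r par a m A₂
  climbB : IsClimb r par b m B₂.reverse
  marks : HoldsMarks G adj r pos par τ
  reg10 : τ.reg 10 = a
  reg11 : τ.reg 11 = b
  reg12 : τ.reg 12 + A₁.length = n
  reg13 : τ.reg 13 = τ.reg 12 + (A₁ ++ B₁).length
  reg14 : τ.reg 14 = A₁.length + B₁.length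
  buffer : HoldsList (τ.arr 5) (τ.reg 12) (A₁ ++ B₁)

/-- The end with the later position moves; it is not yet at `m`, which comes no later than the other
end. So the time is bounded by the length of the cycle and not by the depth of the tree. -/
theorem halts_walk {σ : Store} (h : HoldsMarks G adj r pos par σ) (ht : IsSearchTree G r pos par)
    {v w m : Fin n} {A B : List (Fin n)} (hA : IsClimb r par v m A)
    (hB : IsClimb r par w m B.reverse) (hnd : (m :: (A ++ B)).Nodup)
    (h7 : σ.reg 7 = v) (h8 : σ.reg 8 = w) :
    Halts walk σ fun τ t => HoldsMarks G adj r pos par τ ∧ τ.reg 6 = σ.reg 6 ∧ τ.reg 7 = v ∧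
      τ.reg 9 = σ.reg 9 ∧ τ.reg 14 = A.length + B.length ∧
      τ.reg 13 = τ.reg 12 + (A.length + B.length + 1) ∧
      HoldsList (τ.arr 5) (τ.reg 12) (A ++ B ++ [m]) ∧ t ≤ 40 * (A.length + B.length) + 80 := by
  -- The buffer starts at position `n` and grows downwards by the vertices of `A`, so register `12`
  -- is positive whenever it is decreased.
  have hlenA : A.length ≤ n := by
    have := (List.nodup_append.1 (List.nodup_cons.1 hnd).2).1.length_le_card
    rwa [Fintype.card_fin] at this
  simp only [walk, Halts.seq_iff, Halts.assign_iff]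
  refine (Halts.while_rule (fun τ t => ∃ a b A₁ A₂ B₁ B₂,
    IsWalkState G adj r pos par m A B a b A₁ A₂ B₁ B₂ τ ∧ (τ.reg 15 = 0 ∨ (τ.reg 15 = 1 ∧ a = b)) ∧
    τ.reg 6 = σ.reg 6 ∧ τ.reg 7 = v ∧ τ.reg 9 = σ.reg 9 ∧
    t ≤ 40 * (A₁.length + B₁.length + τ.reg 15))
    -- Register `15` flags the end; until then each round uses up one vertex of `A` or `B`.
    (fun τ => 1 - τ.reg 15 + (A.length + B.length - τ.reg 14)) ?_ ?_ ?_).mono ?_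
    (Q := fun τ t => ∃ a b A₁ A₂ B₁ B₂,
      IsWalkState G adj r pos par m A B a b A₁ A₂ B₁ B₂ τ ∧ a = b ∧
      τ.reg 6 = σ.reg 6 ∧ τ.reg 7 = v ∧ τ.reg 9 = σ.reg 9 ∧ t ≤ 40 * (A.length + B.length) + 44)
  · rintro τ t ⟨a, b, A₁, A₂, B₁, B₂, hs, h15, h6, h7', h9, htime⟩ hb
    have h15' : τ.reg 15 = 0 := by simpa using hb
    have hl1 : A.length = A₂.length + A₁.length := by rw [hs.eqA, List.length_append]
    have hl2 : B.length = B₁.length + B₂.length := by rw [hs.eqB, List.length_append]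
    have h10 := hs.reg10
    have h11 := hs.reg11
    have h12 := hs.reg12
    have h13 := hs.reg13
    have h14 := hs.reg14
    have hpa := hs.marks.tree.arr2 a
    have hpb := hs.marks.tree.arr2 b
    rw [List.length_append] at h13
    simp only [Halts.ite_iff, Halts.seq_iff, Halts.assign_iff, Halts.write_iff]
    refine ⟨fun hab => ?_, fun hab => ⟨fun hlt => ?_, fun hlt => ?_⟩⟩
    · have hab : a = b := Fin.ext (by simpa [h10, h11] using hab)
      refine ⟨⟨a, b, A₁, A₂, B₁, B₂, ⟨hs.eqA, hs.eqB, hs.climbA, hs.climbB,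
        hs.marks.congr (by simp) (by simp), by simp [h10], by simp [h11], by simpa using h12,
        by simp [h13], by simpa using h14, by simpa using hs.buffer⟩, by simp [hab], by simpa using h6,
        by simpa using h7', by simpa using h9, ?_⟩, by simp [h15']⟩
      simp only [Store.setReg_reg, if_true, Test.cost, Expr.cost, Expr.eval]
      omega
    · have hlt : pos b < pos a := by simpa [h10, h11, hpa, hpb] using hlt
      rcases hs.climbA.snoc_cases with ⟨-, h⟩ | ⟨A₃, h1, har, h2⟩
      · have := hs.climbB.pos_le ht
        rw [h] at hlt
        omega
      have hla : A₂.length = A₃.length + 1 := by rw [h1]; simp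
      have hpar := hs.marks.tree.arr3 a har
      refine ⟨⟨par a, b, a :: A₁, A₃, B₁, B₂, ⟨?_, hs.eqB, h2, hs.climbB,
        hs.marks.congr (by simp) fun x hx => by simp [hx], by simp [h10, hpar], by simp [h11], ?_, ?_, ?_,
        ?_⟩, by simp [h15'], by simpa using h6,
        by simpa using h7', by simpa using h9, ?_⟩, by simp [h15', h14]; omega⟩
      · rw [hs.eqA, h1]; simp
      · simp; omega
      · simp [h13]; omega
      · simp [h14]; omega
      · have hbuf := hs.buffer
        obtain ⟨lo, hlo⟩ : ∃ lo, τ.reg 12 = lo + 1 := ⟨τ.reg 12 - 1, by omega⟩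
        rw [hlo] at hbuf
        simpa [hlo, h10] using hbuf.cons a
      · simp [h15']; omega
    · have hlt : pos a < pos b := by
        have h1 : ¬ pos b < pos a := by simpa [h10, h11, hpa, hpb] using hlt
        refine lt_of_le_of_ne (not_lt.1 h1) fun he => hab ?_
        simp [h10, h11, ht.inj he]
      rcases hs.climbB.snoc_cases with ⟨-, h⟩ | ⟨B₃, h1, hbr, h2⟩
      · have := hs.climbA.pos_le ht
        rw [h] at hlt
        omega
      rw [List.reverse_eq_iff, List.reverse_append, List.reverse_singleton] at h1
      have hlb : B₂.length = B₃.length + 1 := by rw [h1]; simp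
      have hpar := hs.marks.tree.arr3 b hbr
      refine ⟨⟨a, par b, A₁, A₂, B₁ ++ [b], B₃.reverse, ⟨hs.eqA, ?_, hs.climbA, by simpa using h2,
        hs.marks.congr (by simp) fun x hx => by simp [hx], by simp [h10], by simp [h11, hpar], ?_, ?_, ?_,
        ?_⟩, by simp [h15'], by simpa using h6,
        by simpa using h7', by simpa using h9, ?_⟩, by simp [h15', h14]; omega⟩
      · rw [hs.eqB, h1]; simp
      · simpa using h12
      · simp [h13]; omega
      · simp [h14]; omega
      · have hbuf := hs.buffer.snoc b
        simpa [hs.reg13, h11] using hbuf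
      · simp [h15']; omega
  · refine ⟨v, w, [], A, [], B, ⟨by simp, by simp, hA, hB, h.congr (by simp) (by simp), by simp [h7],
      by simp [h8], by simp [h.tree.input.reg0], by simp, by simp, ?_⟩, by simp, by simp, by simp [h7],
      by simp, by simp⟩
    intro i hi
    simp at hi
  · rintro τ t ⟨a, b, A₁, A₂, B₁, B₂, hs, h15, h6, h7', h9, htime⟩ hb
    have h15' : τ.reg 15 ≠ 0 := by simpa using hb
    obtain ⟨h15, hab⟩ := h15.resolve_left h15'
    refine ⟨a, b, A₁, A₂, B₁, B₂, hs, hab, h6, h7', h9, ?_⟩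
    have hl1 : A.length = A₂.length + A₁.length := by rw [hs.eqA, List.length_append]
    have hl2 : B.length = B₁.length + B₂.length := by rw [hs.eqB, List.length_append]
    simp only [Test.cost, Expr.cost]
    omega
  · rintro τ t ⟨a, b, A₁, A₂, B₁, B₂, hs, rfl, h6, h7', h9, htime⟩
    obtain ⟨hA₂, hB₂⟩ := hs.climbA.eq_nil_of_eq hs.climbB (by
      refine hnd.sublist (List.Sublist.cons_cons m ?_)
      rw [hs.eqA, hs.eqB]
      exact (List.sublist_append_left _ _).append (List.sublist_append_right _ _))
    have hA' := hs.eqA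
    have hB' := hs.eqB
    have ha := hs.climbA
    rw [hA₂] at ha
    rw [hA₂, List.nil_append] at hA'
    rw [hB₂, List.append_nil] at hB'
    subst hA' hB'
    obtain rfl := ha.eq_of_nil
    have h13 := hs.reg13
    have h14 := hs.reg14
    rw [List.length_append] at h13
    simp only [Halts.write_iff]
    refine ⟨hs.marks.congr (by simp) fun x hx => by simp [hx], by simpa using h6, by simpa using h7',
      by simpa using h9, by simpa using h14, by simp [h13]; omega, ?_, ?_⟩
    · simpa [hs.reg13, hs.reg10] using hs.buffer.snoc m
    · simp only [Expr.cost]; omega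

end Walks

/-! ### The scan of the cycle in the buffer -/

section Scans

variable {n : ℕ} {G : SimpleGraph (Fin n)} {adj : Fin n → List (Fin n)} {r : Fin n}
  {pos : Fin n → ℕ} {par : Fin n → Fin n}

def resetLengths : Prog :=
  .seq (.assign 16 (.const 0)) (.seq (.assign 17 (.const 0)) (.seq (.assign 18 (.const 0))
    (.assign 19 (.const 0))))

/-- Update the lengths in a scan for the vertex in register `22`. -/
def updateLengths : Prog :=
  .ite (.eq (.read 0 (.succ (.reg 22))) (.succ (.succ (.read 0 (.reg 22)))))
    (.seq (.assign 16 (.succ (.reg 16)))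
    (.seq (.assign 17 (.succ (.reg 17)))
    (.seq (.assign 18 (.succ (.reg 18)))
      (.assign 19 (.const 0)))))
    (.ite (.eq (.read 0 (.succ (.reg 22))) (.succ (.succ (.succ (.read 0 (.reg 22))))))
      (.ite (.eq (.read 6 (.reg 22)) (.const 1))
        -- The registers `18`, `17`, `16` are overwritten in this order, because the new values use
        -- the old lengths of the stricter windows.
        (.seq
          (.ite (.eq (.reg 19) (.const 1))
            (.assign 18 (.succ (.reg 17)))
            (.assign 18 (.succ (.reg 16))))
        (.seq (.assign 17 (.succ (.reg 16)))
        (.seq (.assign 16 (.const 0))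
          (.assign 19 (.const 1)))))
        resetLengths)
      resetLengths)

/-- Update the maximum in register `20` and the difference in register `9`. -/
def updateBest : Prog :=
  .ite (.lt (.reg 20) (.reg 18))
    (.ite (.lt (.reg 20) (.reg 14))
      (.seq (.assign 20 (.succ (.reg 20))) (.assign 9 (.pred (.reg 9))))
      .skip)
    .skip

def scanPass : Prog :=
  .seq (.assign 21 (.reg 12))
    (.while (.lt (.reg 21) (.reg 13))
      (.seq (.assign 22 (.read 5 (.reg 21)))
      (.seq updateLengths
      (.seq updateBest
        (.assign 21 (.succ (.reg 21)))))))

/-- Go twice through the buffer. -/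
def scanBuffer : Prog :=
  .seq resetLengths (.seq (.assign 20 (.const 0)) (.seq scanPass scanPass))

/-- The store holds the state of a scan, and the maximum has been subtracted from `R`. -/
structure HoldsScan (R : ℕ) (S : Scan) (τ : Store) : Prop where
  f0 : τ.reg 16 = S.f0
  f1 : τ.reg 17 = S.f1
  f2 : τ.reg 18 = S.f2
  p : τ.reg 19 = S.p
  best : τ.reg 20 = S.best
  res : τ.reg 9 = R - S.best

theorem halts_updateLengths {σ : Store} (h : HoldsMarks G adj r pos par σ)
    (hadj : IsAdjacencyList G adj) {R cap : ℕ} {S : Scan} (hS : HoldsScan R S σ) {x : Fin n}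
    (hx : σ.reg 22 = x) :
    Halts updateLengths σ fun τ t =>
      τ.reg 16 = (S.step cap (vertexClass G r par x)).f0 ∧
      τ.reg 17 = (S.step cap (vertexClass G r par x)).f1 ∧
      τ.reg 18 = (S.step cap (vertexClass G r par x)).f2 ∧
      τ.reg 19 = (S.step cap (vertexClass G r par x)).p ∧
      (∀ i ∈ [0, 6, 7, 9, 12, 13, 14, 20, 21], τ.reg i = σ.reg i) ∧ τ.arr = σ.arr ∧ t ≤ 60 := by
  have hlen := h.tree.input.read_succ x
  rw [hadj.length_eq] at hlen
  have h6 := h.arr6 x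
  simp only [updateLengths, resetLengths, Halts.ite_iff, Halts.seq_iff, Halts.assign_iff,
    Test.holds, Expr.eval, hx, Store.setReg_arr, hlen, h6]
  refine ⟨fun h2 => ?_, fun h2 => ⟨fun h3 => ⟨fun hp => ⟨fun h1 => ?_, fun h1 => ?_⟩, fun hp => ?_⟩,
    fun h3 => ?_⟩⟩
  · have hc : vertexClass G r par x = 0 := by rw [vertexClass, if_pos (by omega)]
    simp [Scan.step, hc, hS.f0, hS.f1, hS.f2]
  · have hc : vertexClass G r par x = 1 := by
      rw [vertexClass, if_neg (by omega), if_pos ⟨by omega, hp⟩]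
    rw [hS.p] at h1
    simp [Scan.step, hc, hS.f0, hS.f1, h1]
  · have hc : vertexClass G r par x = 1 := by
      rw [vertexClass, if_neg (by omega), if_pos ⟨by omega, hp⟩]
    rw [hS.p] at h1
    simp [Scan.step, hc, hS.f0, h1]
  · have hc : vertexClass G r par x = 2 := by
      rw [vertexClass, if_neg (by omega), if_neg (fun h => hp h.2)]
    simp [Scan.step, hc]
  · have hc : vertexClass G r par x = 2 := by
      rw [vertexClass, if_neg (by omega), if_neg (fun h => by omega)]
    simp [Scan.step, hc]

/-- The scan has already consumed `b` entries, so that the second pass can continue the first one.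
-/
theorem halts_scanPass {σ : Store} (h : HoldsMarks G adj r pos par σ) (hadj : IsAdjacencyList G adj)
    {R cap b : ℕ} {q : ℕ → ℕ} (hS : HoldsScan R (Scan.run cap q b) σ) {L : List (Fin n)}
    (hL : HoldsList (σ.arr 5) (σ.reg 12) L) (h13 : σ.reg 13 = σ.reg 12 + L.length)
    (h14 : σ.reg 14 = cap)
    (hq : ∀ i (hi : i < L.length), q (b + i) = vertexClass G r par L[i]) :
    Halts scanPass σ fun τ t => HoldsScan R (Scan.run cap q (b + L.length)) τ ∧
      (∀ i ∈ [0, 6, 7, 12, 13, 14], τ.reg i = σ.reg i) ∧ τ.arr = σ.arr ∧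
      t ≤ 100 * L.length + 10 := by
  simp only [scanPass, Halts.seq_iff, Halts.assign_iff]
  refine (Halts.for_rule L.length (fun i τ => HoldsScan R (Scan.run cap q (b + i)) τ ∧
    τ.reg 21 = σ.reg 12 + i ∧ (∀ i ∈ [0, 6, 7, 12, 13, 14], τ.reg i = σ.reg i) ∧
    τ.arr = σ.arr) (fun _ => 100) ?_ ?_ ?_).mono ?_
  · rintro i τ hi ⟨-, h21, hr, -⟩
    have := hr 13 (by simp)
    simp only [Test.holds, Expr.eval]
    omega
  · rintro i τ hi ⟨hT, h21, hr, ha⟩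
    simp only [Halts.seq_iff, Halts.assign_iff]
    have hm : HoldsMarks G adj r pos par τ := h.congr (hr 0 (by simp)) fun a _ => by rw [ha]
    refine (halts_updateLengths (cap := cap) (R := R) (S := Scan.run cap q (b + i)) (x := L[i])
      (hm.congr (by simp) (by simp)) hadj ⟨by simp [hT.f0], by simp [hT.f1],
        by simp [hT.f2], by simp [hT.p], by simp [hT.best], by simp [hT.res]⟩
      (by simp [h21, ha, hL i hi])).mono ?_
    rintro ρ t ⟨hf0, hf1, hf2, hp, hrρ, haρ, ht⟩
    rw [← hq i hi] at hf0 hf1 hf2 hp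
    have h20 := hrρ 20 (by simp)
    have h9 := hrρ 9 (by simp)
    have h14' := hrρ 14 (by simp)
    have h14'' := hr 14 (by simp)
    have h21' := hrρ 21 (by simp)
    simp only [Store.setReg_reg, Nat.reduceEqDiff, if_false, hT.best, hT.res, h14'', h14] at h20 h9 h14' h21'
    have hstep : (Scan.run cap q (b + (i + 1))) = (Scan.run cap q (b + i)).step cap (q (b + i)) := rfl
    have hb : ((Scan.run cap q (b + i)).step cap (q (b + i))).best =
        if (Scan.run cap q (b + i)).best < ((Scan.run cap q (b + i)).step cap (q (b + i))).f2 ∧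
          (Scan.run cap q (b + i)).best < cap then
          (Scan.run cap q (b + i)).best + 1 else (Scan.run cap q (b + i)).best := rfl
    have hreg : ∀ i ∈ [0, 6, 7, 12, 13, 14], ρ.reg i = σ.reg i := by
      intro i hi
      rw [← hr i hi, hrρ i (by simp at hi ⊢; omega), Store.setReg_reg, if_neg (by simp at hi; omega)]
    simp only [updateBest, Halts.ite_iff, Halts.seq_iff, Halts.assign_iff, Halts.skip_iff,
      Test.holds, Expr.eval, h20, hf2, h14']
    have harr : ρ.arr = σ.arr := by rw [haρ]; simp [ha]
    simp only [hstep]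
    refine ⟨fun h1 => ⟨fun h2 => ?_, fun h2 => ?_⟩, fun h1 => ?_⟩
    · rw [if_pos ⟨h1, h2⟩] at hb
      refine ⟨⟨⟨by simp [hf0], by simp [hf1], by simp [hf2], by simp [hp], by simp [hb],
        by simp [hb, h9]; omega⟩, by simp [h21', h21]; omega, by simpa using hreg, by simpa using harr⟩,
        by simp [Expr.cost]; omega⟩
    · rw [if_neg (fun h => h2 h.2)] at hb
      refine ⟨⟨⟨by simp [hf0], by simp [hf1], by simp [hf2], by simp [hp], by simp [hb, h20],
        by simp [hb, h9]⟩, by simp [h21', h21]; omega, by simpa using hreg, by simpa using harr⟩,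
        by simp [Expr.cost]; omega⟩
    · rw [if_neg (fun h => h1 h.1)] at hb
      refine ⟨⟨⟨by simp [hf0], by simp [hf1], by simp [hf2], by simp [hp], by simp [hb, h20],
        by simp [hb, h9]⟩, by simp [h21', h21]; omega, by simpa using hreg, by simpa using harr⟩,
        by simp [Expr.cost]; omega⟩
  · exact ⟨⟨by simp [hS.f0], by simp [hS.f1], by simp [hS.f2], by simp [hS.p], by simp [hS.best],
      by simp [hS.res]⟩, by simp, by simp, by simp⟩
  · rintro τ t ⟨⟨hT, -, hr, ha⟩, ht⟩
    refine ⟨hT, hr, ha, ?_⟩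
    simp only [Finset.sum_const, Finset.card_range, smul_eq_mul, Test.cost, Expr.cost] at ht ⊢
    omega

theorem halts_scanBuffer {σ : Store} (h : HoldsMarks G adj r pos par σ) (hadj : IsAdjacencyList G adj)
    {cap : ℕ} {q : ℕ → ℕ} {L : List (Fin n)}
    (hL : HoldsList (σ.arr 5) (σ.reg 12) L) (h13 : σ.reg 13 = σ.reg 12 + L.length)
    (h14 : σ.reg 14 = cap)
    (hq : ∀ i (hi : i < L.length), q i = vertexClass G r par L[i] ∧
      q (L.length + i) = vertexClass G r par L[i]) :
    Halts scanBuffer σ fun τ t => HoldsMarks G adj r pos par τ ∧ τ.reg 6 = σ.reg 6 ∧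
      τ.reg 7 = σ.reg 7 ∧ τ.reg 9 = σ.reg 9 - (Scan.run cap q (2 * L.length)).best ∧
      t ≤ 200 * L.length + 40 := by
  simp only [scanBuffer, resetLengths, Halts.seq_iff, Halts.assign_iff]
  refine (halts_scanPass (R := σ.reg 9) (b := 0) (cap := cap) (q := q) (L := L)
    (h.congr (by simp) (by simp)) hadj
    ⟨by simp [Scan.run], by simp [Scan.run], by simp [Scan.run], by simp [Scan.run], by simp [Scan.run],
      by simp [Scan.run]⟩ (by simpa using hL) (by simpa using h13) (by simpa using h14)
    (fun i hi => by rw [zero_add]; exact (hq i hi).1)).mono ?_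
  rintro τ s ⟨hS, hr, ha, hs⟩
  simp only [List.mem_cons, List.not_mem_nil, or_false, forall_eq_or_imp, forall_eq,
    Store.setReg_reg, Nat.reduceEqDiff, if_false] at hr
  obtain ⟨hr0, hr6, hr7, hr12, hr13, hr14⟩ := hr
  have hm : HoldsMarks G adj r pos par τ := h.congr hr0 fun a _ => by rw [ha]; simp
  refine (halts_scanPass (R := σ.reg 9) (b := L.length) (cap := cap) (q := q) (L := L) hm hadj
    (by simpa using hS) (by rw [ha, hr12]; simpa using hL) (by rw [hr12, hr13, h13])
    (by rw [hr14, h14]) (fun i hi => (hq i hi).2)).mono ?_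
  rintro ρ t ⟨hS', hr', ha', ht⟩
  refine ⟨hm.congr (hr' 0 (by simp)) fun a _ => by rw [ha'], by rw [hr' 6 (by simp), hr6],
    by rw [hr' 7 (by simp), hr7], ?_, ?_⟩
  · rw [hS'.res, two_mul]
  · simp only [Expr.cost]; omega

end Scans

/-! ### All cycles: the sum of their segments and the total time -/

section Edges

theorem exists_getD_zmod_iff {V : Type u} {L : List V} {k : ℕ} (hk : 0 < k) (hL : L.length = k)
    (d x : V) : (∃ i : ZMod k, L.getD i.val d = x) ↔ x ∈ L := by
  have : NeZero k := ⟨hk.ne'⟩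
  constructor
  · rintro ⟨i, rfl⟩
    rw [List.getD_eq_getElem _ _ (hL ▸ ZMod.val_lt i)]
    exact List.getElem_mem _
  · intro hx
    obtain ⟨i, hi, rfl⟩ := List.getElem_of_mem hx
    exact ⟨i, by rw [ZMod.val_natCast_of_lt (hL ▸ hi), List.getD_eq_getElem _ _ hi]⟩

/-- The buffer ends with the common ancestor and the cycle starts with it, so entry `i` of the
buffer is vertex `i + 1` of the cycle, modulo its length. -/
theorem getD_succ_zmod {V : Type u} (L : List V) (m : V) {i : ℕ} (hi : i < (L ++ [m]).length) :
    (m :: L).getD ((0 + 1 + (i : ZMod (L.length + 1))).val) m = (L ++ [m])[i] := by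
  rw [List.length_append, List.length_singleton] at hi
  have hcast : (0 + 1 + (i : ZMod (L.length + 1))) = ((i + 1 : ℕ) : ZMod (L.length + 1)) := by
    push_cast; ring
  rw [hcast]
  rcases Nat.lt_succ_iff_lt_or_eq.1 hi with h | rfl
  · rw [ZMod.val_natCast_of_lt (by omega), List.getElem_append_left h, List.getD_cons_succ,
      List.getD_eq_getElem _ _ h]
  · simp

variable {n : ℕ} {G : SimpleGraph (Fin n)} {adj : Fin n → List (Fin n)} {r : Fin n}
  {pos : Fin n → ℕ} {par : Fin n → Fin n} {F : Fin n → Fin n → Finset (Fin n)}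

def processEdge : Prog := .seq walk scanBuffer

/-- Process the back edges in the list of the vertex in register `7`. -/
def processList : Prog :=
  .while (.lt (.reg 6) (.read 0 (.succ (.reg 7))))
    (.seq (.assign 8 (.read 1 (.reg 6)))
    (.seq
      (.ite (.lt (.read 2 (.reg 8)) (.read 2 (.reg 7)))
        (.ite (.eq (.read 3 (.reg 7)) (.reg 8)) .skip processEdge)
        .skip)
      (.assign 6 (.succ (.reg 6)))))

/-- Subtract from register `9` the maximum sizes of the feasible segments of all cycles. -/
def processGraph : Prog :=
  .seq (.assign 7 (.const 0))
    (.while (.lt (.reg 7) (.reg 0))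
      (.seq (.assign 6 (.read 0 (.reg 7)))
      (.seq processList
        (.assign 7 (.succ (.reg 7))))))

/-- `C` is the vertex set of the cycle which the edge `uw` closes with the tree. -/
def IsFundSet {V : Type u} (r : V) (par : V → V) (u w : V) (C : Finset V) : Prop :=
  ∃ m A B, IsClimb r par u m A ∧ IsClimb r par w m B.reverse ∧ (m :: (A ++ B)).Nodup ∧
    ∀ x, x ∈ C ↔ x ∈ m :: (A ++ B)

theorem IsSearchTree.exists_isFundSet {V : Type u} {G : SimpleGraph V} {r : V} {pos : V → ℕ}
    {par : V → V} (ht : IsSearchTree G r pos par) (u w : V) : ∃ C, IsFundSet r par u w C := by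
  classical
  obtain ⟨m, A, B, h⟩ := ht.exists_climbs u w
  exact ⟨(m :: (A ++ B)).toFinset, m, A, B, h.1, h.2.1, h.2.2, fun x => List.mem_toFinset⟩

theorem IsFundSet.exists_isFundCycle {V : Type u} {G : SimpleGraph V} {r : V} {pos : V → ℕ}
    {par : V → V} {u w : V} {C : Finset V} (h : IsFundSet r par u w C)
    (ht : IsSearchTree G r pos par) (hb : IsBackEdge G pos par u w) :
    ∃ (k : ℕ) (c : ZMod k → V), IsFundCycle G r par u w c ∧ ∀ x, x ∈ C ↔ ∃ i, c i = x := by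
  obtain ⟨m, A, B, hA, hB, hnd, hm⟩ := h
  refine ⟨_, _, hA.isFundCycle hB ht hb hnd, fun x => ?_⟩
  rw [hm, exists_getD_zmod_iff (by omega) (by simp)]

/-- Walk and scan both take time proportional to the length of the cycle, and `IsRing.best_run_eq`
identifies the result of the scan. -/
theorem halts_processEdge {σ : Store} (h : HoldsMarks G adj r pos par σ)
    (ht : IsSearchTree G r pos par) (hG : G.Connected) (hC : IsCactus G)
    (hadj : IsAdjacencyList G adj) (hr : 3 ≤ (G.neighborSet r).ncard) {v w : Fin n}
    (hb : IsBackEdge G pos par v w) {C : Finset (Fin n)} (hF : IsFundSet r par v w C)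
    (h7 : σ.reg 7 = v) (h8 : σ.reg 8 = w) :
    Halts processEdge σ fun τ t => HoldsMarks G adj r pos par τ ∧ τ.reg 6 = σ.reg 6 ∧ τ.reg 7 = v ∧
      τ.reg 9 = σ.reg 9 - maxFeasible G C ∧ t ≤ 400 * C.card := by
  classical
  obtain ⟨m, A, B, hA, hB, hnd, hm⟩ := hF
  have hcard : C.card = A.length + B.length + 1 := by
    have : C = (m :: (A ++ B)).toFinset := by ext x; rw [hm, List.mem_toFinset]
    rw [this, List.toFinset_card_of_nodup hnd]
    simp
  have hcyc := (hA.isFundCycle hB ht hb hnd).isCyclic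
  obtain ⟨π, hπ⟩ := hC.exists_isRing hG hcyc
  -- The base point `0` is the common ancestor `m`; like the buffer, the scan starts right after it.
  have hbest := hπ.best_run_eq hG hC ht hr
    (fun x => by rw [hm, exists_getD_zmod_iff (by omega) (by simp)]) 0
  simp only [processEdge, Halts.seq_iff]
  refine (halts_walk h ht hA hB hnd h7 h8).mono ?_
  rintro τ s ⟨hτ, h6', h7', h9', h14', h13', hL, hs⟩
  have hlen : (A ++ B ++ [m]).length = A.length + B.length + 1 := by simp [Nat.add_assoc]
  have hq : ∀ i (hi : i < (A ++ B ++ [m]).length),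
      (m :: (A ++ B)).getD (0 + 1 + (i : ZMod (A.length + B.length + 1))).val m =
        (A ++ B ++ [m])[i] := by
    intro i hi
    rw [← List.length_append]
    exact getD_succ_zmod (A ++ B) m hi
  refine (halts_scanBuffer (cap := A.length + B.length + 1 - 1) (q := fun i =>
    vertexClass G r par ((m :: (A ++ B)).getD
      (0 + 1 + (i : ZMod (A.length + B.length + 1))).val m)) hτ hadj hL (by rw [h13', hlen])
    (by rw [h14']; rfl) fun i hi => ⟨?_, ?_⟩).mono ?_
  · rw [hq i hi]
  · rw [← hq i hi, hlen]
    congr 4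
    rw [Nat.cast_add, ZMod.natCast_self, zero_add]
  · rintro ρ t ⟨hρ, h6'', h7'', h9'', ht'⟩
    refine ⟨hρ, by rw [h6'', h6'], by rw [h7'', h7'], ?_, ?_⟩
    · rw [h9'', h9', hlen, ← hbest]
    · rw [hlen] at ht'
      omega

open Classical in
/-- `f u w` if `uw` is a back edge, and `0` otherwise. -/
noncomputable def onBackEdge {V : Type u} (G : SimpleGraph V) (pos : V → ℕ) (par : V → V)
    (f : V → V → ℕ) (u w : V) : ℕ :=
  if IsBackEdge G pos par u w then f u w else 0

theorem halts_processList {σ : Store} (h : HoldsMarks G adj r pos par σ)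
    (ht : IsSearchTree G r pos par) (hG : G.Connected) (hC : IsCactus G)
    (hadj : IsAdjacencyList G adj) (hr : 3 ≤ (G.neighborSet r).ncard)
    (hF : ∀ u w, IsFundSet r par u w (F u w)) {v : Fin n}
    (h7 : σ.reg 7 = v) (h6 : σ.reg 6 = σ.arr 0 v) :
    Halts processList σ fun τ t => HoldsMarks G adj r pos par τ ∧ τ.reg 7 = v ∧
      τ.reg 9 = σ.reg 9 - ∑ w ∈ (adj v).toFinset,
        onBackEdge G pos par (fun u w => maxFeasible G (F u w)) v w ∧
      t ≤ ∑ w ∈ (adj v).toFinset,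
        (60 + 400 * onBackEdge G pos par (fun u w => (F u w).card) v w) + 10 := by
  have hin := h.tree.input
  -- The loop runs over list positions; since the list has no repetitions, its sums are sums over
  -- the neighbours of `v`.
  have hsum : ∀ f : Fin n → ℕ, ∑ i ∈ Finset.range (adj v).length,
      (if hi : i < (adj v).length then f (adj v)[i] else 0) = ∑ w ∈ (adj v).toFinset, f w := by
    intro f
    rw [List.sum_toFinset f (hadj v).1, Finset.sum_range, ← Fin.sum_univ_fun_getElem]
    exact Finset.sum_congr rfl fun i _ => dif_pos i.isLt
  set g := onBackEdge G pos par (fun u w => maxFeasible G (F u w)) v with hg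
  set κ := onBackEdge G pos par (fun u w => (F u w).card) v with hκ
  refine (Halts.for_rule (adj v).length (fun i τ => HoldsMarks G adj r pos par τ ∧
      τ.reg 7 = v ∧ τ.reg 6 = σ.arr 0 v + i ∧ τ.reg 9 = σ.reg 9 -
        ∑ i ∈ Finset.range i, (if hi : i < (adj v).length then g (adj v)[i] else 0))
    (fun i => if hi : i < (adj v).length then 60 + 400 * κ (adj v)[i] else 0) ?_ ?_ ?_).mono ?_
  · rintro i τ hi ⟨hq, h7', h6', -⟩
    have hs := hq.tree.input.read_succ v
    rw [hq.tree.input.arr0, ← hin.arr0] at hs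
    simp only [Test.holds, Expr.eval, h7', h6']
    rw [hq.tree.input.arr0, ← hin.arr0]
    omega
  · rintro i τ hi ⟨hq, h7', h6', h9'⟩
    have he : τ.arr 1 (σ.arr 0 v + i) = ((adj v)[i] : Fin n) := by
      rw [hin.arr0, ← hq.tree.input.arr0, hq.tree.input.read_entry v i hi]
    rw [dif_pos hi, Finset.sum_range_succ, dif_pos hi]
    have hvw : G.Adj v (adj v)[i] := ((hadj v).2 _).1 (List.getElem_mem hi)
    generalize (adj v)[i] = w at he hvw ⊢
    generalize (∑ i ∈ Finset.range i,
      (if hi : i < (adj v).length then g (adj v)[i] else 0)) = D at h9' ⊢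
    have hpw := hq.tree.arr2 w
    have hpv := hq.tree.arr2 v
    simp only [Halts.seq_iff, Halts.ite_iff, Halts.assign_iff, Halts.skip_iff]
    refine ⟨fun h1 => ⟨fun h2 => ?_, fun h2 => ?_⟩, fun h1 => ?_⟩
    · have h1 : pos w < pos v := by simpa [h6', he, h7', hpw, hpv] using h1
      have hvr : v ≠ r := fun hv => by
        have := ht.root_le w
        rw [hv] at h1; omega
      have hpar := hq.tree.arr3 v hvr
      have h2 : par v = w := Fin.ext (by simpa [h6', he, h7', hpar] using h2)
      have hgw : g w = 0 := if_neg fun hb => hb.2.2 h2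
      rw [hgw]
      exact ⟨⟨hq.congr (by simp) (by simp), by simp [h7'], by simp [h6']; ring, by simp [h9']⟩,
        by simp; omega⟩
    · have h1 : pos w < pos v := by simpa [h6', he, h7', hpw, hpv] using h1
      have hvr : v ≠ r := fun hv => by
        have := ht.root_le w
        rw [hv] at h1; omega
      have hpar := hq.tree.arr3 v hvr
      have h2 : par v ≠ w := fun hp => h2 (by simp [h6', he, h7', hpar, hp])
      have hb : IsBackEdge G pos par v w := ⟨hvw, h1, h2⟩
      have hgw : g w = maxFeasible G (F v w) := if_pos hb
      have hκw : κ w = (F v w).card := if_pos hb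
      refine (halts_processEdge (hq.congr (by simp) (by simp)) ht hG hC hadj hr hb (hF v w)
        (by simp [h7']) (by simp [h6', he])).mono ?_
      rintro ρ t ⟨hρ, h6'', h7'', h9'', ht'⟩
      refine ⟨⟨hρ.congr (by simp) (by simp), by simp [h7''], by simp [h6'', h6']; ring, ?_⟩, ?_⟩
      · rw [hgw]
        simp [h9'', h9', Nat.sub_sub]
      · rw [hκw]
        simp only [Test.cost, Expr.cost]
        omega
    · have h1 : ¬ pos w < pos v := by simpa [h6', he, h7', hpw, hpv] using h1
      have hgw : g w = 0 := if_neg fun hb => h1 hb.2.1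
      rw [hgw]
      exact ⟨⟨hq.congr (by simp) (by simp), by simp [h7'], by simp [h6']; ring, by simp [h9']⟩,
        by simp; omega⟩
  · exact ⟨h, h7, h6, by simp⟩
  · rintro τ t ⟨⟨hq, h7', -, h9'⟩, ht'⟩
    rw [hsum g] at h9'
    rw [hsum fun w => 60 + 400 * κ w] at ht'
    exact ⟨hq, h7', h9', ht'.trans (by simp)⟩

theorem sum_onBackEdge (hadj : IsAdjacencyList G adj) (f : Fin n → Fin n → ℕ) :
    ∑ v, ∑ w ∈ (adj v).toFinset, onBackEdge G pos par f v w =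
      ∑ p ∈ backEdges G pos par, f p.1 p.2 := by
  classical
  rw [backEdges, Finset.sum_filter, Fintype.sum_prod_type]
  refine Finset.sum_congr rfl fun v _ => ?_
  simp only [onBackEdge]
  refine (Finset.sum_subset (Finset.subset_univ _) fun w _ hw => if_neg fun hb => hw ?_).trans ?_
  · exact List.mem_toFinset.2 (((hadj v).2 w).2 hb.1)
  · exact Finset.sum_congr rfl fun w _ => by congr

/-- The time is constant per vertex and per list entry, and at most `400 |C|` per cycle;
`sum_degree_le` and `sum_card_fundCycles_le` make the total linear. -/
theorem halts_processGraph {σ : Store} (h : HoldsMarks G adj r pos par σ)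
    (ht : IsSearchTree G r pos par) (hG : G.Connected) (hC : IsCactus G)
    (hadj : IsAdjacencyList G adj) (hr : 3 ≤ (G.neighborSet r).ncard) :
    Halts processGraph σ fun τ t => τ.reg 9 = σ.reg 9 - ∑ C ∈ cycleSets G, maxFeasible G C ∧
      (∑ v, (adj v).length ≤ 4 * n) ∧ t ≤ 2000 * n + 10 := by
  choose F hF using ht.exists_isFundSet
  have hF' : ∀ u w, IsBackEdge G pos par u w → ∃ (k : ℕ) (c : ZMod k → Fin n),
      IsFundCycle G r par u w c ∧ ∀ x, x ∈ F u w ↔ ∃ i, c i = x :=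
    fun u w hb => (hF u w).exists_isFundCycle ht hb
  have hdeg : ∑ v, (adj v).length ≤ 4 * n := by
    have := sum_degree_le ht hG hC hF'
    rw [Fintype.card_fin] at this
    exact (Finset.sum_congr rfl fun v _ => hadj.length_eq v).trans_le this
  have hcyc := sum_card_fundCycles_le ht hG hC hF'
  rw [Fintype.card_fin] at hcyc
  have hext : ∀ f : Fin n → ℕ, ∑ i ∈ Finset.range n, (if hi : i < n then f ⟨i, hi⟩ else 0) =
      ∑ v, f v := fun f => by
    rw [Finset.sum_range]
    exact Finset.sum_congr rfl fun i _ => dif_pos i.isLt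
  let g : Fin n → ℕ := fun v => ∑ w ∈ (adj v).toFinset,
    onBackEdge G pos par (fun u w => maxFeasible G (F u w)) v w
  let κ : Fin n → ℕ := fun v => ∑ w ∈ (adj v).toFinset,
    (60 + 400 * onBackEdge G pos par (fun u w => (F u w).card) v w)
  have hg : ∑ v, g v = ∑ C ∈ cycleSets G, maxFeasible G C := by
    rw [sum_cycleSets_eq ht hG hC hF' (maxFeasible G), ← sum_onBackEdge hadj fun u w => maxFeasible G (F u w)]
  have hκ : ∑ v, κ v = 60 * ∑ v, (adj v).length + 400 * ∑ p ∈ backEdges G pos par, (F p.1 p.2).card := by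
    rw [← sum_onBackEdge hadj (fun u w => (F u w).card), Finset.mul_sum, Finset.mul_sum,
      ← Finset.sum_add_distrib]
    refine Finset.sum_congr rfl fun v _ => ?_
    simp only [κ, Finset.sum_add_distrib, Finset.sum_const, smul_eq_mul, ← Finset.mul_sum,
      List.toFinset_card_of_nodup (hadj v).1]
    ring
  simp only [processGraph, Halts.seq_iff, Halts.assign_iff]
  refine (Halts.for_rule n (fun i τ => HoldsMarks G adj r pos par τ ∧
      τ.reg 7 = i ∧ τ.reg 9 = σ.reg 9 -
        ∑ i ∈ Finset.range i, (if hi : i < n then g ⟨i, hi⟩ else 0))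
    (fun i => if hi : i < n then 60 + κ ⟨i, hi⟩ else 0) ?_ ?_ ?_).mono ?_
  · rintro i τ hi ⟨hq, h7, -⟩
    simp [h7, hq.tree.input.reg0]
  · rintro i τ hi ⟨hq, h7, h9⟩
    rw [dif_pos hi, Finset.sum_range_succ, dif_pos hi]
    simp only [Halts.seq_iff, Halts.assign_iff]
    refine (halts_processList (v := ⟨i, hi⟩) (F := F) (hq.congr (by simp) (by simp)) ht hG hC hadj hr hF
      (by simp [h7]) (by simp [h7])).mono ?_
    rintro ρ t ⟨hρ, h7', h9', ht'⟩
    refine ⟨⟨hρ.congr (by simp) (by simp), by simp [h7'], ?_⟩, ?_⟩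
    · simp [h9', h9, Nat.sub_sub, g]
    · simp only [Test.cost, Expr.cost, κ]
      omega
  · exact ⟨h.congr (by simp) (by simp), by simp, by simp⟩
  · rintro τ t ⟨⟨-, -, h9⟩, ht'⟩
    rw [hext g, hg] at h9
    rw [hext fun v => 60 + κ v, Finset.sum_add_distrib, hκ, Finset.sum_const, Finset.card_univ,
      Fintype.card_fin, smul_eq_mul] at ht'
    refine ⟨h9, hdeg, ?_⟩
    simp only [Test.cost, Expr.cost] at ht' ⊢
    omega

end Edges

/-! ### The whole program -/

section Program

variable {n : ℕ} {G : SimpleGraph (Fin n)} {adj : Fin n → List (Fin n)}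

theorem sum_card_pendantPaths {V : Type u} [Fintype V] (G : SimpleGraph V) :
    ∑ P ∈ pendantPaths G, P.card = (pendantVertices G).card := by
  classical
  have hpp : ∀ P, P ∈ pendantPaths G ↔ IsPendantPath G P := fun P => by simp [pendantPaths]
  have : pendantVertices G = (pendantPaths G).biUnion id := by
    ext v
    simp [pendantVertices, InPendantPath, hpp]
  rw [this, Finset.card_biUnion fun P hP Q hQ hPQ => ?_]
  · rfl
  · rw [Function.onFun, Finset.disjoint_left]
    exact fun z hz hz' => hPQ (((hpp P).1 hP).eq_of_mem ((hpp Q).1 hQ) hz hz')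

/-- Compute the connected power domination number of a connected cactus graph. -/
def cactusProg : Prog :=
  .seq findRoot
    (.ite (.eq (.reg 2) (.const 0))
      (.assign 0 (.const 1))
      (.seq search
      (.seq markPendant
      (.seq processGraph
        (.assign 0 (.reg 9))))))

/-- Without a vertex of degree 3 the graph is a path or a cycle, with answer 1. Otherwise register
`9` is lowered from `n` by the pendant vertices and the maximum segments, and by
`connPowerDomNumber_add` nothing is lost by truncation. -/
theorem halts_cactusProg (hG : G.Connected) (hC : IsCactus G) (hadj : IsAdjacencyList G adj) :
    Halts cactusProg (inputStore adj) fun τ t =>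
      t ≤ 4000 * n ∧ τ.reg 0 = connPowerDomNumber G := by
  obtain ⟨v₀⟩ := hG.nonempty
  -- Since `n` is positive, the additive constants of the phases are absorbed into `4000 * n`.
  have hn : 0 < n := v₀.pos
  simp only [cactusProg, Halts.seq_iff, Halts.ite_iff, Halts.assign_iff]
  refine (halts_findRoot adj).mono ?_
  rintro σ s ⟨ha, h0, hroot, hs⟩
  refine ⟨fun h2 => ?_, fun h2 => ?_⟩
  · have h2 : σ.reg 2 = 0 := by simpa using h2
    rcases hroot with ⟨-, hdeg⟩ | ⟨h2', -⟩
    swap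
    · omega
    refine ⟨by simp only [Test.cost, Expr.cost]; omega, ?_⟩
    have : connPowerDomNumber G = 1 := by
      rcases isPathGraph_or_isCycleGraph hG hC fun v => by
        rw [← hadj.length_eq]; exact hdeg v with h | h
      · exact h.connPowerDomNumber_eq hG
      · exact h.connPowerDomNumber_eq
    simp [this]
  · have h2 : σ.reg 2 ≠ 0 := by simpa using h2
    obtain ⟨-, r, h1, hr⟩ := hroot.resolve_left fun h => h2 h.1
    rw [hadj.length_eq] at hr
    have hin : HoldsInput adj σ := ⟨h0, by rw [ha]; rfl, by rw [ha]; rfl⟩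
    refine (halts_search hin hadj hG h1 fun a j haj => ?_).mono ?_
    · rw [ha]
      have h3 : a ≠ 0 := by omega
      have h4 : a ≠ 1 := by omega
      simp [inputStore, h3, h4]
    rintro τ t ⟨⟨pos, par, ht, hT⟩, hm, htime⟩
    refine (halts_markPendant hT ht hG hadj hr hm).mono ?_
    rintro ρ t' ⟨hM, h9, htime'⟩
    refine (halts_processGraph hM ht hG hC hadj hr).mono ?_
    rintro φ t'' ⟨h9', hdeg, htime''⟩
    have hnp : ¬ (IsPathGraph G ∨ IsCycleGraph G) := by
      rintro (h | h) <;>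
      · have := h.ncard_le r
        omega
    have hnum := connPowerDomNumber_add hG hC hnp
    rw [sum_card_pendantPaths, Fintype.card_fin] at hnum
    refine ⟨by simp only [Test.cost, Expr.cost]; omega, ?_⟩
    simp only [Store.setReg_reg, if_true, Expr.eval, h9', h9]
    omega

end Program

end CactusPD

theorem mainTheorem3 :
    (∀ (V : Type u) [Fintype V] (G : SimpleGraph V), G.Connected → IsCactus G →
      ((IsPathGraph G ∨ IsCycleGraph G) → connPowerDomNumber G = 1) ∧
      (¬ (IsPathGraph G ∨ IsCycleGraph G) →
        (connPowerDomNumber G : ℤ) =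
          (Fintype.card V : ℤ) - ∑ P ∈ pendantPaths G, (P.card : ℤ)
            - ∑ C ∈ cycleSets G, (maxFeasible G C : ℤ)) ∧
      (∀ C ∈ cycleSets G, ∀ S : Finset V, IsSegment G C S →
        (IsFeasible G S ↔ CutVertexCondition G S))) ∧
    (∃ (prog : Prog) (c : ℕ), ∀ (n : ℕ) (G : SimpleGraph (Fin n)), G.Connected → IsCactus G →
      ∀ adj : Fin n → List (Fin n), IsAdjacencyList G adj →
        ∃ (τ : Store) (t : ℕ), Exec prog (inputStore adj) τ t ∧ t ≤ c * n ∧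
          τ.reg 0 = connPowerDomNumber G) := by
  refine ⟨fun V _ G hG hC => ⟨?_, fun hn => ?_, fun C hCC S hS => isFeasible_iff hG hC hCC hS⟩, ?_⟩
  · rintro (h | h)
    · exact h.connPowerDomNumber_eq hG
    · exact h.connPowerDomNumber_eq
  · have h := connPowerDomNumber_add hG hC hn
    have h' : ((connPowerDomNumber G + ∑ P ∈ pendantPaths G, P.card +
      ∑ C ∈ cycleSets G, maxFeasible G C : ℕ) : ℤ) = (Fintype.card V : ℕ) := by rw [h]
    push_cast at h'
    linarith
  · refine ⟨cactusProg, 4000, fun n G hG hC adj hadj => ?_⟩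
    exact halts_cactusProg hG hC hadj
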